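/- Let $\Gamma$ be a finite connected graph (loops and multiple edges allowed) embedded in a closed connected, possibly non-orientable surface $\Sigma$ as the 1-skeleton of a cellular decomposition $X$, with positive edge weights $\mathrm w$ and with vertices numbered $1,\dots,2n$. A *dimer configuration* is a set $D$ of edges with distinct end points such that each vertex is adjacent to exactly one edge of $D$; let $\mathcal D(\Gamma)$ be the set of these, and $Z=\sum_{D\in\mathcal D(\Gamma)}\prod_{e\in D}\mathrm w(e)$. Let $\omega\in C^1(X;\mathbb Z_2)$ be a cocycle representing $w_1(\Sigma)$: the local orientation of $\Sigma$ is preserved along a closed walk in $\Gamma$ if and only if the walk has an even number of 1-edges (edges with $\omega(e)=1$; the others are 0-edges). Then one can choose local orientations $o_x$ of $\Sigma$ at the vertices $x$ of $\Gamma$ such that the transport along an edge $e$ carries the orientation at one end to that at the other if and only if $\omega(e)=0$. Fix any such choice. In the orientation cover $\widetilde\Sigma$, label each lift of a vertex $x$ by $+$ or $-$, so that for the orientation of $\widetilde\Sigma$ near the lift labelled $+$ (resp. $-$) the covering map is compatible with $o_x$ (resp. with $-o_x$). An orientation $K$ of the edges of $\Gamma$ is *Kasteleyn* on $(X,\omega)$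 if, for every face $\widetilde f$ of the lifted decomposition $\widetilde X$, with oriented boundary $\partial\widetilde f$, the number of edges of $\partial\widetilde f$ where the lift of $K$ disagrees with $\partial\widetilde f$, plus the number of edges of $\partial\widetilde f$ joining two vertices labelled $-$, is odd. Two orientations are *equivalent* if they differ by flipping the edges around the vertices of some set of vertices; $\mathcal K(X,\omega)$ is the set of equivalence classes of Kasteleyn orientations. For an orientation $K$, put $\varepsilon^K_{jk}(e)=1$ (resp. $-1$) if the edge $e$ is oriented by $K$ from $j$ to $k$ (resp. from $k$ to $j$), and let $A^{K,\omega}$ be the skew-symmetric $2n\times 2n$ matrix with coefficients $a_{jk}=\sum_e\varepsilon^K_{jk}(e)\,i^{\omega(e)}\,\mathrm w(e)$ for $j\neq k$, the sum being over the edges $e$ between $j$ and $k$. If $D$ consists of edges $e_1,\dots,e_n$, where $e_\ell$ joins $i_\ell$ and $j_\ell$, put $\varepsilon^K(D)=(-1)^\sigma\prod_\ell\varepsilon^K_{i_\ell j_\ell}(e_\ell)$, where $\sigma$ sends $(1,\dots,2n)$ to $(i_1,j_1,\dots,i_n,j_n)$. For a set of edges $S$, let $\omega(S)$ be the number of 1-edges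 in $S$. Then the following holds. 1. For every Kasteleyn orientation $K$ on $(X,\omega)$ and every $D\in\mathcal D(\Gamma)$ there is a unique quadratic enhancement $q^{K,\omega}_D\colon H_1(\Sigma;\mathbb Z_2)\to\mathbb Z_4$ of the intersection form, i.e. a map with $q(x+y)=q(x)+q(y)+2(x\cdot y)$, such that for every oriented simple closed curve $C$ in $\Gamma$ $$q^{K,\omega}_D([C])=2\big(n^K(C)+\ell^\omega_D(C)+1\big)+\omega(D\cap C)-\omega(C\setminus D)\pmod 4,$$ where $n^K(C)$ is the number of edges of $C$ at which $K$ disagrees with the orientation of $C$, and $\ell^\omega_D(C)$ is the number of vertices $x$ of $C$ at which the edge of $D$ adjacent to $x$ is not in $C$ and lies to the left of $C$ with respect to $o_x$. 2. For every $D_0\in\mathcal D(\Gamma)$, $$Z=\frac{(-i)^{\omega(D_0)}}{2^{b_1/2}}\sum_{[K]\in\mathcal K(X,\omega)}\exp(i\pi/4)^{\beta(q^{K,\omega}_{D_0})}\,\varepsilon^K(D_0)\,\mathrm{Pf}(A^{K,\omega}),$$ where $b_1=\dim H_1(\Sigma;\mathbb Z_2)$ and the Brown invariant $\beta(q)\in\mathbb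 Z_8$ is defined by $\exp(i\pi/4)^{\beta(q)}=2^{-b_1/2}\sum_{x\in H_1(\Sigma;\mathbb Z_2)}i^{q(x)}$. 3. For each class $[K]$, the summand does not depend on the representative $K$, and the product of $(-i)^{\omega(D_0)}$ with the summand does not depend on $D_0$. -/

import Mathlib

/-- A finite connected graph embedded in a closed connected (possibly non-orientable) surface
with all complementary regions open discs, i.e. a finite cellular decomposition of the surface
with at least one edge, described by its flags.

`F` is the set of flags, that is, of triangles of the barycentric subdivision: a flag is an
incidence (vertex end of an edge, edge, side of that edge).  Each triangle has three neighbours: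
`t0` changes the vertex end and keeps the edge and the side, `t1` changes the edge and keeps the
vertex and the face (it crosses the segment joining the vertex to the centre of the face),
`t2` changes the side and keeps the edge and its end.
No fixed points of `t0`, `t1`, `t2`: the surface has no boundary.  The laws for `t0` and `t2` say
that every edge is surrounded by exactly four flags.  Loops and multiple edges are allowed. -/
structure SurfaceGraph (F : Type*) where
  t0 : Equiv.Perm F
  t1 : Equiv.Perm F
  t2 : Equiv.Perm F
  t0_t0 : ∀ φ, t0 (t0 φ) = φ
  t1_t1 : ∀ φ, t1 (t1 φ) = φ
  t2_t2 : ∀ φ, t2 (t2 φ) = φ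
  t0_ne : ∀ φ, t0 φ ≠ φ
  t1_ne : ∀ φ, t1 φ ≠ φ
  t2_ne : ∀ φ, t2 φ ≠ φ
  t0_t2 : ∀ φ, t0 (t2 φ) = t2 (t0 φ)
  t0_t2_ne : ∀ φ, t0 (t2 φ) ≠ φ
  nonempty : Nonempty F
  connected : ∀ φ ψ,
    Relation.ReflTransGen (fun a b => b = t0 a ∨ b = t1 a ∨ b = t2 a) φ ψ

namespace SurfaceGraph

noncomputable section

open Classical

variable {F : Type*} (X : SurfaceGraph F)

/-! ### Cells -/

/-- Vertices: classes of flags under `t1`, `t2`. -/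
def Vertex : Type _ := Quot (fun a b : F => b = X.t1 a ∨ b = X.t2 a)

/-- Edges: classes of flags under `t0`, `t2`. -/
def Edge : Type _ := Quot (fun a b : F => b = X.t0 a ∨ b = X.t2 a)

/-- Faces: classes of flags under `t0`, `t1`. -/
def Face : Type _ := Quot (fun a b : F => b = X.t0 a ∨ b = X.t1 a)

/-- The vertex of a flag. -/
def vert (φ : F) : X.Vertex := Quot.mk _ φ

/-- The edge of a flag. -/
def edge (φ : F) : X.Edge := Quot.mk _ φ

/-- The face of a flag. -/
def face (φ : F) : X.Face := Quot.mk _ φ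

lemma vert_t1 (φ : F) : X.vert (X.t1 φ) = X.vert φ := by
  symm
  apply Quot.sound
  exact Or.inl rfl

lemma vert_t2 (φ : F) : X.vert (X.t2 φ) = X.vert φ := by
  symm
  apply Quot.sound
  exact Or.inr rfl

lemma face_t0 (φ : F) : X.face (X.t0 φ) = X.face φ := by
  symm
  apply Quot.sound
  exact Or.inl rfl

/-! ### Orientations of the edges -/

/-- An orientation of the edges: `K φ = 0` if the edge of `φ` is oriented away from the end
carried by `φ`, and `K φ = 1` if it is oriented towards this end. -/
def EdgeOrientation : Type _ :=
  {K : F → ZMod 2 // ∀ φ, K (X.t2 φ) = K φ ∧ K (X.t0 φ) = K φ + 1}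

/-- Two orientations are equivalent if one is obtained from the other by flipping the edges around
each vertex of a set `S` (an edge with both ends in `S` is flipped twice). -/
def Equivalent (K K' : X.EdgeOrientation) : Prop :=
  ∃ S : Set X.Vertex, ∀ φ, K'.1 φ = K.1 φ +
    ((if X.vert φ ∈ S then 1 else 0) + (if X.vert (X.t0 φ) ∈ S then 1 else 0))

lemma equivalent_equivalence : Equivalence X.Equivalent where
  refl K := ⟨∅, fun φ => by simp⟩
  symm := by
    rintro K K' ⟨S, hS⟩
    refine ⟨S, fun φ => ?_⟩
    rw [hS φ, add_assoc, CharTwo.add_self_eq_zero, add_zero]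
  trans := by
    rintro K K' K'' ⟨S, hS⟩ ⟨T, hT⟩
    refine ⟨symmDiff S T, fun φ => ?_⟩
    have key : ∀ v : X.Vertex, (if v ∈ symmDiff S T then (1 : ZMod 2) else 0) =
        (if v ∈ S then 1 else 0) + (if v ∈ T then 1 else 0) := by
      intro v
      have h2 : (1 : ZMod 2) + 1 = 0 := by decide
      by_cases h : v ∈ S <;> by_cases h' : v ∈ T <;> simp [Set.mem_symmDiff, h, h', h2]
    rw [hT φ, hS φ, key, key]
    ring

variable [Fintype F]

instance : Finite X.Vertex := Finite.of_surjective X.vert Quot.mk_surjective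
instance : Finite X.Edge := Finite.of_surjective X.edge Quot.mk_surjective
instance : Finite X.Face := Finite.of_surjective X.face Quot.mk_surjective
instance : Fintype X.Vertex := Fintype.ofFinite _
instance : Fintype X.Edge := Fintype.ofFinite _
instance : Fintype X.Face := Fintype.ofFinite _

/-! ### Cellular homology with coefficients in `ZMod 2` -/

/-- The boundary of an edge: the sum of its two end points. -/
def edgeBoundary : X.Edge → X.Vertex → ZMod 2 :=
  Quot.lift (fun φ => Pi.single (X.vert φ) 1 + Pi.single (X.vert (X.t0 φ)) 1) (by
    rintro a b (rfl | rfl)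
    · simp only [X.t0_t0]
      exact add_comm _ _
    · simp only [X.t0_t2, X.vert_t2])

/-- The boundary map from 1-chains to 0-chains. -/
def bd1 : (X.Edge → ZMod 2) →ₗ[ZMod 2] (X.Vertex → ZMod 2) :=
  ∑ e, (LinearMap.proj e).smulRight (X.edgeBoundary e)

/-- The two faces on the two sides of an edge, evaluated on a 2-chain `z`: the coefficient of the
edge in the boundary of `z`. -/
def faceBoundaryCoeff (z : X.Face → ZMod 2) : X.Edge → ZMod 2 :=
  Quot.lift (fun φ => z (X.face φ) + z (X.face (X.t2 φ))) (by
    rintro a b (rfl | rfl)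
    · simp only [← X.t0_t2, X.face_t0]
    · simp only [X.t2_t2]
      exact add_comm _ _)

/-- The boundary map from 2-chains to 1-chains. -/
def bd2 : (X.Face → ZMod 2) →ₗ[ZMod 2] (X.Edge → ZMod 2) where
  toFun := X.faceBoundaryCoeff
  map_add' x y := by
    funext e
    induction e using Quot.ind
    exact add_add_add_comm _ _ _ _
  map_smul' c x := by
    funext e
    induction e using Quot.ind
    exact (mul_add _ _ _).symm

/-- The 1-cycles modulo 2. -/
abbrev Z1 : Submodule (ZMod 2) (X.Edge → ZMod 2) := LinearMap.ker X.bd1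

/-- The first homology group of the surface with coefficients in `ZMod 2`. -/
abbrev H1 : Type _ := X.Z1 ⧸ (LinearMap.range X.bd2).submoduleOf X.Z1

instance : Finite X.H1 := Finite.of_surjective _ (Submodule.mkQ_surjective _)
instance : Fintype X.H1 := Fintype.ofFinite _

/-- The homology class of a 1-cycle. -/
def homologyClass (x : X.Z1) : X.H1 := Submodule.Quotient.mk x

/-- The first Betti number modulo 2. -/
def b1 : ℕ := Module.finrank (ZMod 2) X.H1

/-! ### The intersection form -/

/-- `y` is a 1-chain of the graph.  A 1-chain `c` of the dual graph (edges of the dual graph are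
indexed by the edges of the graph that they cross) is homologous to `y` in the surface:
some 2-chain `g` of the barycentric subdivision has boundary `y + c`.  Triangles adjacent
through `t2` are separated by half an edge of the graph, through `t0` by half a dual edge. -/
def DualHomologous (y c : X.Edge → ZMod 2) : Prop :=
  ∃ g : F → ZMod 2, ∀ φ, g (X.t1 φ) = g φ ∧
    g (X.t2 φ) = g φ + y (X.edge φ) ∧ g (X.t0 φ) = g φ + c (X.edge φ)

/-- The intersection number modulo 2 of two homology classes: represent the first one by a cycle
`x` in the graph, the second one by a cycle `c` in the dual graph (so that the two cycles are
transverse), and count the crossings.  The result does not depend on the representatives. -/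
def intersection (a b : X.H1) : ZMod 2 :=
  Classical.epsilon fun m => ∃ (x y : X.Z1) (c : X.Edge → ZMod 2),
    X.homologyClass x = a ∧ X.homologyClass y = b ∧ X.DualHomologous y c ∧ m = ∑ e, x.1 e * c e

/-- A quadratic enhancement of the intersection form. -/
def IsQuadraticEnhancement (q : X.H1 → ZMod 4) : Prop :=
  ∀ a b, q (a + b) = q a + q b + 2 * ((X.intersection a b).val : ZMod 4)

/-! ### The first Stiefel-Whitney class -/

/-- Move from a flag to one of its three neighbours. -/
def step : Fin 3 → F → F := ![X.t0, X.t1, X.t2]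

/-- The end point of a path of flags. -/
def pathEnd : F → List (Fin 3) → F
  | φ, [] => φ
  | φ, i :: l => pathEnd (X.step i φ) l

/-- The sum of `ω` over the edges of the graph along which the path of flags travels. -/
def pathSum (ω : X.Edge → ZMod 2) : F → List (Fin 3) → ZMod 2
  | _, [] => 0
  | φ, i :: l => (if i = 0 then ω (X.edge φ) else 0) + pathSum ω (X.step i φ) l

/-- `ω` is a cocycle representing the first Stiefel-Whitney class: the local orientation is
preserved along a closed path if and only if the path runs along an even number of 1-edges.
(Neighbouring triangles are mirror images of each other, so the local orientation is preserved
along a closed path of flags if and only if its number of steps is even.) -/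
def RepresentsW1 (ω : X.Edge → ZMod 2) : Prop :=
  ∀ (φ : F) (l : List (Fin 3)), X.pathEnd φ l = φ → X.pathSum ω φ l = (l.length : ZMod 2)

/-- A choice `o` of local orientations at the vertices which is preserved along an edge `e` if and
only if `ω e = 0`.  The flags with `o φ = 0` are those whose face is on the left of the half-edge
leaving the vertex, for the chosen orientation at this vertex; the alternation of `o` under
`t1`, `t2` says that this is a local orientation.

A vertex of the orientation cover is a vertex `x` with one of its two local orientations; it is
labelled `+` if this is the chosen one, and `-` otherwise.  The orientation of the cover is the
one that restricts to the chosen local orientation near the vertices labelled `+`. -/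
structure IsLabelling (ω : X.Edge → ZMod 2) (o : F → ZMod 2) : Prop where
  t1 : ∀ φ, o (X.t1 φ) = o φ + 1
  t2 : ∀ φ, o (X.t2 φ) = o φ + 1
  t0 : ∀ φ, o (X.t0 φ) = o φ + 1 + ω (X.edge φ)

/-! ### Kasteleyn orientations -/

/-- The Kasteleyn curvature at a face.  The lifts of the faces to the orientation cover are the
faces with a direction of their boundary, that is, the cycles of `t1 * t0`.  In the lift that
contains `φ`, the boundary edges, run through with the face on the left, start at the flags `ψ`
of this cycle, and `o ψ = 0` if and only if the starting vertex is labelled `+`.  The sum counts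
the edges oriented against the boundary, and the edges joining two vertices labelled `-`. -/
def curvature (ω : X.Edge → ZMod 2) (o : F → ZMod 2) (K : X.EdgeOrientation) (φ : F) : ZMod 2 :=
  (∑ ψ ∈ Finset.univ.filter (fun ψ => (X.t1 * X.t0).SameCycle φ ψ),
    (K.1 ψ + if o ψ = 1 ∧ ω (X.edge ψ) = 0 then 1 else 0)) + 1

/-- The Kasteleyn orientations. -/
def Kasteleyn (ω : X.Edge → ZMod 2) (o : F → ZMod 2) : Type _ :=
  {K : X.EdgeOrientation // ∀ φ, X.curvature ω o K φ = 0}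

/-- Equivalence of Kasteleyn orientations. -/
def kasteleynSetoid (ω : X.Edge → ZMod 2) (o : F → ZMod 2) : Setoid (X.Kasteleyn ω o) where
  r K K' := X.Equivalent K.1 K'.1
  iseqv := ⟨fun _ => X.equivalent_equivalence.refl _, X.equivalent_equivalence.symm,
    X.equivalent_equivalence.trans⟩

/-- The set of equivalence classes of Kasteleyn orientations. -/
def KasteleynClass (ω : X.Edge → ZMod 2) (o : F → ZMod 2) : Type _ :=
  Quotient (X.kasteleynSetoid ω o)

instance : Finite X.EdgeOrientation := Subtype.finite
instance (ω : X.Edge → ZMod 2) (o : F → ZMod 2) : Finite (X.Kasteleyn ω o) := Subtype.finite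
instance (ω : X.Edge → ZMod 2) (o : F → ZMod 2) : Finite (X.KasteleynClass ω o) :=
  Quotient.finite _
instance (ω : X.Edge → ZMod 2) (o : F → ZMod 2) : Fintype (X.KasteleynClass ω o) :=
  Fintype.ofFinite _

/-! ### Dimers and Pfaffians -/

/-- The edge `e` has end points `u` and `v`. -/
def Joins (e : X.Edge) (u v : X.Vertex) : Prop :=
  ∃ φ, X.edge φ = e ∧ X.vert φ = u ∧ X.vert (X.t0 φ) = v

/-- Dimer configurations: sets of edges such that each vertex is adjacent to exactly one of them
(edges joining two distinct vertices, as a loop does not match two vertices). -/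
def Dimer : Type _ :=
  {D : Finset X.Edge // (∀ u, ∃! e, e ∈ D ∧ ∃ v, X.Joins e u v) ∧
    ∀ e ∈ D, ∀ u v, X.Joins e u v → u ≠ v}

instance : Finite X.Dimer := Subtype.finite
instance : Fintype X.Dimer := Fintype.ofFinite _

/-- The partition function of the dimer model. -/
def partitionFunction (w : X.Edge → ℝ) : ℝ := ∑ D : X.Dimer, ∏ e ∈ D.1, w e

/-- The number of 1-edges in a dimer configuration. -/
def omegaDimer (ω : X.Edge → ZMod 2) (D : X.Dimer) : ℕ := ∑ e ∈ D.1, (ω e).val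

/-- The edge `e` is oriented by `K` from `u` to `v`. -/
def OrientedFromTo (K : X.EdgeOrientation) (e : X.Edge) (u v : X.Vertex) : Prop :=
  ∃ φ, X.edge φ = e ∧ X.vert φ = u ∧ X.vert (X.t0 φ) = v ∧ K.1 φ = 0

/-- `1` if `e` is oriented from `u` to `v`, and `-1` if it is oriented from `v` to `u`
(and `0` if `e` does not join `u` and `v`, or is a loop). -/
def edgeSign (K : X.EdgeOrientation) (e : X.Edge) (u v : X.Vertex) : ℤ :=
  (if X.OrientedFromTo K e u v then 1 else 0) - (if X.OrientedFromTo K e v u then 1 else 0)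

/-- The complex skew-symmetric Kasteleyn matrix, with respect to a numbering of the vertices: the
weights of the 1-edges are multiplied by `i`. -/
def kasteleynMatrix {n : ℕ} (num : X.Vertex ≃ Fin (2 * n)) (w : X.Edge → ℝ)
    (ω : X.Edge → ZMod 2) (K : X.EdgeOrientation) : Matrix (Fin (2 * n)) (Fin (2 * n)) ℂ :=
  fun j k => ∑ e, (X.edgeSign K e (num.symm j) (num.symm k) : ℂ) *
    Complex.I ^ (ω e).val * (w e : ℂ)

/-- The first element of the `l`-th pair in `Fin (2 * n)`. -/
def fstIdx {n : ℕ} (l : Fin n) : Fin (2 * n) := ⟨2 * l.1, by omega⟩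

/-- The second element of the `l`-th pair in `Fin (2 * n)`. -/
def sndIdx {n : ℕ} (l : Fin n) : Fin (2 * n) := ⟨2 * l.1 + 1, by omega⟩

/-- The Pfaffian of a skew-symmetric matrix (each matching is represented by `2 ^ n * n!`
permutations). -/
def pfaffian {n : ℕ} (A : Matrix (Fin (2 * n)) (Fin (2 * n)) ℂ) : ℂ :=
  (1 / ((2 : ℂ) ^ n * (n.factorial : ℂ))) * ∑ σ : Equiv.Perm (Fin (2 * n)),
    ((Equiv.Perm.sign σ : ℤ) : ℂ) * ∏ l : Fin n, A (σ (fstIdx l)) (σ (sndIdx l))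

/-- The permutation `σ` and the edges `e 0, …, e (n - 1)` list the dimer configuration `D`: the
edge `e l` of `D` joins the vertices numbered `σ (2 l)` and `σ (2 l + 1)`. -/
def Lists {n : ℕ} (num : X.Vertex ≃ Fin (2 * n)) (D : X.Dimer)
    (p : Equiv.Perm (Fin (2 * n)) × (Fin n → X.Edge)) : Prop :=
  ∀ l, p.2 l ∈ D.1 ∧
    X.Joins (p.2 l) (num.symm (p.1 (fstIdx l))) (num.symm (p.1 (sndIdx l)))

/-- The sign of a dimer configuration with respect to an orientation, computed from any list of
the dimers. -/
def dimerSign {n : ℕ} (num : X.Vertex ≃ Fin (2 * n)) (K : X.EdgeOrientation) (D : X.Dimer) : ℤ :=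
  if h : ∃ p, X.Lists num D p then
    (Equiv.Perm.sign h.choose.1 : ℤ) * ∏ l : Fin n, X.edgeSign K (h.choose.2 l)
      (num.symm (h.choose.1 (fstIdx l))) (num.symm (h.choose.1 (sndIdx l)))
  else 0

/-! ### The quadratic enhancement of a Kasteleyn orientation and a dimer configuration -/

/-- An oriented simple closed curve in the graph.  The `i`-th edge starts at the half-edge of the
flag `dart i` (the flags `φ` and `t2 φ` belong to the same half-edge); indices are cyclic. -/
structure SimpleClosedCurve where
  len : ℕ
  dart : Fin (len + 1) → F
  closed : ∀ i, X.vert (X.t0 (dart i)) = X.vert (dart (i + 1))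
  vert_inj : Function.Injective fun i => X.vert (dart i)
  edge_inj : Function.Injective fun i => X.edge (dart i)

namespace SimpleClosedCurve

variable {X} (C : X.SimpleClosedCurve)

/-- The 1-chain of a simple closed curve. -/
def chain : X.Edge → ZMod 2 := ∑ i, Pi.single (X.edge (C.dart i)) 1

lemma bd1_single (φ : F) : X.bd1 (Pi.single (X.edge φ) 1) =
    Pi.single (X.vert φ) 1 + Pi.single (X.vert (X.t0 φ)) 1 := by
  have h : X.bd1 (Pi.single (X.edge φ) 1) = X.edgeBoundary (X.edge φ) := by
    simp [bd1, LinearMap.sum_apply, Pi.single_apply, ite_smul]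
  rw [h]
  rfl

lemma chain_mem : C.chain ∈ X.Z1 := by
  rw [LinearMap.mem_ker, chain, map_sum]
  simp only [bd1_single, C.closed, Finset.sum_add_distrib]
  have h : ∑ i, Pi.single (M := fun _ : X.Vertex => ZMod 2) (X.vert (C.dart (i + 1))) 1 =
      ∑ i, Pi.single (X.vert (C.dart i)) 1 :=
    Equiv.sum_comp (Equiv.addRight (1 : Fin (C.len + 1)))
      (fun i => Pi.single (M := fun _ : X.Vertex => ZMod 2) (X.vert (C.dart i)) 1)
  rw [h]
  funext v
  exact CharTwo.add_self_eq_zero _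

/-- The homology class of a simple closed curve. -/
def homology : X.H1 := X.homologyClass ⟨C.chain, C.chain_mem⟩

/-- The number of edges of `C` whose orientation by `K` differs from the orientation of `C`. -/
def disagreements (K : X.EdgeOrientation) : ℕ :=
  (Finset.univ.filter fun i => K.1 (C.dart i) = 1).card

/-- The flag of a half-edge whose face is on the left for the chosen local orientation. -/
def leftFlag (X : SurfaceGraph F) (o : F → ZMod 2) (φ : F) : F := if o φ = 0 then φ else X.t2 φ

/-- At its `i`-th vertex, `C` arrives through the half-edge of `t0 (dart (i - 1))` and leaves
through that of `dart i`.  The dimer of `D` at this vertex lies on the left of `C`, for the chosen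
local orientation, if it is met when turning counterclockwise (by `t2 * t1`) from the half-edge
leaving along `C`, strictly before the half-edge arriving along `C`.  Equivalently, `C` and the
dimer, in this order, induce the chosen local orientation. -/
def DimerOnLeft (o : F → ZMod 2) (D : X.Dimer) (i : Fin (C.len + 1)) : Prop :=
  ∃ k : ℕ, 0 < k ∧ X.edge (((X.t2 * X.t1) ^ k) (leftFlag X o (C.dart i))) ∈ D.1 ∧
    ∀ j ≤ k, ((X.t2 * X.t1) ^ j) (leftFlag X o (C.dart i)) ≠
      leftFlag X o (X.t0 (C.dart (i - 1)))

/-- The number of vertices of `C` where the dimer of `D` lies on the left of `C`. -/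
def leftDimers (o : F → ZMod 2) (D : X.Dimer) : ℕ :=
  (Finset.univ.filter fun i => C.DimerOnLeft o D i).card

/-- The number of 1-edges of `C` in `D`. -/
def omegaOn (ω : X.Edge → ZMod 2) (D : X.Dimer) : ℕ :=
  ∑ i ∈ Finset.univ.filter (fun i => X.edge (C.dart i) ∈ D.1), (ω (X.edge (C.dart i))).val

/-- The number of 1-edges of `C` outside `D`. -/
def omegaOff (ω : X.Edge → ZMod 2) (D : X.Dimer) : ℕ :=
  ∑ i ∈ Finset.univ.filter (fun i => X.edge (C.dart i) ∉ D.1), (ω (X.edge (C.dart i))).val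

end SimpleClosedCurve

/-- `q` is the quadratic enhancement associated with `ω`, the chosen local orientations, `K` and
`D`: it is a quadratic enhancement with the prescribed values on simple closed curves. -/
def IsEnhancementOf (ω : X.Edge → ZMod 2) (o : F → ZMod 2) (K : X.EdgeOrientation)
    (D : X.Dimer) (q : X.H1 → ZMod 4) : Prop :=
  X.IsQuadraticEnhancement q ∧ ∀ C : X.SimpleClosedCurve,
    q C.homology = 2 * ((C.disagreements K + C.leftDimers o D + 1 : ℕ) : ZMod 4) +
      (C.omegaOn ω D : ZMod 4) - (C.omegaOff ω D : ZMod 4)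

/-- The quadratic enhancement associated with a Kasteleyn orientation and a dimer configuration. -/
def enhancement (ω : X.Edge → ZMod 2) (o : F → ZMod 2) (K : X.EdgeOrientation)
    (D : X.Dimer) : X.H1 → ZMod 4 :=
  Classical.epsilon (X.IsEnhancementOf ω o K D)

/-- The Brown invariant of a quadratic enhancement `q` on a finite `ZMod 2`-vector space: the
element `β` of `ZMod 8` with `exp (i π / 4) ^ β = |V| ^ (-1 / 2) * ∑ x, i ^ q x`. -/
def brown {V : Type*} [Fintype V] (q : V → ZMod 4) : ZMod 8 :=
  Classical.epsilon fun β => Complex.exp (Complex.I * Real.pi / 4) ^ β.val =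
    (1 / (Real.sqrt (Fintype.card V) : ℂ)) * ∑ x, Complex.I ^ (q x).val

/-- The contribution of a Kasteleyn orientation to the Pfaffian formula, computed with the dimer
configuration `D`, without the power of `-i`. -/
def pfaffianTerm {n : ℕ} (num : X.Vertex ≃ Fin (2 * n)) (w : X.Edge → ℝ)
    (ω : X.Edge → ZMod 2) (o : F → ZMod 2) (D : X.Dimer) (K : X.EdgeOrientation) : ℂ :=
  Complex.exp (Complex.I * Real.pi / 4) ^ (brown (X.enhancement ω o K D)).val *
    (X.dimerSign num K D : ℂ) * pfaffian (X.kasteleynMatrix num w ω K)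

end

end SurfaceGraph

open Finset

set_option linter.unusedSectionVars false

/-! The whole proof rests on one `ZMod 4`-valued quadratic function `quad` on the mod 2 chains of
the graph. It encodes the Kasteleyn curvatures, the prescribed values on simple closed curves and
the signs of the dimer configurations all at once.

Cut the cyclic order of the flags at each vertex at the half-edge of a dimer configuration D, and
order the vertices by their numbers. This is a total order on the flags (`Before`), in which every
edge becomes a chord joining two points of a line. Counting the right-hand flags of the half-edges
of a cycle that come before a given flag yields a 2-chain of the barycentric subdivision that moves
the cycle to the dual graph (`dualPot`). So the crossing parities `cross` of the chords represent
the intersection form, and an edge crosses its own copy `ω e` times (`cross_self`). The matrix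
`gram` lifts these parities to `ZMod 4`, with diagonal entries `weight` that involve K. Hence `quad`
is quadratic with the intersection form as polarization (`quad_add`).

On a sequence of oriented edges, `quad` counts increasing pairs of flags (`quad_flags`). If the
sequence closes up, `sum_pairs_cyclic` replaces the chords of the edges by the chords of the corners
between them, at the price of one sign. Corners are easy to count. Around a face they are empty
sectors, which do not cross, and the value is twice the curvature (`quad_face`). Along a simple
closed curve they sit at distinct vertices, and the value is the prescribed one (`quad_chain`). For
a dimer configuration the ends of the edges are all the vertices, and the increasing pairs give the
sign of a permutation (`quad_dimer`).

Since the curvature is read off from the boundary chain, it pairs to zero with 2-cycles, so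
Kasteleyn orientations exist. For such an orientation `quad` vanishes on boundaries and descends to
homology. The result is unique because simple closed curves generate the cycles (`cycle_induction`).

For the formula, evaluating `quad` on D₀ + D gives i^(-q(D₀ + D)) = (-i)^ω(D₀) ε(D₀) ε(D) i^ω(D)
(`enhancement_dimers`). The Pfaffian is the sum of ε(D) i^ω(D) w(D) over D. Thus (-i)^ω(D₀) times
the summand of K is 2^(-b₁/2) times the sum over D of G_K i^(-q_K(D₀ + D)) w(D), where G_K is the
Gauss sum of q_K. The classes of Kasteleyn orientations form a torsor under the dual of H₁, and a
functional f changes q by 2f. Orthogonality of characters then makes the sum of G_K i^(-q_K(a)) over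
K equal to |H₁| for every a (`sum_kasteleyn`), so each D is counted with the same factor. Finally,
changing D₀ translates q by the class of the superposition (`enhancement_eq_sub`), which gives the
independence of D₀. -/

/-- Doubling, as a homomorphism from `ZMod 2` to `ZMod 4`. -/
def two : ZMod 2 →+ ZMod 4 where
  toFun x := 2 * (x.val : ZMod 4)
  map_zero' := by decide
  map_add' := by decide

lemma two_one : two 1 = 2 := by decide

lemma two_natCast (n : ℕ) : two (n : ZMod 2) = 2 * (n : ZMod 4) := by
  induction n with
  | zero => simp
  | succ n ih => rw [Nat.cast_succ, map_add, ih, two_one]; push_cast; ring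

lemma two_eq (x : ZMod 2) : two x = 2 * (x.val : ZMod 4) := rfl

lemma two_injective : Function.Injective two := by
  unfold Function.Injective; decide

lemma ZMod.two_eq_zero_or_one (x : ZMod 2) : x = 0 ∨ x = 1 := by
  revert x; decide

lemma ZMod.two_add_self (x : ZMod 2) : x + x = 0 := CharTwo.add_self_eq_zero x

lemma ZMod.two_ne_zero_iff (x : ZMod 2) : x ≠ 0 ↔ x = 1 := by
  revert x; decide

/-! ### Chord diagrams on a line and increasing pairs -/

section Chords

variable {α : Type*} (L : α → α → ZMod 2)

/-- The crossing parity of two chords `a b` and `c d`, where `L x y = 1` means that `x` comes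
before `y`. -/
def crossing (a b c d : α) : ZMod 2 := L a c + L a d + L b c + L b d

/-- Both sides count the increasing pairs of the sequence a₀, b₀, a₁, b₁, …, a_m. The left side
groups the terms as (aᵢ, bᵢ) and isolates the last one; the right side groups them as (bᵢ, aᵢ₊₁) and
isolates the first one. -/
lemma sum_pairs_shift (a b : ℕ → α) (m : ℕ) :
    (∑ i ∈ range m, L (a i) (b i) +
      ∑ j ∈ range m, ∑ i ∈ range j, crossing L (a i) (b i) (a j) (b j)) +
      ∑ i ∈ range m, (L (a i) (a m) + L (b i) (a m)) =
    (∑ i ∈ range m, L (b i) (a (i + 1)) +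
      ∑ j ∈ range m, ∑ i ∈ range j, crossing L (b i) (a (i + 1)) (b j) (a (j + 1))) +
      ∑ i ∈ range m, (L (a 0) (b i) + L (a 0) (a (i + 1))) := by
  induction m with
  | zero => simp
  | succ m ih =>
    simp only [crossing, sum_add_distrib] at ih
    simp only [crossing, sum_add_distrib, sum_range_succ _ m]
    have h1 := sum_range_succ (fun i => L (a i) (b m)) m
    rw [sum_range_succ'] at h1
    have h2 := sum_range_succ (fun i => L (a i) (a (m + 1))) m
    rw [sum_range_succ'] at h2
    linear_combination ih - h1 - h2

/-- The chord diagrams formed by the even and by the odd pairs of consecutive terms of a cyclic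
sequence have signs of opposite parity. -/
lemma sum_pairs_cyclic (hL : ∀ x y, x ≠ y → L x y + L y x = 1) (a b : ℕ → α) (m : ℕ)
    (hm : 0 < m) (hc : a m = a 0) (ha : ∀ i, 0 < i → i < m → a i ≠ a 0)
    (hb : ∀ i, i < m → b i ≠ a 0) :
    (∑ i ∈ range m, L (a i) (b i) +
      ∑ j ∈ range m, ∑ i ∈ range j, crossing L (a i) (b i) (a j) (b j)) =
    (∑ i ∈ range m, L (b i) (a (i + 1)) +
      ∑ j ∈ range m, ∑ i ∈ range j, crossing L (b i) (a (i + 1)) (b j) (a (j + 1))) + 1 := by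
  have h := sum_pairs_shift L a b m
  -- Comparing the isolated term a₀ = a_m from both sides: the other 2m - 1 terms of the cycle
  -- contribute 1 each, and `L (a 0) (a 0)` appears twice.
  have hs : ∑ i ∈ range m, (L (a i) (a m) + L (b i) (a m)) +
      ∑ i ∈ range m, (L (a 0) (b i) + L (a 0) (a (i + 1))) = 1 := by
    rw [hc]
    have e1 : ∑ i ∈ range m, (L (b i) (a 0) + L (a 0) (b i)) = m := by
      rw [sum_congr rfl fun i hi => hL _ _ (hb i (mem_range.1 hi))]; simp
    obtain ⟨k, rfl⟩ : ∃ k, m = k + 1 := ⟨m - 1, by omega⟩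
    have e2 : ∑ i ∈ range k, (L (a (i + 1)) (a 0) + L (a 0) (a (i + 1))) = k := by
      rw [sum_congr rfl fun i hi => hL _ _ (ha (i + 1) (by omega)
        (by have := mem_range.1 hi; omega))]; simp
    have e3 := sum_range_succ' (fun i => L (a i) (a 0)) k
    have e4 := sum_range_succ (fun i => L (a 0) (a (i + 1))) k
    rw [hc] at e4
    simp only [sum_add_distrib] at e1 e2 ⊢
    have h5 := ZMod.two_add_self (L (a 0) (a 0))
    have h6 := ZMod.two_add_self (k : ZMod 2)
    push_cast at e1
    linear_combination e1 + e2 + e3 + e4 + h5 + h6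
  have h2 : ∀ x y u v : ZMod 2, x + u = y + v → u + v = 1 → x = y + 1 := by decide
  exact h2 _ _ _ _ h hs

/-- The number of increasing pairs in a sequence listed by blocks of two. -/
lemma sum_pairs_blocks (s : ℕ → α) (m : ℕ) :
    ∑ j ∈ range (2 * m), ∑ i ∈ range j, L (s i) (s j) =
    ∑ l ∈ range m, L (s (2 * l)) (s (2 * l + 1)) + ∑ j ∈ range m, ∑ i ∈ range j,
      crossing L (s (2 * i)) (s (2 * i + 1)) (s (2 * j)) (s (2 * j + 1)) := by
  have h0 : ∀ (f : ℕ → ZMod 2) (m : ℕ),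
      ∑ i ∈ range (2 * m), f i = ∑ i ∈ range m, (f (2 * i) + f (2 * i + 1)) := by
    intro f m
    induction m with
    | zero => simp
    | succ m ih => rw [show 2 * (m + 1) = 2 * m + 1 + 1 by ring, sum_range_succ, sum_range_succ, ih,
        sum_range_succ]; ring
  induction m with
  | zero => simp
  | succ m ih =>
    rw [show 2 * (m + 1) = 2 * m + 1 + 1 by ring, sum_range_succ, sum_range_succ, ih,
      sum_range_succ _ m, sum_range_succ _ m, sum_range_succ _ (2 * m), h0, h0]
    simp only [crossing, sum_add_distrib]
    ring

end Chords

/-! ### Flags of an edge, paths of flags, local orientations -/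

namespace SurfaceGraph

noncomputable section

open Classical

variable {F : Type*} (X : SurfaceGraph F)

lemma edge_t0 (φ : F) : X.edge (X.t0 φ) = X.edge φ := by
  symm
  exact Quot.sound (Or.inl rfl)

lemma edge_t2 (φ : F) : X.edge (X.t2 φ) = X.edge φ := by
  symm
  exact Quot.sound (Or.inr rfl)

lemma face_t1 (φ : F) : X.face (X.t1 φ) = X.face φ := by
  symm
  exact Quot.sound (Or.inr rfl)

lemma edge_surj (e : X.Edge) : ∃ φ, X.edge φ = e := Quot.exists_rep e

lemma face_surj (f : X.Face) : ∃ φ, X.face φ = f := Quot.exists_rep f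

/-- `t0` and `t2` are commuting involutions, so their classes are orbits of a group of order four.
-/
lemma edge_eq_iff {φ ψ : F} : X.edge φ = X.edge ψ ↔
    φ = ψ ∨ φ = X.t2 ψ ∨ φ = X.t0 ψ ∨ φ = X.t0 (X.t2 ψ) := by
  constructor
  · intro h
    have h' := Quot.eqvGen_exact h
    clear h
    induction h' with
    | rel x y h =>
      rcases h with rfl | rfl
      · simp [X.t0_t0]
      · simp [X.t2_t2]
    | refl x => simp
    | symm x y h ih =>
      rcases ih with h | h | h | h <;> subst h <;>
        simp [X.t0_t2, X.t2_t2, X.t0_t0]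
    | trans x y z h1 h2 ih1 ih2 =>
      rcases ih2 with h | h | h | h <;>
      rcases ih1 with h' | h' | h' | h' <;> subst h' <;> subst h <;>
        simp [X.t0_t2, X.t2_t2, X.t0_t0]
  · rintro (rfl | rfl | rfl | rfl) <;> simp [edge_t0, edge_t2]

lemma t0_ne_t2 (φ : F) : X.t0 φ ≠ X.t2 φ := by
  intro h
  apply X.t0_t2_ne φ
  rw [← h, X.t0_t0]

/-- A property that is preserved by `t1` and `t2` holds at all flags of a vertex. -/
lemma vert_induction {p : F → Prop} {φ : F} (h0 : p φ) (h1 : ∀ ψ, p ψ → p (X.t1 ψ))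
    (h2 : ∀ ψ, p ψ → p (X.t2 ψ)) {ψ : F} (h : X.vert ψ = X.vert φ) : p ψ := by
  have key : ∀ x y, Relation.EqvGen (fun a b : F => b = X.t1 a ∨ b = X.t2 a) x y →
      (p x ↔ p y) := by
    intro x y hxy
    induction hxy with
    | rel x y h =>
      rcases h with rfl | rfl
      · exact ⟨h1 _, fun h => by simpa [X.t1_t1] using h1 _ h⟩
      · exact ⟨h2 _, fun h => by simpa [X.t2_t2] using h2 _ h⟩
    | refl x => rfl
    | symm x y _ ih => exact ih.symm
    | trans x y z _ _ ih1 ih2 => exact ih1.trans ih2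
  exact (key _ _ (Quot.eqvGen_exact h)).2 h0

lemma pathEnd_append (φ : F) (l l' : List (Fin 3)) :
    X.pathEnd φ (l ++ l') = X.pathEnd (X.pathEnd φ l) l' := by
  induction l generalizing φ with
  | nil => rfl
  | cons i l ih => exact ih _

lemma pathSum_append (ω : X.Edge → ZMod 2) (φ : F) (l l' : List (Fin 3)) :
    X.pathSum ω φ (l ++ l') = X.pathSum ω φ l + X.pathSum ω (X.pathEnd φ l) l' := by
  induction l generalizing φ with
  | nil => simp [pathSum, pathEnd]
  | cons i l ih => simp only [List.cons_append, pathSum, pathEnd, ih, add_assoc]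

lemma exists_path (φ ψ : F) : ∃ l, X.pathEnd φ l = ψ := by
  induction X.connected φ ψ with
  | refl => exact ⟨[], rfl⟩
  | tail _ h ih =>
    obtain ⟨l, rfl⟩ := ih
    rcases h with rfl | rfl | rfl
    · exact ⟨l ++ [0], by rw [pathEnd_append]; rfl⟩
    · exact ⟨l ++ [1], by rw [pathEnd_append]; rfl⟩
    · exact ⟨l ++ [2], by rw [pathEnd_append]; rfl⟩

/-- A property that is preserved by `t0`, `t1` and `t2` holds at all flags. -/
lemma exists_isLabelling [Fintype F] {ω : X.Edge → ZMod 2} (hω : X.RepresentsW1 ω) :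
    ∃ o, X.IsLabelling ω o := by
  obtain ⟨φ₀⟩ := X.nonempty
  choose path hpath using X.exists_path φ₀
  -- The labelling is a potential: each step reverses the local orientation, and each step along an
  -- edge adds the value of `ω`. Closing two paths with a common return path turns `RepresentsW1`
  -- into independence of the path.
  let s : List (Fin 3) → ZMod 2 := fun l => l.length + X.pathSum ω φ₀ l
  have key : ∀ l l', X.pathEnd φ₀ l = X.pathEnd φ₀ l' → s l = s l' := by
    intro l l' h
    obtain ⟨m, hm⟩ := X.exists_path (X.pathEnd φ₀ l) φ₀
    have h1 := hω φ₀ (l ++ m) (by rw [pathEnd_append, hm])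
    have h2 := hω φ₀ (l' ++ m) (by rw [pathEnd_append, ← h, hm])
    simp only [pathSum_append, ← h, List.length_append, Nat.cast_add] at h1 h2
    have : ∀ a b c d e f : ZMod 2, a + b = c + d → e + b = f + d → c + a = f + e := by decide
    exact this _ _ _ _ _ _ h1 h2
  have hstep : ∀ (φ : F) (i : Fin 3), s (path (X.step i φ)) =
      s (path φ) + 1 + if i = 0 then ω (X.edge φ) else 0 := by
    intro φ i
    rw [key (path (X.step i φ)) (path φ ++ [i]) (by rw [hpath, pathEnd_append, hpath]; rfl)]
    simp only [s, pathSum_append, hpath, List.length_append, pathSum, List.length_singleton]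
    push_cast
    ring
  refine ⟨fun φ => s (path φ), ⟨fun φ => ?_, fun φ => ?_, fun φ => ?_⟩⟩
  · have := hstep φ 1; simpa [step] using this
  · have := hstep φ 2; simpa [step] using this
  · have := hstep φ 0; simpa [step] using this

end

end SurfaceGraph

/-! ### Rotation around the vertices, with positions counted from the dimer -/

namespace SurfaceGraph

noncomputable section

open Classical

variable {F : Type*} (X : SurfaceGraph F)

section Order

variable [Fintype F] {X}

lemma Dimer.vert_ne (D : X.Dimer) {φ : F} (h : X.edge φ ∈ D.1) : X.vert φ ≠ X.vert (X.t0 φ) :=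
  D.2.2 _ h _ _ ⟨φ, rfl, rfl, rfl⟩

lemma Dimer.eq_or_eq_t2 (D : X.Dimer) {φ ψ : F} (hv : X.vert φ = X.vert ψ)
    (hφ : X.edge φ ∈ D.1) (hψ : X.edge ψ ∈ D.1) : φ = ψ ∨ φ = X.t2 ψ := by
  have he : X.edge φ = X.edge ψ :=
    (D.2.1 (X.vert ψ)).unique ⟨hφ, _, φ, rfl, hv, rfl⟩ ⟨hψ, _, ψ, rfl, rfl, rfl⟩
  have hne := D.vert_ne hψ
  rcases X.edge_eq_iff.1 he with h | h | h | h
  · exact Or.inl h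
  · exact Or.inr h
  · rw [h] at hv; exact absurd hv.symm hne
  · rw [h, X.t0_t2, X.vert_t2] at hv; exact absurd hv.symm hne

variable {ω : X.Edge → ZMod 2} {o : F → ZMod 2}

lemma Dimer.exists_flag (ho : X.IsLabelling ω o) (D : X.Dimer) (v : X.Vertex) (c : ZMod 2) :
    ∃ φ, X.vert φ = v ∧ X.edge φ ∈ D.1 ∧ o φ = c := by
  obtain ⟨e, ⟨he, u, φ, rfl, rfl, rfl⟩, -⟩ := D.2.1 v
  by_cases h : o φ = c
  · exact ⟨φ, rfl, he, h⟩
  · refine ⟨X.t2 φ, X.vert_t2 φ, by rwa [X.edge_t2], ?_⟩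
    rw [ho.t2]
    revert h
    generalize o φ = a
    revert a c
    decide

variable (o) in
/-- The flag on the right of the half-edge of `D` at a vertex. -/
def root (D : X.Dimer) (v : X.Vertex) : F :=
  @Classical.epsilon F X.nonempty fun φ => X.vert φ = v ∧ X.edge φ ∈ D.1 ∧ o φ = 1

lemma root_spec (ho : X.IsLabelling ω o) (D : X.Dimer) (v : X.Vertex) :
    X.vert (root o D v) = v ∧ X.edge (root o D v) ∈ D.1 ∧ o (root o D v) = 1 :=
  @Classical.epsilon_spec_aux F X.nonempty _ (D.exists_flag ho v 1)

lemma eq_root_iff (ho : X.IsLabelling ω o) (D : X.Dimer) {φ : F} {v : X.Vertex} :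
    φ = root o D v ↔ X.vert φ = v ∧ X.edge φ ∈ D.1 ∧ o φ = 1 := by
  obtain ⟨h1, h2, h3⟩ := root_spec ho D v
  constructor
  · rintro rfl; exact ⟨h1, h2, h3⟩
  · rintro ⟨h1', h2', h3'⟩
    rcases D.eq_or_eq_t2 (h1'.trans h1.symm) h2' h2 with h | h
    · exact h
    · rw [h, ho.t2, h3] at h3'; exact absurd h3' (by decide)

open SimpleClosedCurve (leftFlag)

lemma o_leftFlag (ho : X.IsLabelling ω o) (φ : F) : o (leftFlag X o φ) = 0 := by
  unfold leftFlag
  split_ifs with h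
  · exact h
  · rw [ho.t2, (ZMod.two_ne_zero_iff _).1 h]; decide

lemma leftFlag_eq_self {φ : F} (h : o φ = 0) : leftFlag X o φ = φ := if_pos h

lemma leftFlag_of_one {φ : F} (h : o φ = 1) : leftFlag X o φ = X.t2 φ :=
  if_neg (by rw [h]; decide)

lemma vert_leftFlag (φ : F) : X.vert (leftFlag X o φ) = X.vert φ := by
  unfold leftFlag; split_ifs
  · rfl
  · exact X.vert_t2 φ

lemma edge_leftFlag (φ : F) : X.edge (leftFlag X o φ) = X.edge φ := by
  unfold leftFlag; split_ifs
  · rfl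
  · exact X.edge_t2 φ

lemma leftFlag_t2 (ho : X.IsLabelling ω o) (φ : F) :
    leftFlag X o (X.t2 φ) = leftFlag X o φ := by
  rcases ZMod.two_eq_zero_or_one (o φ) with h | h
  · rw [leftFlag_eq_self h, leftFlag_of_one (by rw [ho.t2, h, zero_add]), X.t2_t2]
  · rw [leftFlag_of_one h, leftFlag_eq_self (by rw [ho.t2, h]; decide)]

lemma leftFlag_eq_iff (ho : X.IsLabelling ω o) {φ ψ : F} :
    leftFlag X o φ = leftFlag X o ψ ↔ φ = ψ ∨ φ = X.t2 ψ := by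
  constructor
  · intro h
    rcases ZMod.two_eq_zero_or_one (o φ) with h1 | h1 <;>
    rcases ZMod.two_eq_zero_or_one (o ψ) with h2 | h2 <;>
    simp only [leftFlag_eq_self, leftFlag_of_one, h1, h2] at h
    · exact Or.inl h
    · exact Or.inr h
    · right; rw [← h, X.t2_t2]
    · exact Or.inl (X.t2.injective h)
  · rintro (rfl | rfl)
    · rfl
    · exact leftFlag_t2 ho ψ

variable (X) in
/-- The rotation around the vertices: it sends the flag on the left of a half-edge to the flag on
the left of the next half-edge. -/
def rot : Equiv.Perm F := X.t2 * X.t1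

lemma o_rot (ho : X.IsLabelling ω o) (φ : F) : o (X.rot φ) = o φ := by
  simp [rot, ho.t2, ho.t1, add_assoc, ZMod.two_add_self]

lemma vert_rot (φ : F) : X.vert (X.rot φ) = X.vert φ := by
  simp [rot, vert_t1, vert_t2]

lemma vert_rot_pow (k : ℕ) (φ : F) : X.vert ((X.rot ^ k) φ) = X.vert φ := by
  induction k with
  | zero => rfl
  | succ k ih => rw [pow_succ', Equiv.Perm.mul_apply, vert_rot, ih]

lemma o_rot_pow (ho : X.IsLabelling ω o) (k : ℕ) (φ : F) : o ((X.rot ^ k) φ) = o φ := by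
  induction k with
  | zero => rfl
  | succ k ih => rw [pow_succ', Equiv.Perm.mul_apply, o_rot ho, ih]

/-- The degree of the vertex of a flag. -/
def deg (φ : F) : ℕ := Function.minimalPeriod X.rot φ

lemma deg_pos (φ : F) : 0 < X.deg φ :=
  Function.minimalPeriod_pos_of_mem_periodicPts (X.rot.injective.mem_periodicPts φ)

lemma rot_pow_mod (k : ℕ) (φ : F) : (X.rot ^ (k % X.deg φ)) φ = (X.rot ^ k) φ := by
  rw [← Equiv.Perm.iterate_eq_pow, ← Equiv.Perm.iterate_eq_pow]
  exact Function.iterate_mod_minimalPeriod_eq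

lemma rot_pow_inj {k l : ℕ} {φ : F} (hk : k < X.deg φ) (hl : l < X.deg φ)
    (h : (X.rot ^ k) φ = (X.rot ^ l) φ) : k = l := by
  rw [← Equiv.Perm.iterate_eq_pow, ← Equiv.Perm.iterate_eq_pow] at h
  exact (Function.iterate_eq_iterate_iff_of_lt_minimalPeriod hk hl).1 h

/-- `t2` keeps the half-edge and `t1` moves to an adjacent one, so turning reaches every half-edge
of the vertex. -/
lemma exists_rot_pow (ho : X.IsLabelling ω o) {φ ψ : F} (hφ : o φ = 0)
    (h : X.vert ψ = X.vert φ) : ∃ k < X.deg φ, (X.rot ^ k) φ = leftFlag X o ψ := by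
  suffices h' : ∃ k : ℕ, (X.rot ^ k) φ = leftFlag X o ψ by
    obtain ⟨k, hk⟩ := h'
    exact ⟨k % X.deg φ, Nat.mod_lt _ (deg_pos φ), by rw [rot_pow_mod, hk]⟩
  refine X.vert_induction (p := fun ψ => ∃ k : ℕ, (X.rot ^ k) φ = leftFlag X o ψ) (φ := φ)
    ⟨0, by rw [leftFlag_eq_self hφ]; rfl⟩ ?_ ?_ h
  · rintro ψ ⟨k, hk⟩
    rcases ZMod.two_eq_zero_or_one (o ψ) with h1 | h1
    · refine ⟨k + 1, ?_⟩
      rw [pow_succ', Equiv.Perm.mul_apply, hk, leftFlag_eq_self h1,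
        leftFlag_of_one (by rw [ho.t1, h1, zero_add])]
      rfl
    -- Crossing a sector from a right-hand flag is one turn clockwise; adding the degree keeps the
    -- exponent a natural number.
    · refine ⟨k + X.deg φ - 1, ?_⟩
      apply X.rot.injective
      rw [← Equiv.Perm.mul_apply, ← pow_succ', leftFlag_eq_self (φ := X.t1 ψ)
        (by rw [ho.t1, h1]; decide), Nat.sub_add_cancel (by have := deg_pos (X := X) φ; omega),
        ← rot_pow_mod, Nat.add_mod_right, rot_pow_mod, hk, leftFlag_of_one h1]
      simp [rot, X.t1_t1]
  · rintro ψ ⟨k, hk⟩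
    exact ⟨k, by rw [hk, leftFlag_t2 ho]⟩

variable (o) in
/-- The position of the half-edge of a flag around its vertex, counterclockwise from the half-edge
of `D`. -/
def idx (D : X.Dimer) (φ : F) : ℕ :=
  sInf {k | (X.rot ^ k) (X.t2 (root o D (X.vert φ))) = leftFlag X o φ}

lemma o_t2_root (ho : X.IsLabelling ω o) (D : X.Dimer) (v : X.Vertex) :
    o (X.t2 (root o D v)) = 0 := by
  rw [ho.t2, (root_spec ho D v).2.2]; decide

lemma idx_spec (ho : X.IsLabelling ω o) (D : X.Dimer) (φ : F) :
    (X.rot ^ idx o D φ) (X.t2 (root o D (X.vert φ))) = leftFlag X o φ := by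
  obtain ⟨k, -, hk⟩ := exists_rot_pow ho (o_t2_root ho D (X.vert φ)) (ψ := φ)
    (by rw [X.vert_t2, (root_spec ho D _).1])
  exact Nat.sInf_mem (s := {k | (X.rot ^ k) (X.t2 (root o D (X.vert φ))) = leftFlag X o φ}) ⟨k, hk⟩

lemma idx_lt (ho : X.IsLabelling ω o) (D : X.Dimer) (φ : F) :
    idx o D φ < X.deg (X.t2 (root o D (X.vert φ))) := by
  obtain ⟨k, hk', hk⟩ := exists_rot_pow ho (o_t2_root ho D (X.vert φ)) (ψ := φ)
    (by rw [X.vert_t2, (root_spec ho D _).1])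
  exact (Nat.sInf_le hk).trans_lt hk'

lemma idx_eq (ho : X.IsLabelling ω o) (D : X.Dimer) {φ : F} {k : ℕ}
    (hk : (X.rot ^ k) (X.t2 (root o D (X.vert φ))) = leftFlag X o φ) :
    idx o D φ = k % X.deg (X.t2 (root o D (X.vert φ))) := by
  refine rot_pow_inj (idx_lt ho D φ) (Nat.mod_lt _ (deg_pos _)) ?_
  rw [idx_spec ho, rot_pow_mod, hk]

lemma idx_eq_iff (ho : X.IsLabelling ω o) (D : X.Dimer) {φ ψ : F}
    (h : X.vert φ = X.vert ψ) : idx o D φ = idx o D ψ ↔ φ = ψ ∨ φ = X.t2 ψ := by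
  rw [← leftFlag_eq_iff ho, ← idx_spec ho D φ, ← idx_spec ho D ψ, h]
  constructor
  · intro h'; rw [h']
  · intro h'
    refine rot_pow_inj ?_ (idx_lt ho D ψ) h'
    rw [← h]; exact idx_lt ho D φ

lemma idx_t2 (ho : X.IsLabelling ω o) (D : X.Dimer) (φ : F) : idx o D (X.t2 φ) = idx o D φ :=
  (idx_eq_iff ho D (X.vert_t2 φ)).2 (Or.inr rfl)

/-- The position of a half-edge obtained by turning. -/
lemma rot_pow_eq_iff (ho : X.IsLabelling ω o) (D : X.Dimer) {φ ψ : F} (k : ℕ)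
    (h : X.vert φ = X.vert ψ) : (X.rot ^ k) (leftFlag X o φ) = leftFlag X o ψ ↔
      (idx o D φ + k) % X.deg (X.t2 (root o D (X.vert φ))) = idx o D ψ := by
  have h1 : (X.rot ^ k) (leftFlag X o φ) =
      (X.rot ^ (idx o D φ + k)) (X.t2 (root o D (X.vert ψ))) := by
    rw [← idx_spec ho D φ, ← Equiv.Perm.mul_apply, ← pow_add, add_comm, h]
  rw [h1]
  constructor
  · intro h2; rw [idx_eq ho D h2, h]
  · intro h2
    rw [← idx_spec ho D ψ, ← h2, h, rot_pow_mod]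

variable (o) in
/-- The position of a flag around its vertex. -/
def pos (D : X.Dimer) (φ : F) : ℕ := 2 * idx o D φ + if o φ = 0 then 1 else 0

lemma pos_inj (ho : X.IsLabelling ω o) (D : X.Dimer) {φ ψ : F} (h : X.vert φ = X.vert ψ)
    (hp : pos o D φ = pos o D ψ) : φ = ψ := by
  unfold pos at hp
  have hi : idx o D φ = idx o D ψ := by split_ifs at hp <;> omega
  rcases (idx_eq_iff ho D h).1 hi with h' | h'
  · exact h'
  · exfalso
    rw [hi, h', ho.t2] at hp
    rcases ZMod.two_eq_zero_or_one (o ψ) with h1 | h1 <;> simp [h1] at hp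
    exact hp (by decide)

lemma pos_t2 (ho : X.IsLabelling ω o) (D : X.Dimer) {φ : F} (h : o φ = 1) :
    pos o D (X.t2 φ) = pos o D φ + 1 := by
  unfold pos
  rw [idx_t2 ho, ho.t2, h, if_pos (by decide), if_neg (by decide)]

/-- The positions start at the right-hand flag of the dimer. -/
lemma pos_eq_zero (ho : X.IsLabelling ω o) (D : X.Dimer) {φ : F} (h : o φ = 1)
    (hD : X.edge φ ∈ D.1) : pos o D φ = 0 := by
  have h0 : idx o D φ = 0 := by
    rw [idx_eq ho D (k := 0), Nat.zero_mod]
    rw [← (eq_root_iff ho D).2 ⟨rfl, hD, h⟩, leftFlag_of_one h]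
    rfl
  unfold pos
  rw [h0, h, if_neg (by decide)]

lemma leftFlag_t1 (ho : X.IsLabelling ω o) {φ : F} (h : o φ = 0) :
    leftFlag X o (X.t1 φ) = X.rot φ := by
  rw [leftFlag_of_one (by rw [ho.t1, h, zero_add])]; rfl

lemma idx_t1 (ho : X.IsLabelling ω o) (D : X.Dimer) {φ : F} (h : o φ = 0) :
    idx o D (X.t1 φ) = (idx o D φ + 1) % X.deg (X.t2 (root o D (X.vert φ))) := by
  rw [← (rot_pow_eq_iff ho D 1 (X.vert_t1 φ).symm).1]
  rw [leftFlag_t1 ho h, leftFlag_eq_self h, pow_one]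

lemma idx_t1_ne_zero (ho : X.IsLabelling ω o) (D : X.Dimer) {φ : F} (h : o φ = 0) :
    idx o D (X.t1 φ) = 0 ↔ X.edge (X.t1 φ) ∈ D.1 := by
  have h1 : o (X.t1 φ) = 1 := by rw [ho.t1, h, zero_add]
  constructor
  · intro h0
    have := idx_spec ho D (X.t1 φ)
    rw [h0, leftFlag_of_one h1, pow_zero, Equiv.Perm.one_apply] at this
    rw [← X.t2.injective this]
    exact (root_spec ho D _).2.1
  · intro hD
    have := pos_eq_zero ho D h1 hD
    unfold pos at this; omega

/-- A sector joins two consecutive positions, unless it ends at the half-edge of the dimer, where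
the cyclic order is cut. -/
lemma pos_t1 (ho : X.IsLabelling ω o) (D : X.Dimer) {φ : F} (h : o φ = 0)
    (hD : X.edge (X.t1 φ) ∉ D.1) : pos o D (X.t1 φ) = pos o D φ + 1 := by
  have h0 := mt (idx_t1_ne_zero ho D h).1 hD
  have h1 := idx_t1 ho D h
  have h2 := idx_lt ho D φ
  unfold pos
  rw [ho.t1, h, if_pos rfl, if_neg (by decide)]
  rcases Nat.lt_or_ge (idx o D φ + 1) (X.deg (X.t2 (root o D (X.vert φ)))) with h3 | h3
  · rw [Nat.mod_eq_of_lt h3] at h1; omega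
  · have : idx o D φ + 1 = X.deg (X.t2 (root o D (X.vert φ))) := by omega
    rw [this, Nat.mod_self] at h1
    exact absurd h1 h0

/-- On the other side of the cut: the left-hand flag whose next half-edge is the dimer is the last
one of its vertex. -/
lemma pos_le_of_t1_mem (ho : X.IsLabelling ω o) (D : X.Dimer) {φ ψ : F} (h : o φ = 0)
    (hD : X.edge (X.t1 φ) ∈ D.1) (hv : X.vert ψ = X.vert φ) : pos o D ψ ≤ pos o D φ := by
  have h0 := (idx_t1_ne_zero ho D h).2 hD
  have h1 := idx_t1 ho D h
  have h2 := idx_lt ho D φ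
  have h3 := idx_lt ho D ψ
  rw [hv] at h3
  rcases Nat.lt_or_ge (idx o D φ + 1) (X.deg (X.t2 (root o D (X.vert φ)))) with h4 | h4
  · rw [Nat.mod_eq_of_lt h4] at h1; omega
  · unfold pos
    rw [h, if_pos rfl]
    split_ifs <;> omega

/-! ### The order on flags -/

variable {n : ℕ} (num : X.Vertex ≃ Fin (2 * n)) (D : X.Dimer)

variable (o) in
/-- The total order on flags: by vertices, and around each vertex by position. -/
def Before (φ ψ : F) : Prop :=
  num (X.vert φ) < num (X.vert ψ) ∨ X.vert φ = X.vert ψ ∧ pos o D φ < pos o D ψ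

variable (o) in
/-- The indicator function of the order on flags. -/
def bef (φ ψ : F) : ZMod 2 := if Before o num D φ ψ then 1 else 0

lemma bef_add_bef (ho : X.IsLabelling ω o) {φ ψ : F} (h : φ ≠ ψ) :
    bef o num D φ ψ + bef o num D ψ φ = 1 := by
  unfold bef Before
  by_cases hv : X.vert φ = X.vert ψ
  · have hp := mt (pos_inj ho D hv) h
    rcases Nat.lt_or_gt_of_ne hp with h1 | h1
    · simp [hv, h1, h1.le]
    · simp [hv, h1, h1.le]
  · have hv' : num (X.vert φ) ≠ num (X.vert ψ) := fun h => hv (num.injective h)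
    rcases lt_or_gt_of_ne hv' with h1 | h1
    · simp [hv, Ne.symm hv, h1, h1.le]
    · simp [hv, Ne.symm hv, h1, h1.le]

lemma bef_self (φ : F) : bef o num D φ φ = 0 := by simp [bef, Before]

lemma bef_congr_left {φ φ' ψ : F} (hv : X.vert φ = X.vert φ')
    (hp : X.vert φ = X.vert ψ → (pos o D φ < pos o D ψ ↔ pos o D φ' < pos o D ψ)) :
    bef o num D φ ψ = bef o num D φ' ψ := by
  unfold bef Before
  by_cases h : X.vert φ' = X.vert ψ
  · simp only [hv, h, hp (hv.trans h)]
  · simp only [hv, h, false_and]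

lemma bef_congr_right {φ ψ ψ' : F} (hv : X.vert ψ = X.vert ψ')
    (hp : X.vert φ = X.vert ψ → (pos o D φ < pos o D ψ ↔ pos o D φ < pos o D ψ')) :
    bef o num D φ ψ = bef o num D φ ψ' := by
  unfold bef Before
  by_cases h : X.vert φ = X.vert ψ'
  · simp only [hv, h, hp (h.trans hv.symm)]
  · simp only [hv, h, false_and]

lemma bef_of_vert_ne {φ ψ : F} (hv : X.vert φ ≠ X.vert ψ) :
    bef o num D φ ψ = if num (X.vert φ) < num (X.vert ψ) then 1 else 0 := by
  unfold bef Before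
  simp only [hv, false_and, or_false]

lemma bef_of_vert_eq {φ ψ : F} (hv : X.vert φ = X.vert ψ) :
    bef o num D φ ψ = if pos o D φ < pos o D ψ then 1 else 0 := by
  unfold bef Before
  simp only [hv, lt_irrefl, true_and, false_or]

lemma bef_t2_self (ho : X.IsLabelling ω o) (φ : F) : bef o num D φ (X.t2 φ) = o φ := by
  rw [bef_of_vert_eq num D (X.vert_t2 φ).symm]
  rcases ZMod.two_eq_zero_or_one (o φ) with h | h
  · have := pos_t2 ho D (φ := X.t2 φ) (by rw [ho.t2, h, zero_add])
    rw [X.t2_t2] at this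
    rw [h, if_neg (by omega)]
  · rw [pos_t2 ho D h, if_pos (by omega), h]

/-- The two flags of a half-edge are consecutive in the order, so no third flag separates them. -/
lemma bef_t2_left (ho : X.IsLabelling ω o) {φ ψ : F} (h : φ ≠ ψ) (h' : X.t2 φ ≠ ψ) :
    bef o num D (X.t2 φ) ψ = bef o num D φ ψ := by
  refine bef_congr_left num D (X.vert_t2 φ) fun hv => ?_
  have h1 := mt (pos_inj ho D ((X.vert_t2 φ).symm.trans hv)) h
  have h2 := mt (pos_inj ho D hv) h'
  rcases ZMod.two_eq_zero_or_one (o φ) with h3 | h3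
  · have := pos_t2 ho D (φ := X.t2 φ) (by rw [ho.t2, h3, zero_add])
    rw [X.t2_t2] at this
    omega
  · have := pos_t2 ho D h3
    omega

lemma bef_t2_right (ho : X.IsLabelling ω o) {φ ψ : F} (h : ψ ≠ φ) (h' : X.t2 φ ≠ ψ) :
    bef o num D ψ (X.t2 φ) = bef o num D ψ φ := by
  have h1 := bef_add_bef num D ho h
  have h2 := bef_add_bef num D ho h'
  rw [bef_t2_left num D ho h.symm h', ← h1, add_comm] at h2
  exact add_right_cancel h2

/-- A sector at a vertex, cut out by two adjacent half-edges, does not contain other flags, or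
contains all the flags of the vertex. -/
lemma bef_t1_right (ho : X.IsLabelling ω o) {φ χ : F} (h : χ ≠ φ) (h' : χ ≠ X.t1 φ) :
    bef o num D χ (X.t1 φ) = bef o num D χ φ +
      if X.vert χ = X.vert φ ∧ (o φ = 0 ∧ X.edge (X.t1 φ) ∈ D.1 ∨ o φ = 1 ∧ X.edge φ ∈ D.1)
      then 1 else 0 := by
  have key : ∀ φ χ : F, χ ≠ φ → χ ≠ X.t1 φ → o φ = 0 → bef o num D χ (X.t1 φ) =
      bef o num D χ φ + if X.vert χ = X.vert φ ∧ X.edge (X.t1 φ) ∈ D.1 then 1 else 0 := by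
    intro φ χ h h' h0
    by_cases hv : X.vert χ = X.vert φ
    · have h1 := mt (pos_inj ho D hv) h
      have h2 := mt (pos_inj ho D (hv.trans (X.vert_t1 φ).symm)) h'
      rw [bef_of_vert_eq num D hv, bef_of_vert_eq num D (hv.trans (X.vert_t1 φ).symm)]
      by_cases hD : X.edge (X.t1 φ) ∈ D.1
      · have h3 := pos_le_of_t1_mem ho D h0 hD hv
        have h4 := pos_eq_zero ho D (φ := X.t1 φ) (by rw [ho.t1, h0, zero_add]) hD
        rw [if_neg (by omega), if_pos (by omega), if_pos ⟨hv, hD⟩]; decide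
      · rw [pos_t1 ho D h0 hD] at h2 ⊢
        rw [if_neg (c := X.vert χ = X.vert φ ∧ _) (fun h => hD h.2), add_zero]
        congr 1
        exact propext ⟨fun _ => by omega, fun _ => by omega⟩
    · rw [if_neg (fun h => hv h.1), add_zero]
      exact bef_congr_right num D (X.vert_t1 φ) fun hv' => absurd (hv'.trans (X.vert_t1 φ)) hv
  rcases ZMod.two_eq_zero_or_one (o φ) with h0 | h0
  · rw [key φ χ h h' h0]
    simp [h0]
  · have := key (X.t1 φ) χ h' (by rwa [X.t1_t1]) (by rw [ho.t1, h0]; decide)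
    rw [X.t1_t1, X.vert_t1] at this
    rw [this, add_assoc]
    simp only [h0, one_ne_zero, false_and, true_and, false_or, ZMod.two_add_self, add_zero]

/-- The term `o φ` is the answer for a counterclockwise order without cut; the indicator corrects it
for the sector that contains the cut. -/
lemma bef_t1_self (ho : X.IsLabelling ω o) (φ : F) :
    bef o num D (X.t1 φ) φ = o φ +
      (if o φ = 0 ∧ X.edge (X.t1 φ) ∈ D.1 ∨ o φ = 1 ∧ X.edge φ ∈ D.1 then 1 else 0) := by
  have key : ∀ φ : F, o φ = 0 → bef o num D (X.t1 φ) φ =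
      if X.edge (X.t1 φ) ∈ D.1 then 1 else 0 := by
    intro φ h0
    have hne := mt (pos_inj ho D (X.vert_t1 φ)) (X.t1_ne φ)
    rw [bef_of_vert_eq num D (X.vert_t1 φ)]
    by_cases hD : X.edge (X.t1 φ) ∈ D.1
    · have h3 := pos_le_of_t1_mem ho D h0 hD (X.vert_t1 φ)
      rw [if_pos (by omega), if_pos hD]
    · rw [pos_t1 ho D h0 hD, if_neg (by omega), if_neg hD]
  rcases ZMod.two_eq_zero_or_one (o φ) with h0 | h0
  · rw [key φ h0]
    simp [h0]
  · have h1 := key (X.t1 φ) (by rw [ho.t1, h0]; decide)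
    have h2 := bef_add_bef num D ho (X.t1_ne φ)
    rw [X.t1_t1] at h1
    rw [h1] at h2
    simp only [h0, one_ne_zero, false_and, true_and, false_or]
    by_cases hD : X.edge φ ∈ D.1
    · rw [if_pos hD] at h2 ⊢
      rw [add_eq_right.1 h2]; decide
    · rw [if_neg hD] at h2 ⊢
      linear_combination h2

lemma bef_root (ho : X.IsLabelling ω o) {φ χ : F} (hv : X.vert χ = X.vert φ) (hχ : o χ = 1)
    (hD : X.edge χ ∈ D.1) : bef o num D χ φ = if φ = χ then 0 else 1 := by
  rw [bef_of_vert_eq num D hv, pos_eq_zero ho D hχ hD]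
  by_cases h : φ = χ
  · rw [h, pos_eq_zero ho D hχ hD]; simp
  · have := mt (pos_inj ho D hv.symm) h
    rw [pos_eq_zero ho D hχ hD] at this
    rw [if_pos (by omega), if_neg h]

end Order

end

end SurfaceGraph

/-! ### Reduction modulo 2, and sums over half-edges -/

/-- Reduction modulo 2. -/
def red : ZMod 4 →+* ZMod 2 := ZMod.castHom (by norm_num : 2 ∣ 4) (ZMod 2)

lemma two_red (z : ZMod 4) : two (red z) = 2 * z := by revert z; decide

lemma red_natCast_val (x : ZMod 2) : red (x.val : ZMod 4) = x := by revert x; decide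

lemma red_two (x : ZMod 2) : red (two x) = 0 := by revert x; decide

lemma exists_eq_add_two_mul {z : ZMod 4} {x : ZMod 2} (h : red z = x) :
    ∃ k, z = (x.val : ZMod 4) + 2 * k := by
  revert z x; decide

namespace SurfaceGraph

noncomputable section

open Classical

variable {F : Type*} {X : SurfaceGraph F} [Fintype F]
variable {ω : X.Edge → ZMod 2} {o : F → ZMod 2}

open SimpleClosedCurve (leftFlag)

/-- The flags with `o = 1` are the right-hand flags. Each half-edge has exactly one, so they serve
below as an index set for the half-edges. -/
lemma sum_flags_of_edge (ho : X.IsLabelling ω o) {A : Type*} [AddCommMonoid A] (f : F → A)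
    (φ : F) : (∑ χ with o χ = 1, if X.edge χ = X.edge φ then f χ else 0) =
      f (X.t2 (leftFlag X o φ)) + f (X.t2 (leftFlag X o (X.t0 φ))) := by
  have h1 : ∀ φ, o (X.t2 (leftFlag X o φ)) = 1 := fun φ => by
    rw [ho.t2, o_leftFlag ho, zero_add]
  have h2 : ∀ φ, X.edge (X.t2 (leftFlag X o φ)) = X.edge φ := fun φ => by
    rw [X.edge_t2, edge_leftFlag]
  have h3 : ∀ φ, o φ = 1 → X.t2 (leftFlag X o φ) = φ := fun φ h => by
    rw [leftFlag_of_one h, X.t2_t2]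
  have hne : X.t2 (leftFlag X o φ) ≠ X.t2 (leftFlag X o (X.t0 φ)) := by
    intro h
    rcases (leftFlag_eq_iff ho).1 (X.t2.injective h) with h | h
    · exact X.t0_ne φ h.symm
    · exact X.t0_t2_ne φ (by rw [X.t0_t2]; exact h.symm)
  rw [← sum_filter, ← sum_pair hne]
  apply sum_congr _ fun _ _ => rfl
  ext χ
  simp only [mem_filter, mem_univ, true_and, mem_insert, mem_singleton]
  constructor
  · rintro ⟨hχ, he⟩
    rw [← h3 χ hχ]
    rcases X.edge_eq_iff.1 he with rfl | rfl | rfl | rfl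
    · exact Or.inl rfl
    · rw [leftFlag_t2 ho]; exact Or.inl rfl
    · exact Or.inr rfl
    · rw [X.t0_t2, leftFlag_t2 ho]; exact Or.inr rfl
  · rintro (rfl | rfl)
    · exact ⟨h1 _, h2 _⟩
    · exact ⟨h1 _, by rw [h2, X.edge_t0]⟩

/-- A sum over the half-edges, regrouped by edges. -/
lemma sum_half_edges (ho : X.IsLabelling ω o) {A : Type*} [AddCommMonoid A] (f : F → A)
    (hf : ∀ φ, f (X.t2 φ) = f φ) (h : X.Edge → A)
    (hh : ∀ φ, h (X.edge φ) = f φ + f (X.t0 φ)) :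
    ∑ χ with o χ = 1, f χ = ∑ e, h e := by
  rw [← sum_fiberwise (s := univ.filter fun χ => o χ = 1) (g := X.edge)]
  refine sum_congr rfl fun e _ => ?_
  obtain ⟨φ, rfl⟩ := X.edge_surj e
  rw [sum_filter, sum_flags_of_edge ho, hh]
  have hl : ∀ φ, f (leftFlag X o φ) = f φ := fun φ => by
    unfold leftFlag; split_ifs
    · rfl
    · exact hf φ
  simp only [hf, hl]

lemma bd1_apply (y : X.Edge → ZMod 2) (v : X.Vertex) :
    X.bd1 y v = ∑ e, y e * X.edgeBoundary e v := by
  simp [bd1, LinearMap.sum_apply]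

lemma edgeBoundary_edge (φ : F) (v : X.Vertex) : X.edgeBoundary (X.edge φ) v =
    (if X.vert φ = v then 1 else 0) + if X.vert (X.t0 φ) = v then 1 else 0 := by
  change (Pi.single (X.vert φ) 1 + Pi.single (X.vert (X.t0 φ)) 1 : X.Vertex → ZMod 2) v = _
  simp only [Pi.add_apply, Pi.single_apply, eq_comm]

lemma bd1_eq_sum_flags (ho : X.IsLabelling ω o) (y : X.Edge → ZMod 2) (v : X.Vertex) :
    X.bd1 y v = ∑ χ with o χ = 1, if X.vert χ = v then y (X.edge χ) else 0 := by
  rw [bd1_apply]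
  refine (sum_half_edges ho _ (fun φ => by rw [X.vert_t2, X.edge_t2]) _ fun φ => ?_).symm
  rw [edgeBoundary_edge, X.edge_t0, mul_add, mul_ite, mul_ite, mul_one, mul_zero]

variable {n : ℕ} (num : X.Vertex ≃ Fin (2 * n)) (D : X.Dimer)

/-! ### Transverse representatives of cycles -/

variable (o) in
/-- The 2-chain of the barycentric subdivision that carries a cycle of the graph to a cycle of the
dual graph. -/
def dualPot (y : X.Edge → ZMod 2) (φ : F) : ZMod 2 :=
  ∑ χ with o χ = 1, bef o num D χ φ * y (X.edge χ)

/-- Crossing a half-edge changes the order relation with a single right-hand flag, the one of that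
half-edge. -/
lemma dualPot_t2 (ho : X.IsLabelling ω o) (y : X.Edge → ZMod 2) (φ : F) :
    dualPot o num D y (X.t2 φ) = dualPot o num D y φ + y (X.edge φ) := by
  have key : ∀ φ, o φ = 1 →
      dualPot o num D y (X.t2 φ) = dualPot o num D y φ + y (X.edge φ) := by
    intro φ h
    have hφ : φ ∈ univ.filter fun χ => o χ = 1 := by simp [h]
    have h1 : y (X.edge φ) =
        ∑ χ with o χ = 1, if χ = φ then y (X.edge χ) else 0 := by
      rw [sum_ite_eq' _ φ, if_pos hφ]
    rw [h1]
    unfold dualPot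
    rw [← sum_add_distrib]
    refine sum_congr rfl fun χ hχ => ?_
    have hχ' : o χ = 1 := (mem_filter.1 hχ).2
    split_ifs with hc
    · rw [hc, bef_t2_self num D ho, bef_self, h]; ring
    · rw [bef_t2_right num D ho hc, add_zero]
      rintro rfl
      rw [ho.t2, h] at hχ'
      exact absurd hχ' (by decide)
  rcases ZMod.two_eq_zero_or_one (o φ) with h | h
  · have := key (X.t2 φ) (by rw [ho.t2, h, zero_add])
    rw [X.t2_t2, X.edge_t2] at this
    rw [this, add_assoc, ZMod.two_add_self, add_zero]
  · exact key φ h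

/-- Crossing a sector passes no other flag, except at the cut, where every flag of the vertex
changes sides. The total change there is the boundary of `y` at the vertex, which is zero. -/
lemma dualPot_t1 (ho : X.IsLabelling ω o) {y : X.Edge → ZMod 2} (hy : y ∈ X.Z1) (φ : F) :
    dualPot o num D y (X.t1 φ) = dualPot o num D y φ := by
  have key : ∀ φ, o φ = 0 → dualPot o num D y (X.t1 φ) = dualPot o num D y φ := by
    intro φ h
    have h1 : (if X.edge (X.t1 φ) ∈ D.1 then (1 : ZMod 2) else 0) *
        (∑ χ with o χ = 1, if X.vert χ = X.vert φ then y (X.edge χ) else 0) = 0 := by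
      rw [← bd1_eq_sum_flags ho, LinearMap.mem_ker.1 hy]; simp
    rw [← add_zero (dualPot o num D y φ), ← h1, mul_sum]
    unfold dualPot
    rw [← sum_add_distrib]
    refine sum_congr rfl fun χ hχ => ?_
    have hχ' : o χ = 1 := (mem_filter.1 hχ).2
    have hne : χ ≠ φ := by rintro rfl; rw [h] at hχ'; exact absurd hχ' (by decide)
    by_cases hc : χ = X.t1 φ
    · subst hc
      rw [bef_self, bef_t1_self num D ho]
      by_cases hD : X.edge (X.t1 φ) ∈ D.1
      · simp [h, hD, X.vert_t1, ZMod.two_add_self]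
      · simp [h, hD]
    · rw [bef_t1_right num D ho hne hc]
      by_cases hD : X.edge (X.t1 φ) ∈ D.1 <;> by_cases hv : X.vert χ = X.vert φ <;>
        simp [h, hD, hv, add_mul]
  rcases ZMod.two_eq_zero_or_one (o φ) with h | h
  · exact key φ h
  · have := key (X.t1 φ) (by rw [ho.t1, h]; decide)
    rw [X.t1_t1] at this
    exact this.symm

variable (o) in
/-- A 1-chain of the dual graph homologous to a given 1-chain of the graph. -/
def dualChain (y : X.Edge → ZMod 2) (e : X.Edge) : ZMod 2 :=
  dualPot o num D y e.out + dualPot o num D y (X.t0 e.out)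

lemma edge_out (e : X.Edge) : X.edge e.out = e := Quot.out_eq e

lemma dualChain_edge (ho : X.IsLabelling ω o) (y : X.Edge → ZMod 2) (φ : F) :
    dualChain o num D y (X.edge φ) = dualPot o num D y φ + dualPot o num D y (X.t0 φ) := by
  unfold dualChain
  have h4 : ∀ a b c : ZMod 2, a + c + (b + c) = a + b := by decide
  rcases X.edge_eq_iff.1 (edge_out (X.edge φ)) with h | h | h | h <;> rw [h]
  · rw [X.t0_t2, dualPot_t2 num D ho, dualPot_t2 num D ho, X.edge_t0, h4]
  · rw [X.t0_t0, add_comm]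
  · rw [X.t0_t0, X.t0_t2, dualPot_t2 num D ho, dualPot_t2 num D ho, X.edge_t0, h4, add_comm]

lemma dualHomologous_dualChain (ho : X.IsLabelling ω o) {y : X.Edge → ZMod 2} (hy : y ∈ X.Z1) :
    X.DualHomologous y (dualChain o num D y) :=
  ⟨dualPot o num D y, fun φ => ⟨dualPot_t1 num D ho hy φ, dualPot_t2 num D ho y φ, by
    rw [dualChain_edge num D ho, ← add_assoc, ZMod.two_add_self, zero_add]⟩⟩

variable (o) in
/-- The crossing parity of two edges. -/
def cross (e e' : X.Edge) : ZMod 2 := dualChain o num D (Pi.single e' 1) e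

lemma dualPot_eq_sum (y : X.Edge → ZMod 2) (φ : F) :
    dualPot o num D y φ = ∑ e', y e' * dualPot o num D (Pi.single e' 1) φ := by
  unfold dualPot
  simp only [mul_sum]
  rw [sum_comm]
  refine sum_congr rfl fun χ _ => ?_
  rw [Finset.sum_eq_single (X.edge χ)]
  · rw [Pi.single_eq_same]; ring
  · intro e' _ he'
    rw [Pi.single_eq_of_ne he'.symm]; ring
  · simp

lemma dualChain_eq_sum (y : X.Edge → ZMod 2) (e : X.Edge) :
    dualChain o num D y e = ∑ e', y e' * cross o num D e e' := by
  unfold cross dualChain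
  rw [dualPot_eq_sum, dualPot_eq_sum num D y (X.t0 _), ← sum_add_distrib]
  exact sum_congr rfl fun e' _ => (mul_add _ _ _).symm

lemma dualPot_single (ho : X.IsLabelling ω o) (φ ψ : F) :
    dualPot o num D (Pi.single (X.edge ψ) 1) φ =
      bef o num D (X.t2 (leftFlag X o ψ)) φ + bef o num D (X.t2 (leftFlag X o (X.t0 ψ))) φ := by
  rw [← sum_flags_of_edge ho (fun χ => bef o num D χ φ)]
  unfold dualPot
  refine sum_congr rfl fun χ _ => ?_
  simp only [Pi.single_apply]
  split_ifs <;> simp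

lemma dualPot_single_of_edge_ne (ho : X.IsLabelling ω o) {φ ψ : F} (h : X.edge φ ≠ X.edge ψ) :
    dualPot o num D (Pi.single (X.edge ψ) 1) φ =
      bef o num D ψ φ + bef o num D (X.t0 ψ) φ := by
  have key : ∀ χ, X.edge φ ≠ X.edge χ →
      bef o num D (X.t2 (leftFlag X o χ)) φ = bef o num D χ φ := by
    intro χ hχ
    have h1 : χ ≠ φ := by rintro rfl; exact hχ rfl
    have h2 : X.t2 χ ≠ φ := by rintro rfl; exact hχ (X.edge_t2 χ)
    unfold leftFlag
    split_ifs
    · exact bef_t2_left num D ho h1 h2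
    · rw [X.t2_t2]
  rw [dualPot_single num D ho, key _ h, key _ (by rwa [X.edge_t0])]

lemma cross_of_edge_ne (ho : X.IsLabelling ω o) {φ ψ : F} (h : X.edge φ ≠ X.edge ψ) :
    cross o num D (X.edge φ) (X.edge ψ) =
      crossing (bef o num D) ψ (X.t0 ψ) φ (X.t0 φ) := by
  unfold cross crossing
  rw [dualChain_edge num D ho, dualPot_single_of_edge_ne num D ho h,
    dualPot_single_of_edge_ne num D ho (by rwa [X.edge_t0])]
  ring

lemma crossing_comm (ho : X.IsLabelling ω o) {a b c d : F} (hac : a ≠ c) (had : a ≠ d)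
    (hbc : b ≠ c) (hbd : b ≠ d) :
    crossing (bef o num D) a b c d = crossing (bef o num D) c d a b := by
  have h1 := bef_add_bef num D ho hac
  have h2 := bef_add_bef num D ho had
  have h3 := bef_add_bef num D ho hbc
  have h4 := bef_add_bef num D ho hbd
  unfold crossing
  have h5 : ∀ x y z u x' y' z' u' : ZMod 2, x + x' = 1 → y + y' = 1 → z + z' = 1 → u + u' = 1 →
      x + y + z + u = x' + z' + y' + u' := by decide
  exact h5 _ _ _ _ _ _ _ _ h1 h2 h3 h4

lemma cross_comm (ho : X.IsLabelling ω o) (e e' : X.Edge) :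
    cross o num D e e' = cross o num D e' e := by
  by_cases h : e = e'
  · rw [h]
  · obtain ⟨φ, rfl⟩ := X.edge_surj e
    obtain ⟨ψ, rfl⟩ := X.edge_surj e'
    have hne : ∀ a b, X.edge a = X.edge φ → X.edge b = X.edge ψ → b ≠ a := by
      rintro a _ h1 h2 rfl; exact h (h1.symm.trans h2)
    rw [cross_of_edge_ne num D ho h, cross_of_edge_ne num D ho (Ne.symm h)]
    exact crossing_comm num D ho (hne _ _ rfl rfl) (hne _ _ (X.edge_t0 φ) rfl)
      (hne _ _ rfl (X.edge_t0 ψ)) (hne _ _ (X.edge_t0 φ) (X.edge_t0 ψ))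

/-- If `φ` is the right-hand flag at one end, that of the other end is `t0 φ`, on the same side of
the edge, when `ω e = 1`, and `t2 (t0 φ)`, on the opposite side, when `ω e = 0`. In the first case
the two copies cross once. -/
lemma cross_self (ho : X.IsLabelling ω o) (e : X.Edge) : cross o num D e e = ω e := by
  obtain ⟨φ, rfl, hφ⟩ : ∃ φ, X.edge φ = e ∧ o φ = 1 := by
    obtain ⟨φ, rfl⟩ := X.edge_surj e
    exact ⟨X.t2 (leftFlag X o φ), by rw [X.edge_t2, edge_leftFlag],
      by rw [ho.t2, o_leftFlag ho, zero_add]⟩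
  have hne := X.t0_ne φ
  have h1 := bef_add_bef num D ho hne
  unfold cross
  rw [dualChain_edge num D ho, dualPot_single num D ho, dualPot_single num D ho,
    leftFlag_of_one hφ, X.t2_t2, bef_self]
  have h0 := ho.t0 φ
  rw [hφ] at h0
  rcases ZMod.two_eq_zero_or_one (ω (X.edge φ)) with hω | hω
  · have h2 : o (X.t0 φ) = 0 := by rw [h0, hω]; decide
    have h3 : X.t2 (X.t0 φ) ≠ φ := by rw [← X.t0_t2]; exact X.t0_t2_ne φ
    have h4 := bef_t2_self num D ho (X.t2 (X.t0 φ))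
    rw [X.t2_t2, ho.t2, h2] at h4
    rw [leftFlag_eq_self h2, bef_t2_left num D ho hne h3, h4, hω]
    revert h1
    generalize bef o num D (X.t0 φ) φ = a
    generalize bef o num D φ (X.t0 φ) = b
    revert a b; decide
  · have h2 : o (X.t0 φ) = 1 := by rw [h0, hω]; decide
    rw [leftFlag_of_one h2, X.t2_t2, bef_self, hω, zero_add, add_zero, h1]

/-- The case of equal edges is needed because a face may lie on both sides of an edge. Its walk then
uses two chords of that edge, ending at flags on opposite sides, and they cross with parity `ω e`.
-/
lemma crossing_eq_cross (ho : X.IsLabelling ω o) {φ ψ : F} (h : ψ ≠ φ) (h' : ψ ≠ X.t0 φ) :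
    crossing (bef o num D) φ (X.t0 φ) ψ (X.t0 ψ) = cross o num D (X.edge φ) (X.edge ψ) := by
  by_cases he : X.edge φ = X.edge ψ
  · rw [← he, cross_self num D ho]
    have h1 := bef_add_bef num D ho (X.t0_ne φ)
    have h2 := bef_t2_self num D ho φ
    have h3 := bef_t2_self num D ho (X.t0 φ)
    have h4 : bef o num D φ (X.t2 (X.t0 φ)) = bef o num D φ (X.t0 φ) :=
      bef_t2_right num D ho (X.t0_ne φ).symm (by rw [← X.t0_t2]; exact X.t0_t2_ne φ)
    have h5 : bef o num D (X.t0 φ) (X.t2 φ) = bef o num D (X.t0 φ) φ :=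
      bef_t2_right num D ho (X.t0_ne φ) (X.t0_ne_t2 φ).symm
    rw [ho.t0] at h3
    have h6 : ∀ a b c w : ZMod 2, a + b = 1 → c + b + a + (c + 1 + w) = w := by decide
    unfold crossing
    rcases X.edge_eq_iff.1 he.symm with rfl | rfl | rfl | rfl
    · exact absurd rfl h
    · rw [X.t0_t2, h2, h3, h4, h5]
      exact h6 _ _ _ _ h1
    · exact absurd rfl h'
    · have h7 := h6 _ _ (o φ) (ω (X.edge φ)) h1
      rw [X.t0_t0, X.t0_t2, h2, h3, h4, h5]
      linear_combination h7
  · rw [cross_comm num D ho, cross_of_edge_ne num D ho (Ne.symm he)]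

/-! ### The quadratic function on chains -/

variable (ω o) in
/-- The value of the quadratic function on an edge. -/
def weight (K : X.EdgeOrientation) (e : X.Edge) : ZMod 4 :=
  two (K.1 e.out + bef o num D e.out (X.t0 e.out) + if e ∈ D.1 then 1 + ω e else 0) -
    ((ω e).val : ZMod 4)

/-- Reversing the edge changes both `K` and the order of its two ends, so the weight does not depend
on the chosen flag. -/
lemma weight_edge (ho : X.IsLabelling ω o) (K : X.EdgeOrientation) (φ : F) :
    weight ω o num D K (X.edge φ) = two (K.1 φ + bef o num D φ (X.t0 φ) +
      if X.edge φ ∈ D.1 then 1 + ω (X.edge φ) else 0) - ((ω (X.edge φ)).val : ZMod 4) := by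
  have ht2 : ∀ φ, K.1 (X.t2 φ) + bef o num D (X.t2 φ) (X.t0 (X.t2 φ)) =
      K.1 φ + bef o num D φ (X.t0 φ) := by
    intro φ
    rw [(K.2 φ).1, bef_t2_left num D ho (X.t0_t2_ne φ).symm
      (by rw [X.t0_t2]; exact fun h => X.t0_ne φ (X.t2.injective h).symm), X.t0_t2,
      bef_t2_right num D ho (X.t0_ne φ).symm (by rw [← X.t0_t2]; exact X.t0_t2_ne φ)]
  have ht0 : ∀ φ, K.1 (X.t0 φ) + bef o num D (X.t0 φ) (X.t0 (X.t0 φ)) =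
      K.1 φ + bef o num D φ (X.t0 φ) := by
    intro φ
    rw [(K.2 φ).2, X.t0_t0]
    have := bef_add_bef num D ho (X.t0_ne φ)
    have h : ∀ a b k : ZMod 2, a + b = 1 → k + 1 + a = k + b := by decide
    exact h _ _ _ this
  unfold weight
  rcases X.edge_eq_iff.1 (edge_out (X.edge φ)) with h | h | h | h <;> rw [h]
  · rw [ht2]
  · rw [ht0]
  · rw [ht0, ht2]

variable (ω o) in
/-- The matrix of the quadratic function. -/
def gram (K : X.EdgeOrientation) (e e' : X.Edge) : ZMod 4 :=
  if e = e' then weight ω o num D K e else ((cross o num D e e').val : ZMod 4)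

lemma gram_comm (ho : X.IsLabelling ω o) (K : X.EdgeOrientation) (e e' : X.Edge) :
    gram ω o num D K e e' = gram ω o num D K e' e := by
  unfold gram
  by_cases h : e = e'
  · rw [h]
  · rw [if_neg h, if_neg (Ne.symm h), cross_comm num D ho]

/-- The diagonal fits as well: a weight is congruent to `ω e` modulo 2, which is the self-crossing
of the edge. -/
lemma red_gram (ho : X.IsLabelling ω o) (K : X.EdgeOrientation) (e e' : X.Edge) :
    red (gram ω o num D K e e') = cross o num D e e' := by
  unfold gram
  split_ifs with h
  · rw [← h, cross_self num D ho]
    unfold weight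
    rw [map_sub, red_two, red_natCast_val, zero_sub, CharTwo.neg_eq]
  · exact red_natCast_val _

variable (ω o) in
/-- The quadratic function on chains. -/
def quad (K : X.EdgeOrientation) (x : X.Edge → ZMod 2) : ZMod 4 :=
  ∑ e, ∑ e', gram ω o num D K e e' * ((x e).val : ZMod 4) * ((x e').val : ZMod 4)

/-- By symmetry of the matrix, changing a lift by 2k changes the value by a multiple of 4. -/
lemma quad_eq_of_lift (ho : X.IsLabelling ω o) (K : X.EdgeOrientation) (x : X.Edge → ZMod 2)
    (z : X.Edge → ZMod 4) (hz : ∀ e, red (z e) = x e) :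
    quad ω o num D K x = ∑ e, ∑ e', gram ω o num D K e e' * z e * z e' := by
  choose k hk using fun e => exists_eq_add_two_mul (hz e)
  have h4 : (4 : ZMod 4) = 0 := by decide
  have h : ∑ e, ∑ e', gram ω o num D K e e' * z e * z e' = quad ω o num D K x +
      2 * (∑ e, ∑ e', gram ω o num D K e e' * k e * ((x e').val : ZMod 4)) +
      2 * (∑ e, ∑ e', gram ω o num D K e e' * ((x e).val : ZMod 4) * k e') := by
    unfold quad
    simp only [mul_sum, ← sum_add_distrib]
    refine sum_congr rfl fun e _ => sum_congr rfl fun e' _ => ?_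
    rw [hk e, hk e']
    linear_combination (gram ω o num D K e e' * k e * k e') * h4
  rw [h, sum_comm (f := fun e e' => gram ω o num D K e e' * ((x e).val : ZMod 4) * k e')]
  have h2 : ∑ e, ∑ e', gram ω o num D K e' e * ((x e').val : ZMod 4) * k e =
      ∑ e, ∑ e', gram ω o num D K e e' * k e * ((x e').val : ZMod 4) := by
    refine sum_congr rfl fun e _ => sum_congr rfl fun e' _ => ?_
    rw [gram_comm num D ho]; ring
  rw [h2]
  linear_combination (-∑ e, ∑ e', gram ω o num D K e e' * k e * ((x e').val : ZMod 4)) * h4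

/-- Evaluate on the sum of the two lifts: the two mixed terms coincide by symmetry, and twice such a
term depends only on its residue modulo 2. -/
lemma quad_add (ho : X.IsLabelling ω o) (K : X.EdgeOrientation) (x y : X.Edge → ZMod 2) :
    quad ω o num D K (x + y) = quad ω o num D K x + quad ω o num D K y +
      two (∑ e, x e * dualChain o num D y e) := by
  rw [quad_eq_of_lift num D ho K (x + y)
    (fun e => ((x e).val : ZMod 4) + ((y e).val : ZMod 4))
    (fun e => by rw [map_add, red_natCast_val, red_natCast_val]; rfl)]
  have h2 : two (∑ e, x e * dualChain o num D y e) =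
      2 * ∑ e, ∑ e', gram ω o num D K e e' * ((x e).val : ZMod 4) * ((y e').val : ZMod 4) := by
    rw [← two_red]
    congr 1
    rw [map_sum]
    refine sum_congr rfl fun e _ => ?_
    rw [dualChain_eq_sum, mul_sum, map_sum]
    refine sum_congr rfl fun e' _ => ?_
    rw [map_mul, map_mul, red_gram num D ho, red_natCast_val, red_natCast_val]; ring
  have h3 : ∑ e, ∑ e', gram ω o num D K e e' * ((y e).val : ZMod 4) * ((x e').val : ZMod 4) =
      ∑ e, ∑ e', gram ω o num D K e e' * ((x e).val : ZMod 4) * ((y e').val : ZMod 4) := by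
    rw [sum_comm]
    refine sum_congr rfl fun e _ => sum_congr rfl fun e' _ => ?_
    rw [gram_comm num D ho]; ring
  rw [h2, two_mul]
  nth_rw 1 [← h3]
  unfold quad
  simp only [← sum_add_distrib]
  refine sum_congr rfl fun e _ => sum_congr rfl fun e' _ => ?_
  ring

lemma quad_zero (K : X.EdgeOrientation) : quad ω o num D K 0 = 0 := by simp [quad]

lemma quad_single (K : X.EdgeOrientation) (e : X.Edge) :
    quad ω o num D K (Pi.single e 1) = weight ω o num D K e := by
  unfold quad
  rw [Finset.sum_eq_single e, Finset.sum_eq_single e]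
  · simp [gram, ZMod.val_one]
  · intro e' _ h; simp [Pi.single_eq_of_ne h]
  · simp
  · intro e' _ h; simp [Pi.single_eq_of_ne h]
  · simp

/-- The edges may repeat, as they do on the boundary of a face that meets an edge twice. -/
lemma quad_sum_single (ho : X.IsLabelling ω o) (K : X.EdgeOrientation) (f : ℕ → X.Edge) (m : ℕ) :
    quad ω o num D K (∑ i ∈ range m, Pi.single (f i) 1) =
      ∑ i ∈ range m, weight ω o num D K (f i) +
        two (∑ j ∈ range m, ∑ i ∈ range j, cross o num D (f i) (f j)) := by
  induction m with
  | zero => simp [quad_zero]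
  | succ m ih =>
    rw [sum_range_succ, quad_add num D ho, ih, quad_single, sum_range_succ, sum_range_succ, map_add]
    have : ∑ e, (∑ i ∈ range m, Pi.single (M := fun _ : X.Edge => ZMod 2) (f i) 1) e *
        dualChain o num D (Pi.single (f m) 1) e = ∑ i ∈ range m, cross o num D (f i) (f m) := by
      simp only [Finset.sum_apply, sum_mul]
      rw [sum_comm]
      refine sum_congr rfl fun i _ => ?_
      rw [Finset.sum_eq_single (f i)]
      · simp [cross]
      · intro e _ h; simp [Pi.single_eq_of_ne h]
      · simp
    rw [this]; ring

/-- The quadratic function on the chain of a sequence of oriented edges. -/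
lemma quad_flags (ho : X.IsLabelling ω o) (K : X.EdgeOrientation) (ψ : ℕ → F) (m : ℕ)
    (h : ∀ i j, i < j → j < m → ψ j ≠ ψ i ∧ ψ j ≠ X.t0 (ψ i)) :
    quad ω o num D K (∑ i ∈ range m, Pi.single (X.edge (ψ i)) 1) =
      two (∑ i ∈ range m, K.1 (ψ i) +
        (∑ i ∈ range m, bef o num D (ψ i) (X.t0 (ψ i)) + ∑ j ∈ range m, ∑ i ∈ range j,
          crossing (bef o num D) (ψ i) (X.t0 (ψ i)) (ψ j) (X.t0 (ψ j))) +
        ∑ i ∈ range m, if X.edge (ψ i) ∈ D.1 then 1 + ω (X.edge (ψ i)) else 0) -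
      ∑ i ∈ range m, ((ω (X.edge (ψ i))).val : ZMod 4) := by
  have h1 : ∑ j ∈ range m, ∑ i ∈ range j,
      crossing (bef o num D) (ψ i) (X.t0 (ψ i)) (ψ j) (X.t0 (ψ j)) =
      ∑ j ∈ range m, ∑ i ∈ range j, cross o num D (X.edge (ψ i)) (X.edge (ψ j)) := by
    refine sum_congr rfl fun j hj => sum_congr rfl fun i hi => ?_
    have := h i j (mem_range.1 hi) (mem_range.1 hj)
    exact crossing_eq_cross num D ho this.1 this.2
  rw [h1, quad_sum_single num D ho]
  simp only [weight_edge num D ho, sum_sub_distrib, map_add, map_sum, sum_add_distrib]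
  ring

end

end SurfaceGraph

namespace SurfaceGraph

noncomputable section

open Classical

variable {F : Type*} {X : SurfaceGraph F} [Fintype F]

/-! ### Boundaries and coboundaries -/

lemma sum_all_flags_of_edge {A : Type*} [AddCommMonoid A] (f : F → A) (φ : F) :
    (∑ χ, if X.edge χ = X.edge φ then f χ else 0) =
      f φ + f (X.t0 φ) + (f (X.t2 φ) + f (X.t0 (X.t2 φ))) := by
  have h1 := X.t0_ne φ
  have h2 := X.t2_ne φ
  have h3 := X.t0_t2_ne φ
  have h4 := X.t0_ne_t2 φ
  have h5 : X.t0 (X.t2 φ) ≠ X.t0 φ := fun h => h2 (X.t0.injective h)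
  have h6 := X.t0_ne (X.t2 φ)
  have hs : (univ.filter fun χ => X.edge χ = X.edge φ) =
      {φ, X.t0 φ, X.t2 φ, X.t0 (X.t2 φ)} := by
    ext χ
    simp only [mem_filter, mem_univ, true_and, X.edge_eq_iff, mem_insert, mem_singleton]
    tauto
  rw [← sum_filter, hs, sum_insert, sum_insert, sum_insert, sum_singleton, add_assoc]
  · simpa using h6.symm
  · simp [h4, h5.symm]
  · simp [h1.symm, h2.symm, h3.symm]

lemma sum_all_flags {A : Type*} [AddCommMonoid A] (f : F → A) (h : X.Edge → A)
    (hh : ∀ φ, h (X.edge φ) = f φ + f (X.t0 φ) + (f (X.t2 φ) + f (X.t0 (X.t2 φ)))) :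
    ∑ χ, f χ = ∑ e, h e := by
  rw [← sum_fiberwise (s := univ) (g := X.edge)]
  refine sum_congr rfl fun e _ => ?_
  obtain ⟨φ, rfl⟩ := X.edge_surj e
  rw [sum_filter, sum_all_flags_of_edge, hh]

/-- The fixed-point-free involution `t1` cancels the terms in pairs. -/
lemma sum_eq_zero_of_t1 (f : F → ZMod 2) (hf : ∀ φ, f (X.t1 φ) = f φ) : ∑ φ, f φ = 0 :=
  sum_involution (fun φ _ => X.t1 φ) (fun φ _ => by rw [hf, ZMod.two_add_self])
    (fun φ _ _ => X.t1_ne φ) (fun _ _ => mem_univ _) (fun φ _ => X.t1_t1 φ)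

lemma bd2_edge (z : X.Face → ZMod 2) (φ : F) :
    X.bd2 z (X.edge φ) = z (X.face φ) + z (X.face (X.t2 φ)) := rfl

lemma bd2_mem (z : X.Face → ZMod 2) : X.bd2 z ∈ X.Z1 := by
  rw [LinearMap.mem_ker]
  funext v
  rw [bd1_apply, ← sum_all_flags (fun φ => if X.vert φ = v then z (X.face φ) else 0)]
  · exact sum_eq_zero_of_t1 _ fun φ => by rw [X.vert_t1, X.face_t1]
  · intro φ
    rw [bd2_edge, edgeBoundary_edge]
    rw [X.face_t0, X.face_t0, X.t0_t2, X.vert_t2, X.vert_t2]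
    split_ifs <;> ring

lemma sum_mul_coboundary (x c : X.Edge → ZMod 2) (s : X.Vertex → ZMod 2)
    (hc : ∀ φ, c (X.edge φ) = s (X.vert φ) + s (X.vert (X.t0 φ))) :
    ∑ e, x e * c e = ∑ v, X.bd1 x v * s v := by
  simp only [bd1_apply, sum_mul]
  rw [sum_comm]
  refine sum_congr rfl fun e _ => ?_
  obtain ⟨φ, rfl⟩ := X.edge_surj e
  simp only [edgeBoundary_edge, hc, mul_assoc, ← mul_sum, add_mul, sum_add_distrib, ite_mul,
    one_mul, zero_mul, sum_ite_eq, mem_univ, if_true]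

/-- Spread over the flags, the sum becomes that of z(face) · g, with g the 2-chain of the homology.
This product is invariant under `t1`. -/
lemma sum_bd2_mul {y c : X.Edge → ZMod 2} (h : X.DualHomologous y c) (z : X.Face → ZMod 2) :
    ∑ e, X.bd2 z e * c e = 0 := by
  obtain ⟨g, hg⟩ := h
  rw [← sum_all_flags (fun φ => z (X.face φ) * g φ)]
  · exact sum_eq_zero_of_t1 _ fun φ => by rw [X.face_t1, (hg φ).1]
  · intro φ
    have h1 := (hg φ).2.2
    have h2 := (hg (X.t2 φ)).2.2
    rw [X.edge_t2] at h2
    rw [bd2_edge, X.face_t0, X.face_t0, h1, h2]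
    have : ∀ a b c g g' : ZMod 2, (a + b) * c = a * g + a * (g + c) + (b * g' + b * (g' + c)) := by
      decide
    exact this _ _ _ _ _

/-- A function on flags invariant under `t1` and `t2` is a function on vertices. -/
lemma exists_vertex_function {A : Type*} (g : F → A) (h1 : ∀ φ, g (X.t1 φ) = g φ)
    (h2 : ∀ φ, g (X.t2 φ) = g φ) : ∃ s : X.Vertex → A, ∀ φ, s (X.vert φ) = g φ :=
  ⟨Quot.lift g (by rintro a b (rfl | rfl); exacts [(h1 a).symm, (h2 a).symm]), fun _ => rfl⟩

/-- A function on flags invariant under `t0` and `t1` is a function on faces. -/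
lemma exists_face_function {A : Type*} (g : F → A) (h0 : ∀ φ, g (X.t0 φ) = g φ)
    (h1 : ∀ φ, g (X.t1 φ) = g φ) : ∃ z : X.Face → A, ∀ φ, z (X.face φ) = g φ :=
  ⟨Quot.lift g (by rintro a b (rfl | rfl); exacts [(h0 a).symm, (h1 a).symm]), fun _ => rfl⟩

/-- Adding z to the 2-chain g gives a function constant around each vertex, so c is a coboundary and
pairs to zero with cycles. -/
lemma sum_mul_of_dualHomologous_bd2 {c : X.Edge → ZMod 2} {z : X.Face → ZMod 2}
    (h : X.DualHomologous (X.bd2 z) c) {x : X.Edge → ZMod 2} (hx : x ∈ X.Z1) :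
    ∑ e, x e * c e = 0 := by
  obtain ⟨g, hg⟩ := h
  have h3 : ∀ a b c : ZMod 2, a + (b + c) + c = a + b := by decide
  have h4 : ∀ a b c : ZMod 2, b = a + b + c + (a + c) := by decide
  obtain ⟨s, hs⟩ := exists_vertex_function (X := X) (fun φ => g φ + z (X.face φ))
    (fun φ => by rw [(hg φ).1, X.face_t1])
    (fun φ => by rw [(hg φ).2.1, bd2_edge, h3])
  rw [sum_mul_coboundary x c s, LinearMap.mem_ker.1 hx]
  · simp
  · intro φ
    rw [hs, hs, (hg φ).2.2, X.face_t0, add_comm (g φ + _)]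
    exact h4 _ _ _

lemma DualHomologous.add {y y' c c' : X.Edge → ZMod 2} (h : X.DualHomologous y c)
    (h' : X.DualHomologous y' c') : X.DualHomologous (y + y') (c + c') := by
  obtain ⟨g, hg⟩ := h
  obtain ⟨g', hg'⟩ := h'
  refine ⟨g + g', fun φ => ⟨?_, ?_, ?_⟩⟩
  · simp only [Pi.add_apply, (hg φ).1, (hg' φ).1]
  · simp only [Pi.add_apply, (hg φ).2.1, (hg' φ).2.1]; ring
  · simp only [Pi.add_apply, (hg φ).2.2, (hg' φ).2.2]; ring

/-! ### The intersection form -/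

lemma homologyClass_eq_iff {x y : X.Z1} :
    X.homologyClass x = X.homologyClass y ↔ ∃ z, X.bd2 z = x.1 + y.1 := by
  unfold homologyClass
  rw [Submodule.Quotient.eq, Submodule.submoduleOf, Submodule.mem_comap, LinearMap.mem_range]
  refine exists_congr fun z => ?_
  rw [Submodule.subtype_apply, Submodule.coe_sub]
  have : x.1 - y.1 = x.1 + y.1 := by
    funext e
    exact CharTwo.sub_eq_add _ _
  rw [this]

lemma homologyClass_surj (a : X.H1) : ∃ x, X.homologyClass x = a :=
  Submodule.Quotient.mk_surjective _ a

lemma homologyClass_add (x y : X.Z1) :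
    X.homologyClass (x + y) = X.homologyClass x + X.homologyClass y := rfl

/-- This shows that the choice in `intersection` is harmless: the pairing vanishes when either
argument is a boundary. -/
lemma intersection_eq (x y : X.Z1) {c : X.Edge → ZMod 2} (h : X.DualHomologous y.1 c) :
    X.intersection (X.homologyClass x) (X.homologyClass y) = ∑ e, x.1 e * c e := by
  have hex : ∃ m : ZMod 2, ∃ (x' y' : X.Z1) (c : X.Edge → ZMod 2),
      X.homologyClass x' = X.homologyClass x ∧ X.homologyClass y' = X.homologyClass y ∧
      X.DualHomologous y' c ∧ m = ∑ e, x'.1 e * c e := ⟨_, x, y, c, rfl, rfl, h, rfl⟩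
  obtain ⟨x', y', c', hx, hy, h', hm⟩ := Classical.epsilon_spec hex
  change X.intersection (X.homologyClass x) (X.homologyClass y) = _ at hm
  rw [hm]
  obtain ⟨z, hz⟩ := homologyClass_eq_iff.1 hx
  obtain ⟨u, hu⟩ := homologyClass_eq_iff.1 hy
  have h1 := sum_bd2_mul h z
  have h2 := h'.add h
  rw [← hu] at h2
  have h3 := sum_mul_of_dualHomologous_bd2 h2 x'.2
  rw [hz] at h1
  simp only [Pi.add_apply, add_mul, mul_add, sum_add_distrib] at h1 h3
  have h4 : ∀ a b c : ZMod 2, a + b = 0 → c + a = 0 → c = b := by decide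
  exact h4 _ _ _ h1 h3

variable {ω : X.Edge → ZMod 2} {o : F → ZMod 2}
variable {n : ℕ} (num : X.Vertex ≃ Fin (2 * n)) (D : X.Dimer)

lemma intersection_dualChain (ho : X.IsLabelling ω o) (x y : X.Z1) :
    X.intersection (X.homologyClass x) (X.homologyClass y) =
      ∑ e, x.1 e * dualChain o num D y.1 e :=
  intersection_eq x y (dualHomologous_dualChain num D ho y.2)

lemma intersection_add_left (num : X.Vertex ≃ Fin (2 * n)) (D : X.Dimer)
    (ho : X.IsLabelling ω o) (a b c : X.H1) :
    X.intersection (a + b) c = X.intersection a c + X.intersection b c := by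
  obtain ⟨x, rfl⟩ := homologyClass_surj a
  obtain ⟨y, rfl⟩ := homologyClass_surj b
  obtain ⟨z, rfl⟩ := homologyClass_surj c
  rw [← homologyClass_add]
  simp only [intersection_dualChain num D ho, ← sum_add_distrib]
  exact sum_congr rfl fun e _ => add_mul _ _ _

lemma intersection_add_right (num : X.Vertex ≃ Fin (2 * n)) (D : X.Dimer)
    (ho : X.IsLabelling ω o) (a b c : X.H1) :
    X.intersection a (b + c) = X.intersection a b + X.intersection a c := by
  obtain ⟨x, rfl⟩ := homologyClass_surj a
  obtain ⟨y, rfl⟩ := homologyClass_surj b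
  obtain ⟨z, rfl⟩ := homologyClass_surj c
  rw [← homologyClass_add, intersection_eq x (y + z)
    ((dualHomologous_dualChain num D ho y.2).add (dualHomologous_dualChain num D ho z.2))]
  simp only [intersection_dualChain num D ho, ← sum_add_distrib]
  exact sum_congr rfl fun e _ => mul_add (x.1 e) _ _

/-- A functional on a finite power of `ZMod 2` that vanishes on the kernel of `f` factors
through `f`. -/
lemma exists_factor {ι κ : Type*} [Fintype ι] [Fintype κ] (f : (ι → ZMod 2) →ₗ[ZMod 2] (κ → ZMod 2))
    (c : ι → ZMod 2) (h : ∀ x, f x = 0 → ∑ i, x i * c i = 0) :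
    ∃ s : κ → ZMod 2, ∀ x, ∑ i, x i * c i = ∑ k, f x k * s k := by
  let φ : Module.Dual (ZMod 2) (ι → ZMod 2) := ∑ i, c i • LinearMap.proj i
  have hφ : ∀ x, φ x = ∑ i, x i * c i := fun x => by
    simp [φ, LinearMap.sum_apply, mul_comm]
  have hmem : φ ∈ LinearMap.range f.dualMap := by
    rw [LinearMap.range_dualMap_eq_dualAnnihilator_ker, Submodule.mem_dualAnnihilator]
    intro x hx
    rw [hφ]
    exact h x hx
  obtain ⟨s, hs⟩ := hmem
  refine ⟨fun k => s (Pi.single k 1), fun x => ?_⟩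
  rw [← hφ, ← hs, LinearMap.dualMap_apply]
  conv_lhs => rw [pi_eq_sum_univ (f x), map_sum]
  refine sum_congr rfl fun k _ => ?_
  rw [map_smul, smul_eq_mul]
  congr 2
  funext j
  simp [Pi.single_apply, eq_comm]

/-- Poincaré duality by hand. If the dual cycle c of y pairs to zero with all cycles, it is the
coboundary of a function s on vertices. Then g + s is constant on each face, hence a 2-chain, and
its boundary is y. -/
lemma intersection_nondegenerate (num : X.Vertex ≃ Fin (2 * n)) (D : X.Dimer)
    (ho : X.IsLabelling ω o) {b : X.H1}
    (h : ∀ a, X.intersection a b = 0) : b = 0 := by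
  obtain ⟨y, rfl⟩ := homologyClass_surj b
  obtain ⟨g, hg⟩ := dualHomologous_dualChain num D ho y.2
  obtain ⟨s, hs⟩ := exists_factor X.bd1 (dualChain o num D y.1) (fun x hx => by
    rw [← h (X.homologyClass ⟨x, hx⟩), intersection_dualChain num D ho])
  have hc : ∀ φ, dualChain o num D y.1 (X.edge φ) = s (X.vert φ) + s (X.vert (X.t0 φ)) := by
    intro φ
    have := hs (Pi.single (X.edge φ) 1)
    rw [SimpleClosedCurve.bd1_single] at this
    simp only [Pi.single_apply, Pi.add_apply, ite_mul, one_mul, zero_mul, add_mul,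
      sum_add_distrib, sum_ite_eq', mem_univ, if_true] at this
    exact this
  have h3 : ∀ a b c : ZMod 2, a + (b + c) + c = a + b := by decide
  have h4 : ∀ a b c : ZMod 2, a + c + (a + b + c) = b := by decide
  obtain ⟨z, hz⟩ := exists_face_function (X := X) (fun φ => g φ + s (X.vert φ))
    (fun φ => by rw [(hg φ).2.2, hc, h3]) (fun φ => by rw [(hg φ).1, X.vert_t1])
  change _ = X.homologyClass 0
  rw [homologyClass_eq_iff]
  refine ⟨z, ?_⟩
  funext e
  obtain ⟨φ, rfl⟩ := X.edge_surj e
  rw [bd2_edge, hz, hz, (hg φ).2.1, X.vert_t2, h4]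
  simp

end

end SurfaceGraph

namespace SurfaceGraph

noncomputable section

open Classical

variable {F : Type*} {X : SurfaceGraph F} [Fintype F]

/-! ### The boundary walks of the faces -/

variable (X) in
/-- The next flag on the boundary walk of a face. -/
def walk : Equiv.Perm F := X.t1 * X.t0

lemma walk_apply (φ : F) : X.walk φ = X.t1 (X.t0 φ) := rfl

lemma walk_pow_succ (i : ℕ) (φ : F) : (X.walk ^ (i + 1)) φ = X.t1 (X.t0 ((X.walk ^ i) φ)) := by
  rw [pow_succ', Equiv.Perm.mul_apply, walk_apply]

/-- `t0` reverses the walk, so an equality shortens by two steps until `t0` or `t1` has a fixed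
point. Consequently the two directions of the boundary of a face, its two lifts, are disjoint
cycles. -/
lemma walk_pow_ne_t0 (k : ℕ) (ψ : F) : (X.walk ^ k) ψ ≠ X.t0 ψ := by
  induction k using Nat.strong_induction_on generalizing ψ with
  | _ k ih =>
    match k with
    | 0 => exact (X.t0_ne ψ).symm
    | 1 => exact X.t1_ne _
    | k + 2 =>
      intro h
      apply ih k (by omega) (X.walk ψ)
      apply X.walk.injective
      rw [← Equiv.Perm.mul_apply, ← Equiv.Perm.mul_apply, ← pow_succ', ← pow_succ, h, walk_apply,
        walk_apply, X.t0_t0, X.t1_t1]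

lemma walk_pow_ne_t0_walk_pow (i j : ℕ) (ψ : F) : (X.walk ^ i) ψ ≠ X.t0 ((X.walk ^ j) ψ) := by
  rcases le_total j i with h | h
  · obtain ⟨k, rfl⟩ := Nat.exists_eq_add_of_le' h
    rw [pow_add, Equiv.Perm.mul_apply]
    exact walk_pow_ne_t0 _ _
  · obtain ⟨k, rfl⟩ := Nat.exists_eq_add_of_le' h
    intro h'
    rw [pow_add, Equiv.Perm.mul_apply] at h'
    apply walk_pow_ne_t0 k ((X.walk ^ i) ψ)
    rw [h', X.t0_t0, ← h']

/-- The length of the boundary walk of a face. -/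
def flen (φ : F) : ℕ := Function.minimalPeriod X.walk φ

lemma flen_pos (φ : F) : 0 < X.flen φ :=
  Function.minimalPeriod_pos_of_mem_periodicPts (X.walk.injective.mem_periodicPts φ)

lemma walk_pow_flen (φ : F) : (X.walk ^ X.flen φ) φ = φ := by
  rw [← Equiv.Perm.iterate_eq_pow]
  exact Function.iterate_minimalPeriod

lemma walk_pow_inj {k l : ℕ} {φ : F} (hk : k < X.flen φ) (hl : l < X.flen φ)
    (h : (X.walk ^ k) φ = (X.walk ^ l) φ) : k = l := by
  rw [← Equiv.Perm.iterate_eq_pow, ← Equiv.Perm.iterate_eq_pow] at h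
  exact (Function.iterate_eq_iterate_iff_of_lt_minimalPeriod hk hl).1 h

lemma sameCycle_iff {φ ψ : F} : X.walk.SameCycle φ ψ ↔ ∃ i < X.flen φ, (X.walk ^ i) φ = ψ := by
  constructor
  · intro h
    obtain ⟨i, -, hi⟩ := h.exists_pow_eq'
    refine ⟨i % X.flen φ, Nat.mod_lt _ (flen_pos φ), ?_⟩
    rw [← hi, ← Equiv.Perm.iterate_eq_pow, ← Equiv.Perm.iterate_eq_pow]
    exact Function.iterate_mod_minimalPeriod_eq
  · rintro ⟨i, -, rfl⟩
    exact ⟨i, by simp⟩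

lemma sum_sameCycle {A : Type*} [AddCommMonoid A] (f : F → A) (φ : F) :
    ∑ ψ with X.walk.SameCycle φ ψ, f ψ = ∑ i ∈ range (X.flen φ), f ((X.walk ^ i) φ) := by
  have hs : (univ.filter fun ψ => X.walk.SameCycle φ ψ) =
      (range (X.flen φ)).image fun i => (X.walk ^ i) φ := by
    ext ψ
    simp only [mem_filter, mem_univ, true_and, mem_image, mem_range, sameCycle_iff]
  rw [hs, sum_image]
  intro i hi j hj h
  exact walk_pow_inj (mem_range.1 hi) (mem_range.1 hj) h

lemma face_walk_pow (i : ℕ) (φ : F) : X.face ((X.walk ^ i) φ) = X.face φ := by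
  induction i with
  | zero => rfl
  | succ i ih => rw [walk_pow_succ, X.face_t1, X.face_t0, ih]

lemma sameCycle_t0_t1 {φ ψ : F} (h : X.walk.SameCycle φ (X.t0 ψ)) :
    X.walk.SameCycle φ (X.t1 ψ) := by
  refine h.trans ⟨1, ?_⟩
  rw [zpow_one, walk_apply, X.t0_t0]

lemma sameCycle_t1_t0 {φ ψ : F} (h : X.walk.SameCycle φ ψ) :
    X.walk.SameCycle φ (X.t0 (X.t1 ψ)) := by
  refine h.trans (Equiv.Perm.SameCycle.symm ⟨1, ?_⟩)
  rw [zpow_one, walk_apply, X.t0_t0, X.t1_t1]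

lemma face_eq_iff {φ ψ : F} : X.face ψ = X.face φ ↔
    X.walk.SameCycle φ ψ ∨ X.walk.SameCycle φ (X.t0 ψ) := by
  constructor
  · intro h
    have key : ∀ x y, Relation.EqvGen (fun a b : F => b = X.t0 a ∨ b = X.t1 a) x y →
        ((X.walk.SameCycle φ x ∨ X.walk.SameCycle φ (X.t0 x)) ↔
          (X.walk.SameCycle φ y ∨ X.walk.SameCycle φ (X.t0 y))) := by
      intro x y hxy
      induction hxy with
      | rel x y h =>
        rcases h with rfl | rfl
        · rw [X.t0_t0, or_comm]
        · constructor
          · rintro (h | h)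
            · exact Or.inr (sameCycle_t1_t0 h)
            · exact Or.inl (sameCycle_t0_t1 h)
          · rintro (h | h)
            · have := sameCycle_t1_t0 h
              rw [X.t1_t1] at this
              exact Or.inr this
            · have := sameCycle_t0_t1 h
              rw [X.t1_t1] at this
              exact Or.inl this
      | refl x => rfl
      | symm x y _ ih => exact ih.symm
      | trans x y z _ _ ih1 ih2 => exact ih1.trans ih2
    exact (key _ _ (Quot.eqvGen_exact h)).2 (Or.inl (Equiv.Perm.SameCycle.refl _ _))
  · rintro (h | h)
    · obtain ⟨i, -, rfl⟩ := sameCycle_iff.1 h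
      exact face_walk_pow i φ
    · obtain ⟨i, -, hi⟩ := sameCycle_iff.1 h
      rw [← X.face_t0, ← hi, face_walk_pow]

/-- The boundary of a face is the chain of its boundary walk. -/
lemma bd2_single (φ : F) : X.bd2 (Pi.single (X.face φ) 1) =
    ∑ i ∈ range (X.flen φ), Pi.single (X.edge ((X.walk ^ i) φ)) 1 := by
  rw [← sum_sameCycle (fun ψ => Pi.single (M := fun _ : X.Edge => ZMod 2) (X.edge ψ) 1)]
  funext e
  obtain ⟨ψ, rfl⟩ := X.edge_surj e
  -- The flags of a face are split between the boundary walk and its reverse.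
  have key : ∀ ψ, (if X.face ψ = X.face φ then (1 : ZMod 2) else 0) =
      (if X.walk.SameCycle φ ψ then 1 else 0) + if X.walk.SameCycle φ (X.t0 ψ) then 1 else 0 := by
    intro ψ
    by_cases h1 : X.walk.SameCycle φ ψ
    · have h2 : ¬ X.walk.SameCycle φ (X.t0 ψ) := by
        intro h2
        obtain ⟨i, -, hi⟩ := sameCycle_iff.1 h1
        obtain ⟨j, -, hj⟩ := sameCycle_iff.1 h2
        apply walk_pow_ne_t0_walk_pow j i φ
        rw [hi, hj]
      rw [if_pos (face_eq_iff.2 (Or.inl h1)), if_pos h1, if_neg h2, add_zero]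
    · by_cases h2 : X.walk.SameCycle φ (X.t0 ψ)
      · rw [if_pos (face_eq_iff.2 (Or.inr h2)), if_neg h1, if_pos h2, zero_add]
      · rw [if_neg (fun h => (face_eq_iff.1 h).elim h1 h2), if_neg h1, if_neg h2, add_zero]
  rw [bd2_edge, Pi.single_apply, Pi.single_apply, key, key, Finset.sum_apply, sum_filter]
  rw [← sum_all_flags_of_edge (X := X) (fun χ => if X.walk.SameCycle φ χ then (1 : ZMod 2) else 0)]
  refine sum_congr rfl fun χ _ => ?_
  simp only [Pi.single_apply, eq_comm (a := X.edge ψ)]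
  split_ifs <;> rfl

variable {ω : X.Edge → ZMod 2} {o : F → ZMod 2}
variable {n : ℕ} (num : X.Vertex ≃ Fin (2 * n)) (D : X.Dimer)

lemma curvature_eq (K : X.EdgeOrientation) (φ : F) : X.curvature ω o K φ =
    (∑ i ∈ range (X.flen φ), (K.1 ((X.walk ^ i) φ) +
      (o ((X.walk ^ i) φ) + o ((X.walk ^ i) φ) * ω (X.edge ((X.walk ^ i) φ))))) + 1 := by
  have h : ∀ a b : ZMod 2, (if a = 1 ∧ b = 0 then (1 : ZMod 2) else 0) = a + a * b := by decide
  rw [← sum_sameCycle (fun ψ => K.1 ψ + (o ψ + o ψ * ω (X.edge ψ)))]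
  unfold curvature
  simp only [← h]
  rfl

/-- Sectors at the vertices do not cross. -/
lemma crossing_t1 (ho : X.IsLabelling ω o) {φ ψ : F} (h : φ ≠ ψ) (h' : φ ≠ X.t1 ψ) :
    crossing (bef o num D) φ (X.t1 φ) ψ (X.t1 ψ) = 0 := by
  have h1 : X.t1 φ ≠ ψ := fun h => h' (by rw [← h, X.t1_t1])
  have h2 : X.t1 φ ≠ X.t1 ψ := fun h2 => h (X.t1.injective h2)
  unfold crossing
  rw [bef_t1_right num D ho h h', bef_t1_right num D ho h1 h2, X.vert_t1]
  have : ∀ a b c : ZMod 2, a + (a + c) + b + (b + c) = 0 := by decide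
  exact this _ _ _

lemma sum_range_shift {A : Type*} [AddCommGroup A] (f : ℕ → A) {m : ℕ} (h : f m = f 0) :
    ∑ i ∈ range m, f (i + 1) = ∑ i ∈ range m, f i := by
  have h1 := sum_range_succ f m
  rw [sum_range_succ', h] at h1
  exact add_right_cancel h1

/-- The value of the quadratic function on the boundary of a face is its Kasteleyn curvature. -/
lemma quad_face (ho : X.IsLabelling ω o) (K : X.EdgeOrientation) (φ : F) :
    quad ω o num D K (X.bd2 (Pi.single (X.face φ) 1)) = two (X.curvature ω o K φ) := by
  set m := X.flen φ with hm
  set a : ℕ → F := fun i => (X.walk ^ i) φ with ha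
  have ha0 : a m = a 0 := walk_pow_flen φ
  have hstep : ∀ i, a (i + 1) = X.t1 (X.t0 (a i)) := fun i => walk_pow_succ i φ
  have hne : ∀ i j, a i ≠ X.t0 (a j) := fun i j => walk_pow_ne_t0_walk_pow i j φ
  have hinj : ∀ i j, i < m → j < m → a i = a j → i = j := fun i j hi hj h => walk_pow_inj hi hj h
  rw [bd2_single, curvature_eq]
  change quad ω o num D K (∑ i ∈ range m, Pi.single (X.edge (a i)) 1) =
    two ((∑ i ∈ range m, (K.1 (a i) + (o (a i) + o (a i) * ω (X.edge (a i))))) + 1)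
  rw [quad_flags num D ho K a m (fun i j hij hj =>
    ⟨fun h => by have := hinj j i hj (by omega) h; omega, hne j i⟩)]
  -- The edges of the walk are exchanged for its corners, which are sectors.
  rw [sum_pairs_cyclic (bef o num D) (fun x y h => bef_add_bef num D ho h) a (fun i => X.t0 (a i)) m
    (flen_pos φ) ha0 (fun i h0 hi h => by have := hinj i 0 hi (by omega) h; omega)
    (fun i _ => (hne 0 i).symm)]
  have hcr : ∑ j ∈ range m, ∑ i ∈ range j, crossing (bef o num D) (X.t0 (a i)) (a (i + 1))
      (X.t0 (a j)) (a (j + 1)) = 0 := by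
    refine sum_eq_zero fun j hj => sum_eq_zero fun i hi => ?_
    rw [hstep, hstep]
    apply crossing_t1 num D ho
    · intro h
      have := hinj i j (by have := mem_range.1 hi; have := mem_range.1 hj; omega) (mem_range.1 hj)
        (X.t0.injective h)
      have := mem_range.1 hi; omega
    · rw [← hstep]; exact (hne _ _).symm
  -- A corner is traversed in increasing order exactly when its second flag has `o = 1`, up to the
  -- cuts. Each edge of D on the walk meets cuts at its two ends, with total contribution 1 + ω.
  have hdesc : ∑ i ∈ range m, bef o num D (X.t0 (a i)) (a (i + 1)) = ∑ i ∈ range m, o (a i) +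
      ∑ i ∈ range m, if X.edge (a i) ∈ D.1 then 1 + ω (X.edge (a i)) else 0 := by
    have h1 : ∀ i, bef o num D (X.t0 (a i)) (a (i + 1)) = o (a (i + 1)) +
        (if X.edge (a i) ∈ D.1 then 1 + (o (a i) + ω (X.edge (a i))) else 0) +
        (if X.edge (a (i + 1)) ∈ D.1 then o (a (i + 1)) else 0) := by
      intro i
      have h2 : X.t0 (a i) = X.t1 (a (i + 1)) := by rw [hstep, X.t1_t1]
      have h3 : o (a (i + 1)) = o (a i) + ω (X.edge (a i)) := by
        rw [hstep, ho.t1, ho.t0]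
        have : ∀ x w : ZMod 2, x + 1 + w + 1 = x + w := by decide
        exact this _ _
      rw [h2, bef_t1_self num D ho, ← h2, X.edge_t0, ← h3, add_assoc]
      congr 1
      rcases ZMod.two_eq_zero_or_one (o (a (i + 1))) with h4 | h4
      · simp [h4]
      · simp [h4, ZMod.two_add_self]
    simp only [h1, sum_add_distrib]
    rw [sum_range_shift (fun i => o (a i)) (by rw [ha0]),
      sum_range_shift (fun i => if X.edge (a i) ∈ D.1 then o (a i) else 0) (by rw [ha0]), add_assoc,
      ← sum_add_distrib]
    congr 1
    refine sum_congr rfl fun i _ => ?_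
    split_ifs
    · have : ∀ x w : ZMod 2, 1 + (x + w) + x = 1 + w := by decide
      exact this _ _
    · exact add_zero 0
  -- The lift of o to `ZMod 4` telescopes around the face; along an edge it changes by ω - 2oω.
  have hω : ∑ i ∈ range m, ((ω (X.edge (a i))).val : ZMod 4) =
      two (∑ i ∈ range m, o (a i) * ω (X.edge (a i))) := by
    have h1 := sum_range_shift (fun i => ((o (a i)).val : ZMod 4)) (m := m) (by rw [ha0])
    have h2 : ∀ i, ((o (a (i + 1))).val : ZMod 4) = ((o (a i)).val : ZMod 4) +
        (((ω (X.edge (a i))).val : ZMod 4) - two (o (a i) * ω (X.edge (a i)))) := by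
      intro i
      rw [hstep, ho.t1, ho.t0]
      generalize o (a i) = x
      generalize ω (X.edge (a i)) = w
      revert x w
      decide
    simp only [h2, sum_add_distrib, sum_sub_distrib] at h1
    rw [map_sum]
    linear_combination h1
  rw [hcr, hdesc, hω, ← map_sub]
  congr 1
  simp only [sum_add_distrib]
  have : ∀ k x d y : ZMod 2, k + (x + d + 0 + 1) + d - y = k + (x + y) + 1 := by decide
  exact this _ _ _ _

/-- The Kasteleyn curvature as a function on faces. -/
lemma curvature_congr (num : X.Vertex ≃ Fin (2 * n)) (D : X.Dimer) (ho : X.IsLabelling ω o)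
    (K : X.EdgeOrientation) {φ ψ : F} (h : X.face φ = X.face ψ) :
    X.curvature ω o K φ = X.curvature ω o K ψ := by
  -- Both lifts of a face have the same boundary chain, and the curvature is a function of this
  -- chain.
  apply two_injective
  rw [← quad_face num D ho, ← quad_face num D ho, h]

lemma quad_add_of_mem (ho : X.IsLabelling ω o) (K : X.EdgeOrientation) (x y : X.Z1) :
    quad ω o num D K (x.1 + y.1) = quad ω o num D K x.1 + quad ω o num D K y.1 +
      two (X.intersection (X.homologyClass x) (X.homologyClass y)) := by
  rw [quad_add num D ho, intersection_dualChain num D ho]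

/-- A boundary has no intersection with a cycle, so the mixed term vanishes. -/
lemma quad_add_bd2 (ho : X.IsLabelling ω o) (K : X.EdgeOrientation) (x : X.Z1)
    (z : X.Face → ZMod 2) :
    quad ω o num D K (x.1 + X.bd2 z) = quad ω o num D K x.1 + quad ω o num D K (X.bd2 z) := by
  rw [quad_add num D ho, sum_mul_of_dualHomologous_bd2
    (dualHomologous_dualChain num D ho (bd2_mem z)) x.2, map_zero, add_zero]

lemma quad_bd2 (ho : X.IsLabelling ω o) (K : X.EdgeOrientation) (z : X.Face → ZMod 2)
    (κ : X.Face → ZMod 2) (hκ : ∀ φ, κ (X.face φ) = X.curvature ω o K φ) :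
    quad ω o num D K (X.bd2 z) = two (∑ f, z f * κ f) := by
  have key : ∀ s : Finset X.Face, quad ω o num D K (X.bd2 (∑ f ∈ s, Pi.single f (z f))) =
      two (∑ f ∈ s, z f * κ f) := by
    intro s
    induction s using Finset.induction_on with
    | empty => simp [quad_zero]
    | insert f s hf ih =>
      rw [sum_insert hf, sum_insert hf, add_comm, map_add,
        quad_add_bd2 num D ho K ⟨_, bd2_mem _⟩, ih, map_add, add_comm]
      congr 1
      rcases ZMod.two_eq_zero_or_one (z f) with h | h
      · simp [h, quad_zero]
      · obtain ⟨φ, rfl⟩ := X.face_surj f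
        rw [h, one_mul, hκ, quad_face num D ho]
  have h := key univ
  rwa [Finset.univ_sum_single z] at h

/-! ### Existence of Kasteleyn orientations -/

/-- The orientation obtained by reversing a set of edges. -/
def twist (K : X.EdgeOrientation) (c : X.Edge → ZMod 2) : X.EdgeOrientation :=
  ⟨fun φ => K.1 φ + c (X.edge φ), fun φ => by
    beta_reduce
    rw [X.edge_t2, X.edge_t0, (K.2 φ).1, (K.2 φ).2]; exact ⟨rfl, by ring⟩⟩

lemma twist_apply (K : X.EdgeOrientation) (c : X.Edge → ZMod 2) (φ : F) :
    (twist K c).1 φ = K.1 φ + c (X.edge φ) := rfl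

lemma curvature_twist (K : X.EdgeOrientation) (c : X.Edge → ZMod 2) (φ : F) :
    X.curvature ω o (twist K c) φ = X.curvature ω o K φ +
      ∑ e, X.bd2 (Pi.single (X.face φ) 1) e * c e := by
  have h : ∑ e, X.bd2 (Pi.single (X.face φ) 1) e * c e =
      ∑ i ∈ range (X.flen φ), c (X.edge ((X.walk ^ i) φ)) := by
    rw [bd2_single]
    simp only [Finset.sum_apply, sum_mul]
    rw [sum_comm]
    refine sum_congr rfl fun i _ => ?_
    rw [Finset.sum_eq_single (X.edge ((X.walk ^ i) φ))]
    · rw [Pi.single_eq_same, one_mul]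
    · intro e _ he; rw [Pi.single_eq_of_ne he, zero_mul]
    · simp
  rw [h, curvature_eq, curvature_eq]
  simp only [twist_apply, sum_add_distrib]
  ring

variable (X) in
lemma exists_edgeOrientation : Nonempty X.EdgeOrientation := by
  refine ⟨⟨fun φ => if φ = (X.edge φ).out ∨ φ = X.t2 (X.edge φ).out then 0 else 1, fun φ => ?_⟩⟩
  beta_reduce
  rw [X.edge_t2, X.edge_t0]
  have h1 := X.t0_ne φ
  have h2 := X.t2_ne φ
  have h3 := X.t0_t2_ne φ
  have h4 := X.t0_ne_t2 φ
  have h5 : X.t0 φ ≠ X.t2 (X.t0 φ) := (X.t2_ne _).symm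
  have h6 : X.t2 (X.t0 φ) ≠ φ := by rwa [← X.t0_t2]
  have h7 : X.t2 (X.t0 φ) ≠ X.t2 φ := fun h => h1 (X.t2.injective h)
  rcases X.edge_eq_iff.1 (edge_out (X.edge φ)) with h | h | h | h <;> rw [h]
  · simp [h1, h4]
  · simp [h1, h4, X.t2_t2]
  · rw [if_neg, if_neg, if_pos (Or.inl rfl)]
    · exact ⟨rfl, by decide⟩
    · rintro (h | h)
      · exact h1 h.symm
      · exact h6 h.symm
    · rintro (h | h)
      · exact h4 h.symm
      · exact h7 h.symm
  · rw [X.t0_t2, X.t2_t2, if_neg, if_neg, if_pos (Or.inr rfl)]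
    · exact ⟨rfl, by decide⟩
    · rintro (h | h)
      · exact h6 h.symm
      · exact h1 h.symm
    · rintro (h | h)
      · exact h7 h.symm
      · exact h4 h.symm

/-- Reversing the edges of c adds the coboundary of c to the curvature, so the curvature has to
vanish on 2-cycles z. It does, since its pairing with z, doubled, is the value of `quad` on the
boundary of z. -/
lemma exists_kasteleyn (num : X.Vertex ≃ Fin (2 * n)) (D : X.Dimer) (ho : X.IsLabelling ω o) :
    Nonempty (X.Kasteleyn ω o) := by
  obtain ⟨K⟩ := X.exists_edgeOrientation
  let κ : X.Face → ZMod 2 := fun f => X.curvature ω o K f.out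
  have hκ : ∀ φ, κ (X.face φ) = X.curvature ω o K φ := fun φ =>
    curvature_congr num D ho K (Quot.out_eq (X.face φ))
  obtain ⟨c, hc⟩ := exists_factor X.bd2 κ (fun z hz => by
    apply two_injective
    rw [← quad_bd2 num D ho K z κ hκ, hz, quad_zero, map_zero])
  refine ⟨⟨twist K c, fun φ => ?_⟩⟩
  rw [curvature_twist, ← hc]
  simp only [Pi.single_apply, ite_mul, one_mul, zero_mul, sum_ite_eq', mem_univ, if_true]
  rw [hκ, ZMod.two_add_self]

lemma quad_bd2_kasteleyn (ho : X.IsLabelling ω o) (K : X.Kasteleyn ω o) (z : X.Face → ZMod 2) :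
    quad ω o num D K.1 (X.bd2 z) = 0 := by
  rw [quad_bd2 num D ho K.1 z 0 (fun φ => (K.2 φ).symm)]
  simp

/-! ### The quadratic enhancement -/

lemma exists_descent (ho : X.IsLabelling ω o) (K : X.Kasteleyn ω o) :
    ∃ q : X.H1 → ZMod 4, ∀ x : X.Z1, q (X.homologyClass x) = quad ω o num D K.1 x.1 := by
  choose r hr using homologyClass_surj (X := X)
  refine ⟨fun a => quad ω o num D K.1 (r a).1, fun x => ?_⟩
  obtain ⟨z, hz⟩ := homologyClass_eq_iff.1 (hr (X.homologyClass x))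
  have h : (r (X.homologyClass x)).1 = x.1 + X.bd2 z := by
    rw [hz]
    funext e
    simp only [Pi.add_apply]
    have : ∀ a b : ZMod 2, a = b + (a + b) := by decide
    exact this _ _
  simp only [h]
  rw [quad_add_bd2 num D ho, quad_bd2_kasteleyn num D ho, add_zero]

lemma isQuadraticEnhancement_of_quad (ho : X.IsLabelling ω o) (K : X.EdgeOrientation)
    {q : X.H1 → ZMod 4} (hq : ∀ x : X.Z1, q (X.homologyClass x) = quad ω o num D K x.1) :
    X.IsQuadraticEnhancement q := by
  intro a b
  obtain ⟨x, rfl⟩ := homologyClass_surj a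
  obtain ⟨y, rfl⟩ := homologyClass_surj b
  rw [← homologyClass_add, hq, hq, hq, ← two_eq, ← quad_add_of_mem num D ho]
  rfl

end

end SurfaceGraph

/-! ### Cyclic order around a vertex -/

/-- Turning from `a` one meets `p` before `b` if and only if `a`, `p`, `b` are in cyclic order. -/
lemma exists_turn_iff {a b p d : ℕ} (ha : a < d) (hb : b < d) (hp : p < d) (hab : a ≠ b) :
    (∃ k, 0 < k ∧ (a + k) % d = p ∧ ∀ j ≤ k, (a + j) % d ≠ b) ↔
      p ≠ a ∧ p ≠ b ∧ (a < p ∧ p < b ∨ p < b ∧ b < a ∨ b < a ∧ a < p) := by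
  have hmod : ∀ k, k < d → (a + k) % d = if a + k < d then a + k else a + k - d := by
    intro k hk
    split_ifs with h
    · exact Nat.mod_eq_of_lt h
    · rw [Nat.mod_eq_sub_mod (by omega), Nat.mod_eq_of_lt (by omega)]
  constructor
  · rintro ⟨k, hk, hkp, hkj⟩
    have h1 : k < if a < b then b - a else b + d - a := by
      by_contra h
      push Not at h
      apply hkj _ h
      rw [hmod _ (by split_ifs <;> omega)]
      split_ifs <;> omega
    rw [hmod k (by split_ifs at h1 <;> omega)] at hkp
    split_ifs at h1 hkp <;> omega
  · rintro ⟨h1, h2, h3⟩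
    refine ⟨if a < p then p - a else p + d - a, by split_ifs <;> omega, ?_, fun j hj => ?_⟩
    · rw [hmod _ (by split_ifs <;> omega)]
      split_ifs <;> omega
    · rw [hmod j (by split_ifs at hj <;> omega)]
      split_ifs at hj ⊢ <;> omega

namespace SurfaceGraph

noncomputable section

open Classical

variable {F : Type*} {X : SurfaceGraph F} [Fintype F]
variable {ω : X.Edge → ZMod 2} {o : F → ZMod 2}
variable {n : ℕ} (num : X.Vertex ≃ Fin (2 * n)) (D : X.Dimer)

open SimpleClosedCurve (leftFlag)

/-! ### Dimers on the left -/

lemma bef_eq_idx {φ ψ : F} (hv : X.vert φ = X.vert ψ)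
    (hne : idx o D φ ≠ idx o D ψ) :
    bef o num D φ ψ = if idx o D φ < idx o D ψ then 1 else 0 := by
  rw [bef_of_vert_eq num D hv]
  congr 1
  unfold pos
  apply propext
  split_ifs <;> omega

/-- The position of the dimer of `D'` with respect to the half-edges of `a` and `b`. -/
lemma left_indicator (ho : X.IsLabelling ω o) (D' : X.Dimer) {a b : F}
    (hv : X.vert b = X.vert a) (h1 : b ≠ a) (h2 : b ≠ X.t2 a) :
    (if ∃ k : ℕ, 0 < k ∧ X.edge ((X.rot ^ k) (leftFlag X o a)) ∈ D'.1 ∧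
        ∀ j ≤ k, (X.rot ^ j) (leftFlag X o a) ≠ leftFlag X o b then (1 : ZMod 2) else 0) =
      bef o num D b a + (bef o num D (root o D' (X.vert a)) a +
        bef o num D (root o D' (X.vert a)) b) +
      ((if X.edge a ∈ D'.1 then o a else 0) + if X.edge b ∈ D'.1 then 1 + o b else 0) := by
  set p := root o D' (X.vert a) with hp
  obtain ⟨hpv, hpD, hpo⟩ := root_spec ho D' (X.vert a)
  rw [← hp] at hpv hpD hpo
  have hab : idx o D a ≠ idx o D b := by
    rw [ne_comm, Ne, idx_eq_iff ho D hv]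
    tauto
  have hmem : ∀ c, X.vert c = X.vert a → (X.edge c ∈ D'.1 ↔ idx o D p = idx o D c) := by
    intro c hc
    rw [idx_eq_iff ho D (hpv.trans hc.symm)]
    constructor
    · intro h
      exact D'.eq_or_eq_t2 (hpv.trans hc.symm) hpD h
    · rintro (h | h)
      · rwa [← h]
      · rw [h, X.edge_t2] at hpD; exact hpD
  have hself : ∀ c, X.vert c = X.vert a → idx o D p = idx o D c →
      bef o num D p c = 1 + o c := by
    intro c hc h
    rcases (idx_eq_iff ho D (hpv.trans hc.symm)).1 h with h | h
    · rw [← h, bef_self, hpo]; decide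
    · have h3 := bef_t2_self num D ho (X.t2 c)
      rw [X.t2_t2, ho.t2] at h3
      rw [h, h3, add_comm]
  have hleft : ∀ k : ℕ, X.edge ((X.rot ^ k) (leftFlag X o a)) ∈ D'.1 ↔
      (idx o D a + k) % X.deg (X.t2 (root o D (X.vert a))) = idx o D p := by
    intro k
    rw [← rot_pow_eq_iff ho D k hpv.symm]
    have ho' : o ((X.rot ^ k) (leftFlag X o a)) = 0 := by rw [o_rot_pow ho, o_leftFlag ho]
    have hv' : X.vert ((X.rot ^ k) (leftFlag X o a)) = X.vert p := by
      rw [vert_rot_pow, vert_leftFlag, hpv]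
    constructor
    · intro h
      rcases D'.eq_or_eq_t2 hv' h hpD with h3 | h3
      · rw [h3, hpo] at ho'; exact absurd ho' (by decide)
      · rw [h3, leftFlag_of_one hpo]
    · intro h
      rw [h, edge_leftFlag]; exact hpD
  have hlt := idx_lt ho D b
  have hlt' := idx_lt ho D p
  rw [hv] at hlt
  rw [hpv] at hlt'
  -- Positions count turns from the half-edge of D, so meeting the dimer of `D'` before `b` is a
  -- cyclic inequality between positions.
  have hP : (∃ k : ℕ, 0 < k ∧ X.edge ((X.rot ^ k) (leftFlag X o a)) ∈ D'.1 ∧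
        ∀ j ≤ k, (X.rot ^ j) (leftFlag X o a) ≠ leftFlag X o b) ↔
      idx o D p ≠ idx o D a ∧ idx o D p ≠ idx o D b ∧
        (idx o D a < idx o D p ∧ idx o D p < idx o D b ∨
          idx o D p < idx o D b ∧ idx o D b < idx o D a ∨
          idx o D b < idx o D a ∧ idx o D a < idx o D p) := by
    simp only [hleft, Ne, rot_pow_eq_iff ho D _ hv.symm]
    exact exists_turn_iff (idx_lt ho D a) hlt hlt' hab
  simp only [hP, hmem a rfl, hmem b hv]
  rw [bef_eq_idx num D hv hab.symm]
  -- The dimer of `D'` is on the half-edge of `a`, on that of `b`, or on neither. In the first two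
  -- cases it is not on the left, and the correction terms tell apart the two sides of the
  -- half-edge.
  by_cases ha : idx o D p = idx o D a
  · have hb : idx o D p ≠ idx o D b := by rwa [ha]
    rw [hself a rfl ha, bef_eq_idx num D (hpv.trans hv.symm) hb, if_pos ha, if_neg hb, ha,
      if_neg (by tauto)]
    generalize o a = x
    rcases lt_or_gt_of_ne hab with h | h
    · rw [if_neg (by omega), if_pos h]; revert x; decide
    · rw [if_pos h, if_neg (by omega)]; revert x; decide
  · by_cases hb : idx o D p = idx o D b
    · rw [hself b hv hb, bef_eq_idx num D hpv ha, if_neg ha, if_pos hb, hb, if_neg (by tauto)]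
      generalize o b = x
      generalize (if idx o D b < idx o D a then (1 : ZMod 2) else 0) = y
      revert x y; decide
    · rw [bef_eq_idx num D hpv ha, bef_eq_idx num D (hpv.trans hv.symm) hb, if_neg ha,
        if_neg hb]
      rcases lt_or_gt_of_ne hab with h3 | h3 <;> rcases lt_or_gt_of_ne ha with h4 | h4 <;>
        rcases lt_or_gt_of_ne hb with h5 | h5 <;>
        simp only [h3, h4, h5, h3.not_gt, h4.not_gt, h5.not_gt, ha, hb, ne_eq, not_false_eq_true,
          and_true, and_false, or_false, if_true, if_false, or_true, or_self, and_self] <;>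
        first | decide | omega

/-! ### Dimer configurations as chains -/

/-- The 1-chain of a dimer configuration. -/
def Dimer.chain (D : X.Dimer) (e : X.Edge) : ZMod 2 := if e ∈ D.1 then 1 else 0

lemma sum_flags_dimer (ho : X.IsLabelling ω o) {A : Type*} [AddCommMonoid A] (D' : X.Dimer)
    (f : F → A) : (∑ χ with o χ = 1, if X.edge χ ∈ D'.1 then f χ else 0) =
      ∑ v, f (root o D' v) := by
  rw [← sum_filter]
  symm
  refine sum_nbij' (fun v => root o D' v) (fun φ => X.vert φ) ?_ ?_ ?_ ?_ ?_
  · intro v _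
    have := root_spec ho D' v
    simp [this.2.1, this.2.2]
  · intro φ _; exact mem_univ _
  · intro v _; exact (root_spec ho D' v).1
  · intro φ hφ
    simp only [mem_filter, mem_univ, true_and] at hφ
    exact ((eq_root_iff ho D').2 ⟨rfl, hφ.2, hφ.1⟩).symm
  · intro v _; rfl

lemma dualPot_dimer (ho : X.IsLabelling ω o) (D' : X.Dimer) (φ : F) :
    dualPot o num D D'.chain φ = ∑ v, bef o num D (root o D' v) φ := by
  rw [← sum_flags_dimer ho D' (fun χ => bef o num D χ φ)]
  unfold dualPot
  refine sum_congr rfl fun χ _ => ?_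
  simp only [Dimer.chain]
  split_ifs <;> simp

/-- Dimers at other vertices do not separate two flags of the same vertex. -/
lemma dualPot_dimer_add (ho : X.IsLabelling ω o) (D' : X.Dimer) {φ ψ : F}
    (h : X.vert ψ = X.vert φ) : dualPot o num D D'.chain φ + dualPot o num D D'.chain ψ =
      bef o num D (root o D' (X.vert φ)) φ + bef o num D (root o D' (X.vert φ)) ψ := by
  rw [dualPot_dimer num D ho, dualPot_dimer num D ho, ← sum_add_distrib]
  rw [Finset.sum_eq_single (X.vert φ)]
  · intro v _ hv
    have h1 : X.vert (root o D' v) ≠ X.vert φ := by rwa [(root_spec ho D' v).1]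
    rw [bef_of_vert_ne num D h1, bef_of_vert_ne num D (by rwa [h]), h, ZMod.two_add_self]
  · simp

lemma bd1_dimer (ho : X.IsLabelling ω o) (D' : X.Dimer) (v : X.Vertex) :
    X.bd1 D'.chain v = 1 := by
  rw [bd1_eq_sum_flags ho]
  have h : ∀ χ, (if X.vert χ = v then D'.chain (X.edge χ) else 0) =
      if X.edge χ ∈ D'.1 then (if X.vert χ = v then 1 else 0) else 0 := by
    intro χ
    unfold Dimer.chain
    split_ifs <;> rfl
  simp only [h]
  rw [sum_flags_dimer ho]
  simp only [(root_spec ho D' _).1, sum_ite_eq', mem_univ, if_true]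

lemma dimer_add_mem (ho : X.IsLabelling ω o) (D D' : X.Dimer) : D.chain + D'.chain ∈ X.Z1 := by
  rw [LinearMap.mem_ker, map_add]
  funext v
  rw [Pi.add_apply, bd1_dimer ho, bd1_dimer ho]
  exact ZMod.two_add_self 1

namespace SimpleClosedCurve

variable (C : X.SimpleClosedCurve)

lemma sum_range_dart {A : Type*} [AddCommMonoid A] (f : Fin (C.len + 1) → A) :
    ∑ i ∈ range (C.len + 1), f (Fin.ofNat _ i) = ∑ i, f i := by
  rw [Finset.sum_range]
  simp

lemma sum_shift {A : Type*} [AddCommMonoid A] (f : Fin (C.len + 1) → A) :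
    ∑ i, f (i + 1) = ∑ i, f i :=
  Equiv.sum_comp (Equiv.addRight (1 : Fin (C.len + 1))) f

lemma arriving_ne (i : Fin (C.len + 1)) : X.t0 (C.dart i) ≠ C.dart (i + 1) ∧
    X.t0 (C.dart i) ≠ X.t2 (C.dart (i + 1)) := by
  constructor
  · intro h
    have h1 : i = i + 1 := C.edge_inj (by simp only [← h, X.edge_t0])
    rw [← h1] at h
    exact X.t0_ne _ h
  · intro h
    have h1 : i = i + 1 := C.edge_inj (by
      simp only
      rw [← X.edge_t2 (C.dart (i + 1)), ← h, X.edge_t0])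
    rw [← h1] at h
    exact X.t0_ne_t2 _ h

lemma dimerOnLeft_succ (ho : X.IsLabelling ω o) (D' : X.Dimer) (i : Fin (C.len + 1)) :
    (if C.DimerOnLeft o D' (i + 1) then (1 : ZMod 2) else 0) =
      bef o num D (X.t0 (C.dart i)) (C.dart (i + 1)) +
      (dualPot o num D D'.chain (C.dart (i + 1)) +
        dualPot o num D D'.chain (X.t0 (C.dart i))) +
      ((if X.edge (C.dart (i + 1)) ∈ D'.1 then o (C.dart (i + 1)) else 0) +
        if X.edge (C.dart i) ∈ D'.1 then 1 + o (X.t0 (C.dart i)) else 0) := by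
  rw [dualPot_dimer_add num D ho D' (C.closed i)]
  have h := left_indicator num D ho D' (C.closed i) (C.arriving_ne i).1 (C.arriving_ne i).2
  rw [X.edge_t0] at h
  rw [← h]
  unfold DimerOnLeft
  rw [add_sub_cancel_right]
  rfl

/-- The number of dimers on the left, in terms of the order on flags. -/
lemma leftDimers_eq (ho : X.IsLabelling ω o) (D' : X.Dimer) : (C.leftDimers o D' : ZMod 2) =
    ∑ i, bef o num D (X.t0 (C.dart i)) (C.dart (i + 1)) +
      ∑ i, dualChain o num D D'.chain (X.edge (C.dart i)) +
      ∑ i, if X.edge (C.dart i) ∈ D'.1 then ω (X.edge (C.dart i)) else 0 := by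
  unfold leftDimers
  rw [card_filter, Nat.cast_sum]
  simp only [Nat.cast_ite, Nat.cast_one, Nat.cast_zero]
  rw [← sum_shift]
  simp only [dimerOnLeft_succ num D C ho, sum_add_distrib]
  rw [C.sum_shift (fun i => dualPot o num D D'.chain (C.dart i)),
    C.sum_shift (fun i => if X.edge (C.dart i) ∈ D'.1 then o (C.dart i) else 0)]
  simp only [dualChain_edge num D ho, ← sum_add_distrib]
  refine sum_congr rfl fun i _ => ?_
  congr 1
  split_ifs
  · rw [ho.t0]
    generalize o (C.dart i) = x
    generalize ω (X.edge (C.dart i)) = w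
    revert x w; decide
  · exact add_zero 0

/-- The order at each vertex starts with the root of D, so the root comes before every flag but
itself. The constant contributions of the arriving and leaving flags cancel, and only edges in D
remain. -/
lemma sum_dualChain_self (ho : X.IsLabelling ω o) :
    ∑ i, dualChain o num D D.chain (X.edge (C.dart i)) =
      ∑ i, if X.edge (C.dart i) ∈ D.1 then 1 + ω (X.edge (C.dart i)) else 0 := by
  have h1 : ∀ i, dualPot o num D D.chain (C.dart (i + 1)) +
      dualPot o num D D.chain (X.t0 (C.dart i)) =
      (if X.edge (C.dart (i + 1)) ∈ D.1 then o (C.dart (i + 1)) else 0) +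
        if X.edge (C.dart i) ∈ D.1 then o (X.t0 (C.dart i)) else 0 := by
    intro i
    rw [dualPot_dimer_add num D ho D (C.closed i)]
    obtain ⟨hpv, hpD, hpo⟩ := root_spec ho D (X.vert (C.dart (i + 1)))
    have key : ∀ φ, X.vert φ = X.vert (C.dart (i + 1)) →
        bef o num D (root o D (X.vert (C.dart (i + 1)))) φ =
          1 + if X.edge φ ∈ D.1 then o φ else 0 := by
      intro φ hφ
      rw [bef_root num D ho (hpv.trans hφ.symm) hpo hpD]
      by_cases hD : X.edge φ ∈ D.1
      · rw [if_pos hD]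
        rcases ZMod.two_eq_zero_or_one (o φ) with h | h
        · rw [if_neg, h, add_zero]
          rintro h3; rw [h3, hpo] at h; exact absurd h (by decide)
        · rw [if_pos ((eq_root_iff ho D).2 ⟨hφ, hD, h⟩), h]; decide
      · rw [if_neg hD, if_neg, add_zero]
        rintro h3; rw [h3] at hD; exact hD hpD
    rw [key _ rfl, key _ (C.closed i), X.edge_t0]
    have : ∀ a b : ZMod 2, 1 + a + (1 + b) = a + b := by decide
    exact this _ _
  simp only [dualChain_edge num D ho, sum_add_distrib]
  rw [← C.sum_shift (fun i => dualPot o num D D.chain (C.dart i)), ← sum_add_distrib]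
  simp only [h1, sum_add_distrib]
  rw [C.sum_shift (fun i => if X.edge (C.dart i) ∈ D.1 then o (C.dart i) else 0),
    ← sum_add_distrib]
  refine sum_congr rfl fun i _ => ?_
  split_ifs
  · rw [ho.t0]
    generalize o (C.dart i) = x
    generalize ω (X.edge (C.dart i)) = w
    revert x w; decide
  · exact add_zero 0

lemma omegaOn_add_omegaOff (D' : X.Dimer) :
    ((C.omegaOn ω D' : ℕ) : ZMod 4) + ((C.omegaOff ω D' : ℕ) : ZMod 4) =
      ∑ i, ((ω (X.edge (C.dart i))).val : ZMod 4) := by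
  unfold omegaOn omegaOff
  rw [← Nat.cast_add, sum_filter_add_sum_filter_not, Nat.cast_sum]

lemma two_omegaOn (D' : X.Dimer) :
    two (∑ i, if X.edge (C.dart i) ∈ D'.1 then ω (X.edge (C.dart i)) else 0) =
      2 * ((C.omegaOn ω D' : ℕ) : ZMod 4) := by
  unfold omegaOn
  rw [Nat.cast_sum, mul_sum, map_sum, sum_filter]
  refine sum_congr rfl fun i _ => ?_
  split_ifs
  · rfl
  · exact map_zero _

lemma disagreements_cast (K : X.EdgeOrientation) :
    (C.disagreements K : ZMod 2) = ∑ i, K.1 (C.dart i) := by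
  unfold disagreements
  rw [card_filter, Nat.cast_sum]
  refine sum_congr rfl fun i _ => ?_
  generalize K.1 (C.dart i) = x
  revert x; decide

/-- The value of the quadratic function on a simple closed curve. -/
lemma quad_chain (ho : X.IsLabelling ω o) (K : X.EdgeOrientation) :
    quad ω o num D K C.chain = 2 * ((C.disagreements K + C.leftDimers o D + 1 : ℕ) : ZMod 4) +
      (C.omegaOn ω D : ZMod 4) - (C.omegaOff ω D : ZMod 4) := by
  set m := C.len + 1 with hm
  set a : ℕ → F := fun i => C.dart (Fin.ofNat _ i) with ha
  have ha1 : ∀ i, a (i + 1) = C.dart (Fin.ofNat _ i + 1) := fun i => by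
    simp only [ha]
    congr 1
    apply Fin.ext
    simp [Fin.val_add]
  have hcast : ∀ i j : ℕ, i < m → j < m → Fin.ofNat (C.len + 1) i = Fin.ofNat (C.len + 1) j → i = j := by
    intro i j hi hj h
    have := congrArg Fin.val h
    rwa [Fin.val_ofNat, Fin.val_ofNat, Nat.mod_eq_of_lt hi, Nat.mod_eq_of_lt hj] at this
  have hchain : C.chain = ∑ i ∈ range m, Pi.single (X.edge (a i)) 1 :=
    (C.sum_range_dart fun i => Pi.single (M := fun _ : X.Edge => ZMod 2) (X.edge (C.dart i)) 1).symm
  have hedge : ∀ i j, i < m → j < m → X.edge (a i) = X.edge (a j) → i = j :=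
    fun i j hi hj h => hcast i j hi hj (C.edge_inj h)
  have ham : a m = a 0 := by simp [ha, hm]
  rw [hchain, quad_flags num D ho K a m (fun i j hij hj => by
    constructor
    · intro h
      have := hedge j i hj (by omega) (by rw [h])
      omega
    · intro h
      have := hedge j i hj (by omega) (by rw [h, X.edge_t0])
      omega)]
  -- As for faces, edges are exchanged for corners. Here the corners sit at distinct vertices, so
  -- their chords cannot cross.
  rw [sum_pairs_cyclic (bef o num D) (fun x y h => bef_add_bef num D ho h) a (fun i => X.t0 (a i)) m
    (by omega) ham
    (fun i h0 hi h => by have := hedge i 0 hi (by omega) (by rw [h]); omega)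
    (fun i hi h => by
      have := hedge i 0 hi (by omega) (by rw [← h, X.edge_t0])
      subst this
      exact X.t0_ne _ h)]
  have hcr : ∑ j ∈ range m, ∑ i ∈ range j, crossing (bef o num D) (X.t0 (a i)) (a (i + 1))
      (X.t0 (a j)) (a (j + 1)) = 0 := by
    refine sum_eq_zero fun j hj => sum_eq_zero fun i hi => ?_
    have hi' := mem_range.1 hi
    have hj' := mem_range.1 hj
    have h1 : ∀ i, X.vert (X.t0 (a i)) = X.vert (a (i + 1)) := fun i => by
      rw [ha1]; exact C.closed _
    have h2 : X.vert (a (i + 1)) ≠ X.vert (a (j + 1)) := by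
      intro h
      rw [ha1, ha1] at h
      have := hcast i j (by omega) hj' (add_right_cancel (C.vert_inj h))
      omega
    unfold crossing
    simp only [bef_of_vert_ne num D, h1, h2, ne_eq, not_false_eq_true]
    generalize (if num (X.vert (a (i + 1))) < num (X.vert (a (j + 1))) then (1 : ZMod 2) else 0) = x
    revert x; decide
  rw [hcr]
  simp only [ha1]
  rw [C.sum_range_dart (fun i => K.1 (C.dart i)),
    C.sum_range_dart (fun i => bef o num D (X.t0 (C.dart i)) (C.dart (i + 1))),
    C.sum_range_dart (fun i => if X.edge (C.dart i) ∈ D.1 then 1 + ω (X.edge (C.dart i)) else 0),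
    C.sum_range_dart (fun i => ((ω (X.edge (C.dart i))).val : ZMod 4)),
    ← two_natCast, ← omegaOn_add_omegaOff C D]
  push_cast
  rw [leftDimers_eq num D C ho, sum_dualChain_self num D C ho, disagreements_cast]
  simp only [map_add, two_omegaOn]
  have h4 : (4 : ZMod 4) = 0 := by decide
  linear_combination map_zero two - (C.omegaOn ω D : ZMod 4) * h4

lemma sum_chain_mul (c : X.Edge → ZMod 2) :
    ∑ e, C.chain e * c e = ∑ i, c (X.edge (C.dart i)) := by
  unfold chain
  simp only [Finset.sum_apply, sum_mul]
  rw [sum_comm]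
  refine sum_congr rfl fun i _ => ?_
  rw [Finset.sum_eq_single (X.edge (C.dart i))]
  · rw [Pi.single_eq_same, one_mul]
  · intro e _ he; rw [Pi.single_eq_of_ne he, zero_mul]
  · simp

/-- The intersection number of a simple closed curve and the sum of two dimer configurations. -/
lemma intersection_dimers (num : X.Vertex ≃ Fin (2 * n)) (ho : X.IsLabelling ω o) (D D' : X.Dimer) :
    two (X.intersection C.homology
      (X.homologyClass ⟨D.chain + D'.chain, dimer_add_mem ho D D'⟩)) =
    2 * (C.leftDimers o D : ZMod 4) + 2 * (C.omegaOn ω D : ZMod 4) +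
      (2 * (C.leftDimers o D' : ZMod 4) + 2 * (C.omegaOn ω D' : ZMod 4)) := by
  unfold homology
  rw [intersection_dualChain num D ho]
  have h2 : ∀ e, dualChain o num D (D.chain + D'.chain) e =
      dualChain o num D D.chain e + dualChain o num D D'.chain e := by
    intro e
    simp only [dualChain_eq_sum, Pi.add_apply, add_mul, sum_add_distrib]
  simp only [sum_chain_mul, h2, sum_add_distrib]
  rw [← two_natCast (C.leftDimers o D), ← two_natCast (C.leftDimers o D'),
    leftDimers_eq num D C ho D, leftDimers_eq num D C ho D', ← two_omegaOn, ← two_omegaOn,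
    ← map_add, ← map_add, ← map_add]
  congr 1
  -- The order of the corners of C does not depend on the dimer configuration and cancels between
  -- the two counts.
  generalize (∑ i, bef o num D (X.t0 (C.dart i)) (C.dart (i + 1))) = x
  have : ∀ x a b c d : ZMod 2, a + b = x + a + c + c + (x + b + d + d) := by decide
  exact this _ _ _ _ _

end SimpleClosedCurve

end

end SurfaceGraph

namespace SurfaceGraph

noncomputable section

open Classical

variable {F : Type*} {X : SurfaceGraph F} [Fintype F]
variable {ω : X.Edge → ZMod 2} {o : F → ZMod 2}

open SimpleClosedCurve (leftFlag)

/-! ### Cycles are sums of simple closed curves -/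

/-- A cycle has even degree at each vertex: arriving along one of its half-edges, one can leave
along another one. -/
lemma exists_next (ho : X.IsLabelling ω o) {x : X.Edge → ZMod 2} (hx : x ∈ X.Z1) (φ : F)
    (hφ : x (X.edge φ) = 1) : ∃ ψ, x (X.edge ψ) = 1 ∧ X.vert (X.t0 φ) = X.vert ψ ∧
      ψ ≠ X.t0 φ ∧ ψ ≠ X.t2 (X.t0 φ) := by
  by_contra hcon
  push Not at hcon
  have h := bd1_eq_sum_flags ho x (X.vert (X.t0 φ))
  rw [LinearMap.mem_ker.1 hx] at h
  have h1 : o (X.t2 (leftFlag X o (X.t0 φ))) = 1 := by rw [ho.t2, o_leftFlag ho, zero_add]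
  rw [Finset.sum_eq_single (X.t2 (leftFlag X o (X.t0 φ)))] at h
  · rw [X.vert_t2, vert_leftFlag, if_pos rfl, X.edge_t2, edge_leftFlag, X.edge_t0, hφ] at h
    exact zero_ne_one h
  · intro χ hχ hne
    have hχ' : o χ = 1 := (mem_filter.1 hχ).2
    split_ifs with hv
    · by_contra h0
      have h2 := hcon χ ((ZMod.two_ne_zero_iff _).1 h0) hv.symm
      apply hne
      rw [← X.t2_t2 χ, ← leftFlag_of_one hχ']
      congr 1
      rw [leftFlag_eq_iff ho]
      tauto
    · rfl
  · intro hn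
    exact absurd (by simpa using h1) hn

/-- Walk in the support without turning back, until a vertex is visited for the second time. -/
lemma exists_simpleClosedCurve (ho : X.IsLabelling ω o) {x : X.Edge → ZMod 2} (hx : x ∈ X.Z1)
    (hne : x ≠ 0) : ∃ C : X.SimpleClosedCurve, ∀ i, x (X.edge (C.dart i)) = 1 := by
  obtain ⟨e, he⟩ : ∃ e, x e ≠ 0 := by
    by_contra h
    push Not at h
    exact hne (funext h)
  obtain ⟨φ, rfl⟩ := X.edge_surj e
  choose N hN using exists_next ho hx
  let next : {φ : F // x (X.edge φ) = 1} → {φ : F // x (X.edge φ) = 1} :=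
    fun φ => ⟨N φ.1 φ.2, (hN φ.1 φ.2).1⟩
  let d : ℕ → F := fun i => (next^[i] ⟨φ, (ZMod.two_ne_zero_iff _).1 he⟩).1
  have hd : ∀ i, x (X.edge (d i)) = 1 := fun i =>
    (next^[i] ⟨φ, (ZMod.two_ne_zero_iff _).1 he⟩).2
  have hstep : ∀ i, X.vert (X.t0 (d i)) = X.vert (d (i + 1)) ∧ d (i + 1) ≠ X.t0 (d i) ∧
      d (i + 1) ≠ X.t2 (X.t0 (d i)) := by
    intro i
    have : d (i + 1) = N (d i) (hd i) := by
      simp only [d, Function.iterate_succ_apply']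
      rfl
    rw [this]
    exact (hN _ _).2
  have hex : ∃ j, ∃ i < j, X.vert (d i) = X.vert (d j) := by
    obtain ⟨i, j, hij, h⟩ := Finite.exists_ne_map_eq_of_infinite fun i => X.vert (d i)
    rcases Nat.lt_or_gt_of_ne hij with h' | h'
    · exact ⟨j, i, h', h⟩
    · exact ⟨i, j, h', h.symm⟩
  obtain ⟨i, hij, hvij⟩ := Nat.find_spec hex
  have hmin : ∀ k l, k < l → l < Nat.find hex → X.vert (d k) ≠ X.vert (d l) := by
    intro k l hkl hl h
    exact Nat.find_min hex hl ⟨k, hkl, h⟩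
  generalize Nat.find hex = j at hij hvij hmin
  obtain ⟨m, rfl⟩ : ∃ m, j = i + (m + 1) := ⟨j - i - 1, by omega⟩
  -- As the vertices are distinct, an edge could be repeated only by the next step run backwards,
  -- and that is excluded.
  have hedge : ∀ k l : ℕ, k < l → l < m + 1 → X.edge (d (i + l)) ≠ X.edge (d (i + k)) := by
    intro k l hkl hl h
    have hv := hmin (i + k) (i + l) (by omega) (by omega)
    have key : X.vert (d (i + l)) = X.vert (X.t0 (d (i + k))) → l = k + 1 := by
      intro h1
      by_contra h2
      refine hmin (i + k + 1) (i + l) (by omega) (by omega) ?_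
      rw [h1, (hstep _).1]
    have hs := hstep (i + k)
    rcases X.edge_eq_iff.1 h with h1 | h1 | h1 | h1
    · exact hv (by rw [h1])
    · exact hv (by rw [h1, X.vert_t2])
    · have := key (by rw [h1]); subst this
      exact hs.2.1 h1
    · have := key (by rw [h1, X.t0_t2, X.vert_t2]); subst this
      rw [X.t0_t2] at h1
      exact hs.2.2 h1
  refine ⟨⟨m, fun k => d (i + k), fun k => ?_, fun k l h => ?_, fun k l h => ?_⟩, fun k => hd _⟩
  · rw [(hstep _).1]
    rcases Nat.lt_or_ge (k.val + 1) (m + 1) with h | h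
    · rw [Fin.val_add_one_of_lt (by rw [Fin.lt_def, Fin.val_last]; omega), add_assoc]
    · have hk : k = Fin.last m := Fin.ext (by rw [Fin.val_last]; omega)
      rw [hk, Fin.last_add_one, Fin.val_last, Fin.val_zero, add_zero, hvij, add_assoc]
  · simp only at h
    rcases lt_trichotomy k.val l.val with h1 | h1 | h1
    · exact absurd h (hmin _ _ (by omega) (by omega))
    · exact Fin.ext h1
    · exact absurd h.symm (hmin _ _ (by omega) (by omega))
  · simp only at h
    rcases lt_trichotomy k.val l.val with h1 | h1 | h1
    · exact absurd h.symm (hedge _ _ h1 l.2)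
    · exact Fin.ext h1
    · exact absurd h (hedge _ _ h1 k.2)

lemma SimpleClosedCurve.chain_apply (C : X.SimpleClosedCurve) (e : X.Edge) :
    C.chain e = if ∃ i, X.edge (C.dart i) = e then 1 else 0 := by
  unfold SimpleClosedCurve.chain
  rw [Finset.sum_apply]
  split_ifs with h
  · obtain ⟨i, rfl⟩ := h
    rw [Finset.sum_eq_single i]
    · rw [Pi.single_eq_same]
    · intro j _ hj
      exact Pi.single_eq_of_ne (fun h => hj (C.edge_inj h).symm) _
    · simp
  · push Not at h
    exact sum_eq_zero fun i _ => Pi.single_eq_of_ne (h i).symm _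

/-- Induction on cycles, adding simple closed curves. -/
lemma cycle_induction (ho : X.IsLabelling ω o) {p : (X.Edge → ZMod 2) → Prop} (h0 : p 0)
    (h1 : ∀ (x : X.Edge → ZMod 2) (C : X.SimpleClosedCurve), x ∈ X.Z1 → p x → p (x + C.chain)) :
    ∀ x ∈ X.Z1, p x := by
  have key : ∀ (k : ℕ) (x : X.Edge → ZMod 2), x ∈ X.Z1 → (univ.filter fun e => x e ≠ 0).card = k →
      p x := by
    intro k
    induction k using Nat.strong_induction_on with
    | _ k ih =>
      intro x hx hk
      by_cases hx0 : x = 0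
      · rw [hx0]; exact h0
      obtain ⟨C, hC⟩ := exists_simpleClosedCurve ho hx hx0
      have hxC : x + C.chain ∈ X.Z1 := Submodule.add_mem _ hx C.chain_mem
      have hback : x = x + C.chain + C.chain := by
        funext e
        simp only [Pi.add_apply, add_assoc, ZMod.two_add_self, add_zero]
      rw [hback]
      refine h1 _ C hxC (ih _ ?_ _ hxC rfl)
      rw [← hk]
      apply card_lt_card
      rw [Finset.ssubset_iff_of_subset]
      · refine ⟨X.edge (C.dart 0), ?_, ?_⟩
        · simp [hC]
        · simp only [mem_filter, mem_univ, true_and, not_not, Pi.add_apply, hC, C.chain_apply]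
          rw [if_pos ⟨0, rfl⟩]
          exact ZMod.two_add_self 1
      · intro e he
        simp only [mem_filter, mem_univ, true_and, Pi.add_apply, C.chain_apply] at he ⊢
        intro h2
        rw [h2, zero_add] at he
        split_ifs at he with h3
        · obtain ⟨i, rfl⟩ := h3
          rw [hC] at h2
          exact one_ne_zero h2
        · exact he rfl
  intro x hx
  exact key _ x hx rfl

variable {n : ℕ} (num : X.Vertex ≃ Fin (2 * n)) (D : X.Dimer)

lemma quadratic_zero (num : X.Vertex ≃ Fin (2 * n)) (D : X.Dimer) (ho : X.IsLabelling ω o)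
    {q : X.H1 → ZMod 4} (hq : X.IsQuadraticEnhancement q) : q 0 = 0 := by
  have h := hq 0 0
  have h1 := intersection_add_left num D ho 0 0 0
  rw [add_zero] at h h1
  rw [show X.intersection 0 0 = 0 by linear_combination -h1, ZMod.val_zero] at h
  linear_combination -h

/-- A quadratic enhancement on a sum is determined by its values on the summands, and simple closed
curves generate the cycles. -/
lemma quadratic_ext (num : X.Vertex ≃ Fin (2 * n)) (D : X.Dimer) (ho : X.IsLabelling ω o)
    {q q' : X.H1 → ZMod 4} (hq : X.IsQuadraticEnhancement q) (hq' : X.IsQuadraticEnhancement q')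
    (h : ∀ C : X.SimpleClosedCurve, q C.homology = q' C.homology) : q = q' := by
  have key : ∀ x ∈ X.Z1, ∀ hx : x ∈ X.Z1,
      q (X.homologyClass ⟨x, hx⟩) = q' (X.homologyClass ⟨x, hx⟩) := by
    refine cycle_induction ho (p := fun x => ∀ hx : x ∈ X.Z1,
      q (X.homologyClass ⟨x, hx⟩) = q' (X.homologyClass ⟨x, hx⟩)) ?_ ?_
    · intro _
      exact (quadratic_zero num D ho hq).trans (quadratic_zero num D ho hq').symm
    · intro x C hx ih _
      have := ih hx
      change q (X.homologyClass ⟨x, hx⟩ + C.homology) = q' (X.homologyClass ⟨x, hx⟩ + C.homology)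
      rw [hq, hq', this, h]
  funext a
  obtain ⟨x, rfl⟩ := homologyClass_surj a
  exact key x.1 x.2 x.2

lemma isEnhancementOf_of_quad (ho : X.IsLabelling ω o) (K : X.EdgeOrientation)
    {q : X.H1 → ZMod 4} (hq : ∀ x : X.Z1, q (X.homologyClass x) = quad ω o num D K x.1) :
    X.IsEnhancementOf ω o K D q :=
  ⟨isQuadraticEnhancement_of_quad num D ho K hq, fun C =>
    (hq ⟨C.chain, C.chain_mem⟩).trans (C.quad_chain num D ho K)⟩

lemma IsEnhancementOf.unique (num : X.Vertex ≃ Fin (2 * n)) (ho : X.IsLabelling ω o)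
    {K : X.EdgeOrientation} {D : X.Dimer} {q q' : X.H1 → ZMod 4}
    (hq : X.IsEnhancementOf ω o K D q) (hq' : X.IsEnhancementOf ω o K D q') : q = q' :=
  quadratic_ext num D ho hq.1 hq'.1 fun C => (hq.2 C).trans (hq'.2 C).symm

lemma existsUnique_isEnhancementOf (num : X.Vertex ≃ Fin (2 * n)) (D : X.Dimer)
    (ho : X.IsLabelling ω o) (K : X.Kasteleyn ω o) :
    ∃! q, X.IsEnhancementOf ω o K.1 D q := by
  obtain ⟨q, hq⟩ := exists_descent num D ho K
  have h := isEnhancementOf_of_quad num D ho K.1 hq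
  exact ⟨q, h, fun q' hq' => hq'.unique num ho h⟩

lemma enhancement_spec (num : X.Vertex ≃ Fin (2 * n)) (ho : X.IsLabelling ω o)
    (K : X.Kasteleyn ω o) (D : X.Dimer) :
    X.IsEnhancementOf ω o K.1 D (X.enhancement ω o K.1 D) :=
  Classical.epsilon_spec (existsUnique_isEnhancementOf num D ho K).exists

lemma enhancement_eq_quad (ho : X.IsLabelling ω o) (K : X.Kasteleyn ω o) (x : X.Z1) :
    X.enhancement ω o K.1 D (X.homologyClass x) = quad ω o num D K.1 x.1 := by
  obtain ⟨q, hq⟩ := exists_descent num D ho K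
  rw [← hq, (enhancement_spec num ho K D).unique num ho (isEnhancementOf_of_quad num D ho K.1 hq)]

/-- The change of the quadratic enhancement with the dimer configuration. -/
lemma enhancement_change_dimer (num : X.Vertex ≃ Fin (2 * n)) (ho : X.IsLabelling ω o)
    (K : X.Kasteleyn ω o) (D D' : X.Dimer) (a : X.H1) :
    X.enhancement ω o K.1 D' a = X.enhancement ω o K.1 D a +
      two (X.intersection a (X.homologyClass ⟨D.chain + D'.chain, dimer_add_mem ho D D'⟩)) := by
  set q := X.enhancement ω o K.1 D with hq
  set d := X.homologyClass ⟨D.chain + D'.chain, dimer_add_mem ho D D'⟩ with hd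
  have hs := enhancement_spec num ho K D
  rw [← hq] at hs
  -- Adding a linear functional keeps the polarization, so by uniqueness only the values on simple
  -- closed curves have to be compared.
  have h : X.IsEnhancementOf ω o K.1 D' fun a => q a + two (X.intersection a d) := by
    constructor
    · intro a b
      simp only
      rw [hs.1, intersection_add_left num D ho, map_add]
      ring
    · intro C
      simp only
      rw [hs.2, hd, C.intersection_dimers num ho]
      have h1 := C.omegaOn_add_omegaOff (ω := ω) D
      rw [← C.omegaOn_add_omegaOff (ω := ω) D'] at h1
      have h4 : (4 : ZMod 4) = 0 := by decide
      push_cast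
      linear_combination (C.leftDimers o D + C.omegaOn ω D : ZMod 4) * h4 - h1
  rw [(enhancement_spec num ho K D').unique num ho h]

end

end SurfaceGraph

/-! ### Gauss sums and the Brown invariant -/

section Gauss

open Complex

/-- The character of `ZMod 4` with values the powers of `i`. -/
noncomputable def iz (z : ZMod 4) : ℂ := I ^ z.val

lemma iz_natCast (k : ℕ) : iz (k : ZMod 4) = I ^ k := by
  unfold iz
  rw [ZMod.val_natCast]
  conv_rhs => rw [← Nat.div_add_mod k 4, pow_add, pow_mul, I_pow_four, one_pow, one_mul]

lemma iz_add (a b : ZMod 4) : iz (a + b) = iz a * iz b := by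
  have h : a + b = ((a.val + b.val : ℕ) : ZMod 4) := by
    push_cast; rw [ZMod.natCast_zmod_val, ZMod.natCast_zmod_val]
  rw [h, iz_natCast, pow_add]; rfl

lemma iz_zero : iz 0 = 1 := by simp [iz]

lemma iz_two_one : iz (two 1) = -1 := by
  rw [two_one]
  have := iz_natCast 2
  rw [I_sq] at this
  exact_mod_cast this

lemma iz_mul_neg (a : ZMod 4) : iz a * iz (-a) = 1 := by rw [← iz_add, add_neg_cancel, iz_zero]

lemma iz_ne_zero (a : ZMod 4) : iz a ≠ 0 := fun h => by
  have := iz_mul_neg a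
  rw [h, zero_mul] at this
  exact zero_ne_one this

lemma conj_iz (a : ZMod 4) : (starRingEnd ℂ) (iz a) = iz (-a) := by
  apply mul_left_cancel₀ (iz_ne_zero a)
  rw [iz_mul_neg]
  unfold iz
  rw [map_pow, conj_I, ← mul_pow]
  simp

lemma exists_int_iz (a : ZMod 4) : ∃ x y : ℤ, iz a = x + y * I := by
  have h : ∀ k : ℕ, ∃ x y : ℤ, I ^ k = (x : ℂ) + y * I := by
    intro k
    induction k with
    | zero => exact ⟨1, 0, by simp⟩
    | succ k ih =>
      obtain ⟨x, y, h⟩ := ih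
      refine ⟨-y, x, ?_⟩
      rw [pow_succ, h]
      push_cast
      linear_combination (y : ℂ) * I_mul_I
  exact h _

/-- Translating by an element where f is 1 changes the sign of the sum. -/
lemma sum_iz_two {V : Type*} [AddCommGroup V] [Fintype V] (f : V → ZMod 2)
    (hf : ∀ a b, f (a + b) = f a + f b) (h : ∃ a, f a ≠ 0) : ∑ a, iz (two (f a)) = 0 := by
  obtain ⟨a, ha⟩ := h
  have h1 : ∑ b, iz (two (f (b + a))) = ∑ b, iz (two (f b)) :=
    Equiv.sum_comp (Equiv.addRight a) fun b => iz (two (f b))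
  simp only [hf, (ZMod.two_ne_zero_iff _).1 ha, map_add, iz_add, iz_two_one, mul_neg, mul_one,
    sum_neg_distrib] at h1
  linear_combination (-1 / 2 : ℂ) * h1

/-- A Gaussian integer of even norm is divisible by 1 + i; divide until a unit is left. -/
lemma int_norm_two_pow (b : ℕ) (x y : ℤ) (h : x ^ 2 + y ^ 2 = 2 ^ b) :
    ∃ k : ℕ, (x : ℂ) + y * I = I ^ k * (1 + I) ^ b := by
  induction b generalizing x y with
  | zero =>
    rw [pow_zero] at h
    have hx : -1 ≤ x ∧ x ≤ 1 := ⟨by nlinarith [sq_nonneg y], by nlinarith [sq_nonneg y]⟩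
    have hy : -1 ≤ y ∧ y ≤ 1 := ⟨by nlinarith [sq_nonneg x], by nlinarith [sq_nonneg x]⟩
    obtain ⟨h1, h2⟩ := hx
    obtain ⟨h3, h4⟩ := hy
    interval_cases x <;> interval_cases y <;> simp at h
    · exact ⟨2, by simp⟩
    · exact ⟨3, by simp [pow_succ]⟩
    · exact ⟨1, by simp⟩
    · exact ⟨0, by simp⟩
  | succ b ih =>
    have hpar : (x + y) % 2 = 0 := by
      have h1 : (x ^ 2 + y ^ 2) % 2 = 0 := by rw [h, pow_succ]; simp
      rcases Int.even_or_odd x with ⟨u, hu⟩ | ⟨u, hu⟩ <;>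
      rcases Int.even_or_odd y with ⟨v, hv⟩ | ⟨v, hv⟩
      · omega
      · exfalso
        have : x ^ 2 + y ^ 2 = 2 * (2 * u ^ 2 + 2 * v ^ 2 + 2 * v) + 1 := by rw [hu, hv]; ring
        omega
      · exfalso
        have : x ^ 2 + y ^ 2 = 2 * (2 * u ^ 2 + 2 * v ^ 2 + 2 * u) + 1 := by rw [hu, hv]; ring
        omega
      · omega
    obtain ⟨u, hu⟩ : ∃ u, x + y = 2 * u := ⟨(x + y) / 2, by omega⟩
    have hx : x = 2 * u - y := by omega
    subst hx
    -- The quotient of x + yi by 1 + i is u + (y - u)i, where x + y = 2u.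
    obtain ⟨k, hk⟩ := ih u (y - u) (by
      rw [pow_succ (2 : ℤ) b] at h; linarith)
    refine ⟨k, ?_⟩
    rw [pow_succ, ← mul_assoc, ← hk]
    push_cast
    linear_combination (-(y : ℂ) + u) * I_mul_I

lemma exp_pi_div_four : exp (I * Real.pi / 4) = (1 + I) / (Real.sqrt 2 : ℂ) := by
  have h : I * Real.pi / 4 = ((Real.pi / 4 : ℝ) : ℂ) * I := by push_cast; ring
  rw [h, exp_mul_I, ← ofReal_cos, ← ofReal_sin, Real.cos_pi_div_four, Real.sin_pi_div_four]
  have h2 : (Real.sqrt 2 : ℂ) ≠ 0 := by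
    exact_mod_cast (Real.sqrt_pos.2 (by norm_num : (0 : ℝ) < 2)).ne'
  have h3 : (Real.sqrt 2 : ℂ) * (Real.sqrt 2 : ℂ) = 2 := by
    rw [← ofReal_mul, Real.mul_self_sqrt (by norm_num)]; norm_num
  rw [eq_div_iff h2]
  push_cast
  linear_combination ((1 + I) / 2) * h3

lemma exp_pi_div_four_sq : exp (I * Real.pi / 4) ^ 2 = I := by
  rw [← exp_nat_mul]
  have h : ((2 : ℕ) : ℂ) * (I * Real.pi / 4) = Real.pi / 2 * I := by push_cast; ring
  rw [h, exp_pi_div_two_mul_I]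

/-- The Gauss sum of a nondegenerate quadratic enhancement is `|V| ^ (1 / 2)` times an eighth root
of unity. -/
lemma brown_spec {V : Type*} [AddCommGroup V] [Fintype V] (q : V → ZMod 4)
    (B : V → V → ZMod 2) (hq : ∀ a b, q (a + b) = q a + q b + two (B a b)) (hq0 : q 0 = 0)
    (hB : ∀ a b c, B a (b + c) = B a b + B a c) (hB0 : ∀ b, (∀ a, B a b = 0) → b = 0)
    (d : ℕ) (hd : Fintype.card V = 2 ^ d) :
    exp (I * Real.pi / 4) ^ (SurfaceGraph.brown q).val =
      (1 / (Real.sqrt (Fintype.card V) : ℂ)) * ∑ x, iz (q x) := by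
  have hsymm : ∀ a b, B a b = B b a := by
    intro a b
    apply two_injective
    have h1 := hq a b
    rw [add_comm a b, hq b a] at h1
    linear_combination -h1
  -- Writing x = u + y in the double sum, the sum over y is that of the character 2B(u, ·), which
  -- vanishes for u ≠ 0 by nondegeneracy.
  have hnorm : (∑ x, iz (q x)) * (starRingEnd ℂ) (∑ x, iz (q x)) = Fintype.card V := by
    rw [map_sum, mul_sum]
    have h1 : ∀ y, (∑ x, iz (q x)) * (starRingEnd ℂ) (iz (q y)) =
        ∑ u, iz (q u) * iz (two (B u y)) := by
      intro y
      rw [conj_iz, sum_mul, ← Equiv.sum_comp (Equiv.addRight y)]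
      refine sum_congr rfl fun u _ => ?_
      rw [Equiv.coe_addRight, ← iz_add, ← iz_add, hq]
      congr 1; ring
    simp only [h1]
    rw [sum_comm]
    simp only [← mul_sum]
    rw [Finset.sum_eq_single 0]
    · have h2 : ∀ y, B 0 y = 0 := by
        intro y
        have := hB y 0 0
        rw [add_zero] at this
        rw [hsymm]
        linear_combination -this
      simp [h2, iz_zero, hq0]
    · intro u _ hu
      rw [sum_iz_two (fun y => B u y) (hB u), mul_zero]
      by_contra hcon
      push Not at hcon
      exact hu (hB0 u fun a => by rw [hsymm, hcon])
    · simp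
  choose x y hxy using exists_int_iz
  set G := ∑ v, iz (q v) with hG
  have hGint : G = ((∑ v, x (q v) : ℤ) : ℂ) + ((∑ v, y (q v) : ℤ) : ℂ) * I := by
    rw [hG]
    push_cast
    rw [sum_mul, ← sum_add_distrib]
    exact sum_congr rfl fun v _ => hxy _
  generalize (∑ v, x (q v) : ℤ) = x₀ at hGint
  generalize (∑ v, y (q v) : ℤ) = y₀ at hGint
  have hsquares : x₀ ^ 2 + y₀ ^ 2 = 2 ^ d := by
    rw [hGint, hd] at hnorm
    have h2 : (x₀ : ℂ) ^ 2 + (y₀ : ℂ) ^ 2 = 2 ^ d := by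
      simp only [map_add, map_mul, conj_I, map_intCast, Nat.cast_pow, Nat.cast_ofNat] at hnorm
      linear_combination hnorm + (y₀ : ℂ) ^ 2 * I_mul_I
    exact_mod_cast h2
  obtain ⟨k, hk⟩ := int_norm_two_pow d x₀ y₀ hsquares
  have hroot : (1 / (Real.sqrt (Fintype.card V) : ℂ)) * G =
      exp (I * Real.pi / 4) ^ (2 * k + d) := by
    rw [hGint, hk, pow_add, pow_mul, exp_pi_div_four_sq, exp_pi_div_four, div_pow, hd]
    have h5 : (Real.sqrt ((2 ^ d : ℕ) : ℝ) : ℂ) = (Real.sqrt 2 : ℂ) ^ d := by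
      rw [← ofReal_pow]
      congr 1
      push_cast
      rw [Real.sqrt_eq_iff_mul_self_eq (by positivity) (by positivity), ← mul_pow,
        Real.mul_self_sqrt (by norm_num)]
    rw [h5]; ring
  have h8 : exp (I * Real.pi / 4) ^ 8 = 1 := by
    rw [show (8 : ℕ) = 2 * 4 by norm_num, pow_mul, exp_pi_div_four_sq, I_pow_four]
  have hex : ∃ β : ZMod 8, exp (I * Real.pi / 4) ^ β.val =
      (1 / (Real.sqrt (Fintype.card V) : ℂ)) * ∑ x, I ^ (q x).val := by
    refine ⟨((2 * k + d : ℕ) : ZMod 8), ?_⟩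
    change _ = (1 / (Real.sqrt (Fintype.card V) : ℂ)) * G
    rw [hroot, ZMod.val_natCast]
    conv_rhs => rw [← Nat.div_add_mod (2 * k + d) 8, pow_add, pow_mul, h8, one_pow, one_mul]
  exact Classical.epsilon_spec hex

end Gauss

namespace SurfaceGraph

noncomputable section

open Classical

variable {F : Type*} {X : SurfaceGraph F} [Fintype F]
variable {ω : X.Edge → ZMod 2} {o : F → ZMod 2} {n : ℕ}

/-! ### Kasteleyn orientations and cohomology -/

variable (X) in
lemma card_H1 : Fintype.card X.H1 = 2 ^ X.b1 := by
  rw [Module.card_eq_pow_finrank (K := ZMod 2), ZMod.card]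
  rfl

lemma brown_enhancement (num : X.Vertex ≃ Fin (2 * n)) (ho : X.IsLabelling ω o)
    (K : X.Kasteleyn ω o) (D : X.Dimer) :
    Complex.exp (Complex.I * Real.pi / 4) ^ (brown (X.enhancement ω o K.1 D)).val =
      (1 / (Real.sqrt (Fintype.card X.H1) : ℂ)) * ∑ x, iz (X.enhancement ω o K.1 D x) := by
  have h := enhancement_spec num ho K D
  exact brown_spec _ X.intersection h.1 (quadratic_zero num D ho h.1)
    (intersection_add_right num D ho) (fun b hb => intersection_nondegenerate num D ho hb)
    X.b1 X.card_H1

lemma exists_difference (K K' : X.EdgeOrientation) :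
    ∃ c : X.Edge → ZMod 2, ∀ φ, K'.1 φ = K.1 φ + c (X.edge φ) := by
  refine ⟨fun e => K.1 e.out + K'.1 e.out, fun φ => ?_⟩
  have h1 : ∀ a b : ZMod 2, b = a + (a + b) := by decide
  have h2 : ∀ a b : ZMod 2, b = a + (a + 1 + (b + 1)) := by decide
  beta_reduce
  rcases X.edge_eq_iff.1 (edge_out (X.edge φ)) with h | h | h | h <;> rw [h]
  · exact h1 _ _
  · rw [(K.2 φ).1, (K'.2 φ).1]; exact h1 _ _
  · rw [(K.2 φ).2, (K'.2 φ).2]; exact h2 _ _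
  · rw [(K.2 _).2, (K'.2 _).2, (K.2 φ).1, (K'.2 φ).1]; exact h2 _ _

lemma eq_twist {K K' : X.EdgeOrientation} {c : X.Edge → ZMod 2}
    (h : ∀ φ, K'.1 φ = K.1 φ + c (X.edge φ)) : K' = twist K c :=
  Subtype.ext (funext h)

/-- The functional `f` on homology describes the difference of two orientations. -/
def Differ (K K' : X.EdgeOrientation) (f : Module.Dual (ZMod 2) X.H1) : Prop :=
  ∃ c : X.Edge → ZMod 2, (∀ φ, K'.1 φ = K.1 φ + c (X.edge φ)) ∧
    ∀ x : X.Z1, f (X.homologyClass x) = ∑ e, x.1 e * c e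

/-- Reversing the edges of c changes the number of disagreements along C by c(C) modulo 2;
uniqueness of the enhancement does the rest. -/
lemma enhancement_of_differ (num : X.Vertex ≃ Fin (2 * n)) (ho : X.IsLabelling ω o)
    {K K' : X.Kasteleyn ω o} {f : Module.Dual (ZMod 2) X.H1} (h : Differ K.1 K'.1 f)
    (D : X.Dimer) (a : X.H1) :
    X.enhancement ω o K'.1 D a = X.enhancement ω o K.1 D a + two (f a) := by
  obtain ⟨c, hc, hf⟩ := h
  have hs := enhancement_spec num ho K D
  have h : X.IsEnhancementOf ω o K'.1 D fun a => X.enhancement ω o K.1 D a + two (f a) := by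
    constructor
    · intro a b
      simp only
      rw [hs.1, map_add, map_add]
      ring
    · intro C
      simp only
      have h1 : f C.homology = (C.disagreements K'.1 : ZMod 2) - (C.disagreements K.1 : ZMod 2) := by
        unfold SimpleClosedCurve.homology
        rw [hf, C.sum_chain_mul, C.disagreements_cast, C.disagreements_cast]
        simp only [hc, sum_add_distrib]
        ring
      rw [hs.2, h1, map_sub, two_natCast, two_natCast]
      push_cast
      ring
  rw [(enhancement_spec num ho K' D).unique num ho h]

/-- Both curvatures vanish, so the difference is a cocycle and descends to homology. -/
lemma exists_differ (K K' : X.Kasteleyn ω o) : ∃ f, Differ K.1 K'.1 f := by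
  obtain ⟨c, hc⟩ := exists_difference K.1 K'.1
  let g : X.Z1 →ₗ[ZMod 2] ZMod 2 :=
    (∑ e, c e • LinearMap.proj e : (X.Edge → ZMod 2) →ₗ[ZMod 2] ZMod 2) ∘ₗ X.Z1.subtype
  have hg : ∀ x : X.Z1, g x = ∑ e, x.1 e * c e := fun x => by
    simp [g, mul_comm]
  have hface : ∀ f, ∑ e, X.bd2 (Pi.single f 1) e * c e = 0 := by
    intro f
    obtain ⟨φ, rfl⟩ := X.face_surj f
    have h1 := curvature_twist (ω := ω) (o := o) K.1 c φ
    rw [← eq_twist hc, K.2, K'.2, zero_add] at h1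
    exact h1.symm
  have hker : (LinearMap.range X.bd2).submoduleOf X.Z1 ≤ LinearMap.ker g := by
    rintro x ⟨z, hz⟩
    rw [LinearMap.mem_ker, hg]
    change X.bd2 z = x.1 at hz
    rw [← hz, ← Finset.univ_sum_single z, map_sum]
    simp only [Finset.sum_apply, sum_mul]
    rw [sum_comm]
    refine sum_eq_zero fun f _ => ?_
    have h2 : Pi.single f (z f) = z f • (Pi.single f 1 : X.Face → ZMod 2) := by
      rw [← Pi.single_smul, smul_eq_mul, mul_one]
    rw [h2, map_smul]
    simp only [Pi.smul_apply, smul_eq_mul, mul_assoc, ← mul_sum]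
    rw [hface, mul_zero]
  exact ⟨Submodule.liftQ _ g hker, c, hc, fun x => hg x⟩

/-- Extend the functional from cycles to all chains: the resulting cochain vanishes on boundaries,
so reversing its edges preserves the curvature. -/
lemma exists_kasteleyn_differ (K : X.Kasteleyn ω o) (f : Module.Dual (ZMod 2) X.H1) :
    ∃ K' : X.Kasteleyn ω o, Differ K.1 K'.1 f := by
  let g : X.Z1 →ₗ[ZMod 2] ZMod 2 := f ∘ₗ Submodule.mkQ _
  obtain ⟨h, hh⟩ := LinearMap.exists_extend g
  let c : X.Edge → ZMod 2 := fun e => h (Pi.single e 1)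
  have hc : ∀ x : X.Edge → ZMod 2, h x = ∑ e, x e * c e := by
    intro x
    conv_lhs => rw [← Finset.univ_sum_single x, map_sum]
    refine sum_congr rfl fun e _ => ?_
    have h2 : Pi.single e (x e) = x e • (Pi.single e 1 : X.Edge → ZMod 2) := by
      rw [← Pi.single_smul, smul_eq_mul, mul_one]
    rw [h2, map_smul, smul_eq_mul]
  have hf : ∀ x : X.Z1, f (X.homologyClass x) = ∑ e, x.1 e * c e := by
    intro x
    rw [← hc]
    exact (LinearMap.congr_fun hh x).symm
  refine ⟨⟨twist K.1 c, fun φ => ?_⟩, c, fun φ => rfl, hf⟩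
  rw [curvature_twist, K.2, zero_add, ← hf ⟨_, bd2_mem _⟩]
  have h0 : X.homologyClass ⟨X.bd2 (Pi.single (X.face φ) 1), bd2_mem _⟩ = X.homologyClass 0 := by
    rw [homologyClass_eq_iff]
    exact ⟨_, (add_zero _).symm⟩
  rw [h0]
  exact map_zero f

lemma differ_unique {K K' : X.EdgeOrientation} {f f' : Module.Dual (ZMod 2) X.H1}
    (h : Differ K K' f) (h' : Differ K K' f') : f = f' := by
  obtain ⟨c, hc, hf⟩ := h
  obtain ⟨c', hc', hf'⟩ := h'
  have : c = c' := by
    funext e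
    obtain ⟨φ, rfl⟩ := X.edge_surj e
    have := hc φ
    rw [hc' φ] at this
    exact (add_left_cancel this).symm
  apply LinearMap.ext
  intro a
  obtain ⟨x, rfl⟩ := homologyClass_surj a
  rw [hf, hf', this]

lemma differ_zero_of_equivalent {K K' : X.EdgeOrientation} (h : X.Equivalent K K') :
    Differ K K' 0 := by
  obtain ⟨S, hS⟩ := h
  obtain ⟨c, hc⟩ := exists_difference K K'
  refine ⟨c, hc, fun x => ?_⟩
  rw [sum_mul_coboundary x.1 c (fun v => if v ∈ S then 1 else 0), LinearMap.mem_ker.1 x.2]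
  · simp
  · intro φ
    have := hc φ
    rw [hS φ] at this
    exact (add_left_cancel this).symm

lemma Differ.trans {K K' K'' : X.EdgeOrientation} {f f' : Module.Dual (ZMod 2) X.H1}
    (h : Differ K K' f) (h' : Differ K' K'' f') : Differ K K'' (f + f') := by
  obtain ⟨c, hc, hf⟩ := h
  obtain ⟨c', hc', hf'⟩ := h'
  refine ⟨c + c', fun φ => ?_, fun x => ?_⟩
  · rw [hc', hc, Pi.add_apply, add_assoc]
  · simp only [LinearMap.add_apply, hf, hf', Pi.add_apply, mul_add, sum_add_distrib]

/-- The difference of the two cochains vanishes on cycles, hence is the coboundary of a set of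
vertices. -/
lemma equivalent_of_differ {K K' K'' : X.EdgeOrientation} {f : Module.Dual (ZMod 2) X.H1}
    (h : Differ K K' f) (h' : Differ K K'' f) : X.Equivalent K' K'' := by
  obtain ⟨c, hc, hf⟩ := h
  obtain ⟨c', hc', hf'⟩ := h'
  obtain ⟨s, hs⟩ := exists_factor X.bd1 (c + c') (fun x hx => by
    have h1 := hf ⟨x, hx⟩
    have h2 := hf' ⟨x, hx⟩
    simp only [Pi.add_apply, mul_add, sum_add_distrib]
    rw [← h1, ← h2, ZMod.two_add_self])
  refine ⟨{v | s v = 1}, fun φ => ?_⟩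
  have h3 := hs (Pi.single (X.edge φ) 1)
  rw [SimpleClosedCurve.bd1_single] at h3
  simp only [Pi.single_apply, Pi.add_apply, ite_mul, one_mul, zero_mul, add_mul,
    sum_add_distrib, sum_ite_eq', mem_univ, if_true] at h3
  have h4 : ∀ (v : X.Vertex) [Decidable (v ∈ {v | s v = 1})],
      (if v ∈ {v | s v = 1} then (1 : ZMod 2) else 0) = s v := by
    intro v _
    rcases ZMod.two_eq_zero_or_one (s v) with h | h <;> simp [h]
  rw [h4, h4, ← h3, hc, hc']
  have h5 : ∀ a b d : ZMod 2, a + d = a + b + (b + d) := by decide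
  exact h5 _ _ _

lemma enhancement_of_equivalent (num : X.Vertex ≃ Fin (2 * n)) (ho : X.IsLabelling ω o)
    {K K' : X.Kasteleyn ω o} (h : X.Equivalent K.1 K'.1) (D : X.Dimer) :
    X.enhancement ω o K'.1 D = X.enhancement ω o K.1 D := by
  funext a
  rw [enhancement_of_differ num ho (differ_zero_of_equivalent h)]
  simp

/-- The sum over the Kasteleyn orientations detects homology classes. -/
lemma sum_kasteleyn (num : X.Vertex ≃ Fin (2 * n)) (ho : X.IsLabelling ω o) (D : X.Dimer)
    (a : X.H1) : ∑ κ : X.KasteleynClass ω o,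
      (∑ x, iz (X.enhancement ω o (Quotient.out κ).1 D x)) *
        iz (-X.enhancement ω o (Quotient.out κ).1 D a) = Fintype.card X.H1 := by
  obtain ⟨K⟩ := exists_kasteleyn num D ho
  choose Φ hΦ using fun κ : X.KasteleynClass ω o => exists_differ K (Quotient.out κ)
  -- The classes form a torsor under the dual of H₁, based at `K`.
  have hbij : Function.Bijective Φ := by
    constructor
    · intro κ κ' h
      have h1 := hΦ κ
      rw [h] at h1
      rw [← Quotient.out_eq κ, ← Quotient.out_eq κ']
      exact Quotient.sound (equivalent_of_differ h1 (hΦ κ'))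
    · intro f
      obtain ⟨K', hK'⟩ := exists_kasteleyn_differ K f
      refine ⟨Quotient.mk _ K', differ_unique (hΦ _) ?_⟩
      have h1 : X.Equivalent K'.1 (Quotient.out (Quotient.mk (X.kasteleynSetoid ω o) K')).1 :=
        X.equivalent_equivalence.symm (@Quotient.mk_out _ (X.kasteleynSetoid ω o) K')
      have h2 := hK'.trans (differ_zero_of_equivalent h1)
      rwa [add_zero] at h2
  have hfin : Finite (Module.Dual (ZMod 2) X.H1) := Finite.of_surjective Φ hbij.2
  have : Fintype (Module.Dual (ZMod 2) X.H1) := Fintype.ofFinite _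
  set q := X.enhancement ω o K.1 D with hq
  have hterm : ∀ κ, (∑ x, iz (X.enhancement ω o (Quotient.out κ).1 D x)) *
      iz (-X.enhancement ω o (Quotient.out κ).1 D a) =
      ∑ x, iz (q x - q a) * iz (two (Φ κ (x - a))) := by
    intro κ
    rw [sum_mul]
    refine sum_congr rfl fun x _ => ?_
    rw [enhancement_of_differ num ho (hΦ κ), enhancement_of_differ num ho (hΦ κ), ← iz_add,
      ← iz_add, map_sub, map_sub]
    congr 1; ring
  simp only [hterm]
  -- Exchanging the sums leaves, for each x, the sum over functionals f of (-1)^f(x - a), which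
  -- vanishes unless x = a.
  rw [Function.Bijective.sum_comp hbij
    (fun f => ∑ x, iz (q x - q a) * iz (two (f (x - a)))), sum_comm]
  simp only [← mul_sum]
  rw [Finset.sum_eq_single a]
  · simp only [sub_self, map_zero, iz_zero, one_mul, sum_const, card_univ, nsmul_eq_mul, mul_one]
    rw [Module.card_eq_pow_finrank (K := ZMod 2), Subspace.dual_finrank_eq,
      ← Module.card_eq_pow_finrank (K := ZMod 2)]
  · intro x _ hx
    rw [sum_iz_two (fun f : Module.Dual (ZMod 2) X.H1 => f (x - a)) (fun f g => rfl), mul_zero]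
    by_contra hcon
    push Not at hcon
    exact hx (sub_eq_zero.1 ((Module.forall_dual_apply_eq_zero_iff (ZMod 2) _).1 hcon))
  · simp

end

end SurfaceGraph

/-! ### Signs of permutations from increasing pairs -/

/-- The sign of a parity. -/
def sgn (x : ZMod 2) : ℤ := if x = 0 then 1 else -1

lemma sgn_add (x y : ZMod 2) : sgn (x + y) = sgn x * sgn y := by revert x y; decide

lemma sgn_zero : sgn 0 = 1 := rfl

lemma sgn_sum {ι : Type*} (s : Finset ι) (f : ι → ZMod 2) :
    sgn (∑ i ∈ s, f i) = ∏ i ∈ s, sgn (f i) := by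
  classical
  induction s using Finset.induction_on with
  | empty => simp [sgn_zero]
  | insert i s hi ih => rw [sum_insert hi, prod_insert hi, sgn_add, ih]

lemma iz_two (x : ZMod 2) : iz (two x) = (sgn x : ℂ) := by
  rcases ZMod.two_eq_zero_or_one x with rfl | rfl
  · simp [iz_zero, sgn_zero]
  · rw [iz_two_one]; simp [sgn]

lemma sum_range_two_mul_cast (n : ℕ) : ∑ j ∈ range (2 * n), (j : ZMod 2) = n := by
  induction n with
  | zero => simp
  | succ n ih =>
    rw [show 2 * (n + 1) = 2 * n + 1 + 1 by ring, sum_range_succ, sum_range_succ, ih]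
    have h2 : (2 : ZMod 2) = 0 := by decide
    push_cast
    linear_combination (2 * n : ZMod 2) * h2

/-- The sign of a permutation, from its increasing pairs. -/
lemma sign_eq_sgn {n : ℕ} (σ : Equiv.Perm (Fin (2 * n))) (r : ℕ → ℕ → ZMod 2)
    (hr : ∀ i j : Fin (2 * n), i < j → r i j = if σ i < σ j then 1 else 0) :
    (Equiv.Perm.sign σ : ℤ) = sgn (n + ∑ j ∈ range (2 * n), ∑ i ∈ range j, r i j) := by
  -- There are n(2n - 1) pairs in all, a number of the parity of n, so adding n turns increasing
  -- pairs into inversions.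
  have h1 : (n : ZMod 2) + ∑ j ∈ range (2 * n), ∑ i ∈ range j, r i j =
      ∑ j ∈ range (2 * n), ∑ i ∈ range j, (1 + r i j) := by
    simp only [sum_add_distrib, sum_const, card_range, nsmul_eq_mul, mul_one,
      sum_range_two_mul_cast]
  rw [h1, Equiv.Perm.sign_eq_prod_prod_Iio, sgn_sum, Finset.prod_range]
  push_cast
  refine prod_congr rfl fun j _ => ?_
  rw [sgn_sum]
  refine prod_nbij (fun i => (i : ℕ)) ?_ ?_ ?_ ?_
  · intro i hi
    rw [mem_Iio] at hi
    exact mem_range.2 hi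
  · intro a _ b _ h
    exact Fin.ext h
  · intro a ha
    have ha' : a < j := mem_range.1 ha
    exact ⟨⟨a, by omega⟩, by simpa [Fin.lt_def] using ha', rfl⟩
  · intro i hi
    rw [mem_Iio] at hi
    simp only [hr i j hi]
    split_ifs
    · rfl
    · rfl

namespace SurfaceGraph

noncomputable section

open Classical

variable {F : Type*} {X : SurfaceGraph F} [Fintype F]
variable {ω : X.Edge → ZMod 2} {o : F → ZMod 2} {n : ℕ}

/-! ### Signs of dimer configurations -/

lemma edgeSign_eq (K : X.EdgeOrientation) {ψ : F} (h : X.vert ψ ≠ X.vert (X.t0 ψ)) :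
    X.edgeSign K (X.edge ψ) (X.vert ψ) (X.vert (X.t0 ψ)) = sgn (K.1 ψ) := by
  have h1 : X.OrientedFromTo K (X.edge ψ) (X.vert ψ) (X.vert (X.t0 ψ)) ↔ K.1 ψ = 0 := by
    constructor
    · rintro ⟨φ, he, hu, -, hK⟩
      rcases X.edge_eq_iff.1 he with rfl | rfl | rfl | rfl
      · exact hK
      · rwa [(K.2 ψ).1] at hK
      · exact absurd hu.symm h
      · rw [X.t0_t2, X.vert_t2] at hu; exact absurd hu.symm h
    · intro hK
      exact ⟨ψ, rfl, rfl, rfl, hK⟩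
  have h2 : X.OrientedFromTo K (X.edge ψ) (X.vert (X.t0 ψ)) (X.vert ψ) ↔ K.1 ψ = 1 := by
    have h3 : K.1 (X.t0 ψ) = 0 ↔ K.1 ψ = 1 := by
      rw [(K.2 ψ).2]
      generalize K.1 ψ = x
      revert x; decide
    rw [← h3]
    constructor
    · rintro ⟨φ, he, hu, -, hK⟩
      rcases X.edge_eq_iff.1 he with rfl | rfl | rfl | rfl
      · exact absurd hu h
      · rw [X.vert_t2] at hu; exact absurd hu h
      · exact hK
      · rwa [X.t0_t2, (K.2 (X.t0 ψ)).1] at hK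
    · intro hK
      exact ⟨X.t0 ψ, X.edge_t0 ψ, rfl, by rw [X.t0_t0], hK⟩
  unfold edgeSign
  rw [if_congr h1 rfl rfl, if_congr h2 rfl rfl]
  generalize K.1 ψ = x
  revert x; decide

/-- The sign of a listing of edges. -/
def listSign (num : X.Vertex ≃ Fin (2 * n)) (K : X.EdgeOrientation)
    (p : Equiv.Perm (Fin (2 * n)) × (Fin n → X.Edge)) : ℤ :=
  (Equiv.Perm.sign p.1 : ℤ) * ∏ l : Fin n, X.edgeSign K (p.2 l)
    (num.symm (p.1 (fstIdx l))) (num.symm (p.1 (sndIdx l)))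

lemma joins_ends {e : X.Edge} {u v u' v' : X.Vertex} (h : X.Joins e u v) (h' : X.Joins e u' v') :
    u' = u ∨ u' = v := by
  obtain ⟨φ, rfl, rfl, rfl⟩ := h
  obtain ⟨ψ, he, rfl, rfl⟩ := h'
  rcases X.edge_eq_iff.1 he with rfl | rfl | rfl | rfl
  · exact Or.inl rfl
  · exact Or.inl (X.vert_t2 _)
  · exact Or.inr rfl
  · exact Or.inr (by rw [X.t0_t2, X.vert_t2])

lemma exists_idx_of_fin (i : Fin (2 * n)) : ∃ l : Fin n, i = fstIdx l ∨ i = sndIdx l := by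
  refine ⟨⟨i.1 / 2, by omega⟩, ?_⟩
  unfold fstIdx sndIdx
  rcases Nat.mod_two_eq_zero_or_one i.1 with h | h
  · left; apply Fin.ext; simp only; omega
  · right; apply Fin.ext; simp only; omega

lemma listing_injective {num : X.Vertex ≃ Fin (2 * n)}
    {p : Equiv.Perm (Fin (2 * n)) × (Fin n → X.Edge)}
    (hp : ∀ l, X.Joins (p.2 l) (num.symm (p.1 (fstIdx l))) (num.symm (p.1 (sndIdx l)))) :
    Function.Injective p.2 := by
  intro l l' h
  have h1 := hp l
  rw [h] at h1
  rcases joins_ends h1 (hp l') with h2 | h2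
  · have := p.1.injective (num.symm.injective h2)
    unfold fstIdx at this
    exact Fin.ext (by have := congrArg Fin.val this; simp only at this; omega)
  · have := p.1.injective (num.symm.injective h2)
    unfold fstIdx sndIdx at this
    have := congrArg Fin.val this; simp only at this; omega

lemma Lists.image_eq {num : X.Vertex ≃ Fin (2 * n)} {D : X.Dimer}
    {p : Equiv.Perm (Fin (2 * n)) × (Fin n → X.Edge)} (hp : X.Lists num D p) :
    D.1 = univ.image p.2 := by
  ext e
  simp only [mem_image, mem_univ, true_and]
  constructor
  · intro he
    obtain ⟨φ, rfl⟩ := X.edge_surj e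
    obtain ⟨l, hl⟩ := exists_idx_of_fin (p.1.symm (num (X.vert φ)))
    refine ⟨l, ?_⟩
    have hφ : X.Joins (X.edge φ) (X.vert φ) (X.vert (X.t0 φ)) := ⟨φ, rfl, rfl, rfl⟩
    obtain ⟨hD, hJ⟩ := hp l
    have hends : ∃ v, X.Joins (p.2 l) (X.vert φ) v := by
      rcases hl with hl | hl
      · rw [Equiv.symm_apply_eq] at hl
        rw [← hl, Equiv.symm_apply_apply] at hJ
        exact ⟨_, hJ⟩
      · rw [Equiv.symm_apply_eq] at hl
        rw [← hl, Equiv.symm_apply_apply] at hJ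
        obtain ⟨ψ, h1, h2, h3⟩ := hJ
        exact ⟨_, X.t0 ψ, by rw [X.edge_t0, h1], h3, rfl⟩
    exact (D.2.1 (X.vert φ)).unique ⟨hD, hends⟩ ⟨he, _, hφ⟩
  · rintro ⟨l, rfl⟩
    exact (hp l).1

lemma Lists.sum_eq {num : X.Vertex ≃ Fin (2 * n)} {D : X.Dimer}
    {p : Equiv.Perm (Fin (2 * n)) × (Fin n → X.Edge)} (hp : X.Lists num D p)
    {A : Type*} [AddCommMonoid A] (f : X.Edge → A) : ∑ e ∈ D.1, f e = ∑ l, f (p.2 l) := by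
  rw [hp.image_eq, sum_image]
  exact fun a _ b _ h => listing_injective (fun l => (hp l).2) h

lemma Lists.prod_eq {num : X.Vertex ≃ Fin (2 * n)} {D : X.Dimer}
    {p : Equiv.Perm (Fin (2 * n)) × (Fin n → X.Edge)} (hp : X.Lists num D p)
    {A : Type*} [CommMonoid A] (f : X.Edge → A) : ∏ e ∈ D.1, f e = ∏ l, f (p.2 l) := by
  rw [hp.image_eq, prod_image]
  exact fun a _ b _ h => listing_injective (fun l => (hp l).2) h

lemma Dimer.chain_eq_sum (D : X.Dimer) : D.chain = ∑ e ∈ D.1, Pi.single e 1 := by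
  funext e
  rw [Finset.sum_apply]
  simp only [Pi.single_apply, sum_ite_eq, Dimer.chain]

/-- The sign of a listing of a dimer configuration is determined by the quadratic function. -/
lemma quad_dimer (num : X.Vertex ≃ Fin (2 * n)) (ho : X.IsLabelling ω o) (D₀ : X.Dimer)
    (K : X.EdgeOrientation) {D : X.Dimer}
    {p : Equiv.Perm (Fin (2 * n)) × (Fin n → X.Edge)} (hp : X.Lists num D p) :
    ∃ t, listSign num K p = sgn t ∧ quad ω o num D₀ K D.chain =
      two (t + n + ∑ e ∈ D.1, if e ∈ D₀.1 then 1 + ω e else 0) - (X.omegaDimer ω D : ZMod 4) := by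
  choose f hf using fun l => (hp l).2
  obtain ⟨φ₀⟩ := X.nonempty
  let ψ : ℕ → F := fun l => if h : l < n then f ⟨l, h⟩ else φ₀
  have hψ : ∀ l : Fin n, ψ l = f l := fun l => dif_pos l.2
  let s : ℕ → F := fun i => if i % 2 = 0 then ψ (i / 2) else X.t0 (ψ (i / 2))
  have hs0 : ∀ l, s (2 * l) = ψ l := fun l => by
    simp only [s]
    rw [if_pos (by omega), show 2 * l / 2 = l by omega]
  have hs1 : ∀ l, s (2 * l + 1) = X.t0 (ψ l) := fun l => by
    simp only [s]
    rw [if_neg (by omega), show (2 * l + 1) / 2 = l by omega]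
  have hsv : ∀ i : Fin (2 * n), X.vert (s i) = num.symm (p.1 i) := by
    intro i
    obtain ⟨l, rfl | rfl⟩ := exists_idx_of_fin i
    · change X.vert (s (2 * l)) = _
      rw [hs0, hψ, (hf l).2.1]
    · change X.vert (s (2 * l + 1)) = _
      rw [hs1, hψ, (hf l).2.2]
  have hvne : ∀ i j : Fin (2 * n), i ≠ j → X.vert (s i) ≠ X.vert (s j) := by
    intro i j hij h
    rw [hsv, hsv] at h
    exact hij (p.1.injective (num.symm.injective h))
  have hloop : ∀ l : Fin n, X.vert (f l) ≠ X.vert (X.t0 (f l)) := fun l =>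
    D.vert_ne (by rw [(hf l).1]; exact (hp l).1)
  -- All the listed flags are at distinct vertices, where the order on flags is the order of the
  -- vertex numbers.
  have hsign := sign_eq_sgn p.1 (fun i j => bef o num D₀ (s i) (s j)) (fun i j hij => by
    rw [bef_of_vert_ne num D₀ (hvne i j hij.ne), hsv, hsv, Equiv.apply_symm_apply,
      Equiv.apply_symm_apply])
  rw [sum_pairs_blocks (bef o num D₀) s n] at hsign
  simp only [hs0, hs1] at hsign
  have hK : ∏ l : Fin n, X.edgeSign K (p.2 l) (num.symm (p.1 (fstIdx l)))
      (num.symm (p.1 (sndIdx l))) = sgn (∑ l ∈ range n, K.1 (ψ l)) := by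
    rw [sgn_sum, Finset.prod_range]
    refine prod_congr rfl fun l _ => ?_
    rw [← (hf l).1, ← (hf l).2.1, ← (hf l).2.2, edgeSign_eq K (hloop l), hψ]
  have hedge : ∀ l : Fin n, X.edge (ψ l) = p.2 l := fun l => by rw [hψ, (hf l).1]
  have hchain : D.chain = ∑ l ∈ range n, Pi.single (X.edge (ψ l)) 1 := by
    rw [D.chain_eq_sum, hp.sum_eq (fun e => Pi.single (M := fun _ : X.Edge => ZMod 2) e 1),
      Finset.sum_range]
    exact sum_congr rfl fun l _ => by rw [hedge]
  have hq := quad_flags num D₀ ho K ψ n (fun i j hij hj => by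
    have hne : X.edge (ψ j) ≠ X.edge (ψ i) := by
      have h1 := hedge ⟨j, hj⟩
      have h2 := hedge ⟨i, by omega⟩
      simp only at h1 h2
      rw [h1, h2]
      intro h
      have := listing_injective (fun l => (hp l).2) h
      simp only [Fin.mk.injEq] at this
      omega
    exact ⟨fun h => hne (by rw [h]), fun h => hne (by rw [h, X.edge_t0])⟩)
  rw [← hchain] at hq
  have h1 : ∑ l ∈ range n, (if X.edge (ψ l) ∈ D₀.1 then 1 + ω (X.edge (ψ l)) else 0) =
      ∑ e ∈ D.1, if e ∈ D₀.1 then 1 + ω e else 0 := by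
    rw [hp.sum_eq, Finset.sum_range]
    exact sum_congr rfl fun l _ => by rw [hedge]
  have h2 : ∑ l ∈ range n, ((ω (X.edge (ψ l))).val : ZMod 4) = (X.omegaDimer ω D : ZMod 4) := by
    unfold omegaDimer
    rw [hp.sum_eq, Finset.sum_range, Nat.cast_sum]
    exact sum_congr rfl fun l _ => by rw [hedge]
  rw [h1, h2] at hq
  refine ⟨_, by rw [listSign, hsign, hK, ← sgn_add], ?_⟩
  rw [hq]
  congr 2
  generalize (∑ i ∈ range n, bef o num D₀ (ψ i) (X.t0 (ψ i)) + ∑ j ∈ range n, ∑ i ∈ range j,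
          crossing (bef o num D₀) (ψ i) (X.t0 (ψ i)) (ψ j) (X.t0 (ψ j))) = A
  generalize ∑ i ∈ range n, K.1 (ψ i) = B
  generalize (∑ e ∈ D.1, if e ∈ D₀.1 then 1 + ω e else 0) = E
  generalize (n : ZMod 2) = N
  revert A B E N
  decide

/-- The value of `quad` on the chain of D involves no listing, yet it determines the parity of the
sign of any listing. -/
lemma listSign_eq (num : X.Vertex ≃ Fin (2 * n)) (ho : X.IsLabelling ω o)
    (K : X.EdgeOrientation) {D : X.Dimer} {p p' : Equiv.Perm (Fin (2 * n)) × (Fin n → X.Edge)}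
    (hp : X.Lists num D p) (hp' : X.Lists num D p') :
    listSign num K p = listSign num K p' := by
  obtain ⟨t, ht, hq⟩ := quad_dimer num ho D K hp
  obtain ⟨t', ht', hq'⟩ := quad_dimer num ho D K hp'
  rw [hq] at hq'
  have h := two_injective (sub_left_injective hq')
  rw [add_left_inj, add_left_inj] at h
  rw [ht, ht', h]

lemma dimerSign_eq (num : X.Vertex ≃ Fin (2 * n)) (ho : X.IsLabelling ω o)
    (K : X.EdgeOrientation) {D : X.Dimer} {p : Equiv.Perm (Fin (2 * n)) × (Fin n → X.Edge)}
    (hp : X.Lists num D p) : X.dimerSign num K D = listSign num K p := by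
  have h : ∃ p, X.Lists num D p := ⟨p, hp⟩
  unfold dimerSign
  rw [dif_pos h]
  exact listSign_eq num ho K h.choose_spec hp

/-- The total crossing number of two dimer configurations. -/
lemma sum_dualChain_dimers (num : X.Vertex ≃ Fin (2 * n)) (ho : X.IsLabelling ω o)
    (D D₀ : X.Dimer) : ∑ e, D.chain e * dualChain o num D₀ D₀.chain e =
      n + ∑ e ∈ D.1, if e ∈ D₀.1 then 1 + ω e else 0 := by
  -- The roots of `D₀` before φ are one for each vertex of smaller number, and the root of its own
  -- vertex unless this is φ.
  have hpot : ∀ φ, dualPot o num D₀ D₀.chain φ = ((num (X.vert φ)).val : ZMod 2) + 1 +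
      if X.edge φ ∈ D₀.1 then o φ else 0 := by
    intro φ
    obtain ⟨hpv, hpD, hpo⟩ := root_spec ho D₀ (X.vert φ)
    have h1 : bef o num D₀ (root o D₀ (X.vert φ)) φ =
        1 + if X.edge φ ∈ D₀.1 then o φ else 0 := by
      rw [bef_root num D₀ ho hpv hpo hpD]
      by_cases hD : X.edge φ ∈ D₀.1
      · rw [if_pos hD]
        rcases ZMod.two_eq_zero_or_one (o φ) with h | h
        · rw [if_neg, h, add_zero]
          rintro h3; rw [h3, hpo] at h; exact absurd h (by decide)
        · rw [if_pos ((eq_root_iff ho D₀).2 ⟨rfl, hD, h⟩), h]; decide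
      · rw [if_neg hD, if_neg, add_zero]
        rintro h3; rw [h3] at hD; exact hD hpD
    rw [dualPot_dimer num D₀ ho, ← add_sum_erase _ _ (mem_univ (X.vert φ)), h1]
    have h2 : ∑ v ∈ univ.erase (X.vert φ), bef o num D₀ (root o D₀ v) φ =
        ∑ v, if num v < num (X.vert φ) then (1 : ZMod 2) else 0 := by
      rw [← add_sum_erase univ (fun v => if num v < num (X.vert φ) then (1 : ZMod 2) else 0)
        (mem_univ (X.vert φ)), if_neg (lt_irrefl _), zero_add]
      refine sum_congr rfl fun v hv => ?_
      have hv' := (mem_erase.1 hv).1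
      rw [bef_of_vert_ne num D₀ (by rwa [(root_spec ho D₀ v).1]), (root_spec ho D₀ v).1]
    have h3 : ∑ v, (if num v < num (X.vert φ) then (1 : ZMod 2) else 0) =
        ((num (X.vert φ)).val : ZMod 2) := by
      rw [Equiv.sum_comp num (fun i => if i < num (X.vert φ) then (1 : ZMod 2) else 0),
        sum_boole]
      congr 1
      rw [← Fin.card_Iio (num (X.vert φ))]
      congr 1
      ext i
      simp
    rw [h2, h3]
    ring
  -- D meets each vertex once, so the part of the potential that depends on the vertex is summed
  -- over all vertices, giving n modulo 2.
  have hsum : ∑ e, D.chain e * dualChain o num D₀ D₀.chain e =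
      ∑ χ with o χ = 1, (if X.edge χ ∈ D.1 then ((num (X.vert χ)).val : ZMod 2) + 1 else 0) +
      ∑ e, D.chain e * (if e ∈ D₀.1 then 1 + ω e else 0) := by
    rw [sum_half_edges ho _ (fun φ => by rw [X.edge_t2, X.vert_t2])
      (fun e => D.chain e * (dualChain o num D₀ D₀.chain e + if e ∈ D₀.1 then 1 + ω e else 0)),
      ← sum_add_distrib]
    · refine sum_congr rfl fun e _ => ?_
      rw [← mul_add, add_assoc, ZMod.two_add_self, add_zero]
    · intro φ
      rw [dualChain_edge num D₀ ho, hpot, hpot, X.edge_t0, ho.t0]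
      unfold Dimer.chain
      generalize o φ = x
      generalize ω (X.edge φ) = w
      generalize ((num (X.vert φ)).val : ZMod 2) = a
      generalize ((num (X.vert (X.t0 φ))).val : ZMod 2) = b
      split_ifs
      · revert x w a b; decide
      · revert a b; decide
      · simp
      · simp
  rw [hsum, sum_flags_dimer ho D (fun χ => ((num (X.vert χ)).val : ZMod 2) + 1)]
  congr 1
  · simp only [(root_spec ho D _).1]
    rw [Equiv.sum_comp num (fun i => (i.val : ZMod 2) + 1), sum_add_distrib,
      ← Finset.sum_range (fun i => (i : ZMod 2)), sum_range_two_mul_cast]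
    simp only [sum_const, card_univ, Fintype.card_fin, nsmul_eq_mul, mul_one]
    push_cast
    rw [show (2 : ZMod 2) = 0 from by decide, zero_mul, add_zero]
  · simp only [Dimer.chain, ite_mul, one_mul, zero_mul]
    rw [← sum_filter]
    simp

/-- The signs of two dimer configurations and the quadratic enhancement. -/
lemma enhancement_dimers (num : X.Vertex ≃ Fin (2 * n)) (ho : X.IsLabelling ω o)
    (K : X.Kasteleyn ω o) (D D₀ : X.Dimer)
    (hD : ∃ p, X.Lists num D p) (hD₀ : ∃ p, X.Lists num D₀ p) :
    iz (-X.enhancement ω o K.1 D₀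
      (X.homologyClass ⟨D₀.chain + D.chain, dimer_add_mem ho D₀ D⟩)) =
      (-Complex.I) ^ X.omegaDimer ω D₀ * (X.dimerSign num K.1 D₀ : ℂ) *
        ((X.dimerSign num K.1 D : ℂ) * Complex.I ^ X.omegaDimer ω D) := by
  obtain ⟨p, hp⟩ := hD
  obtain ⟨p₀, hp₀⟩ := hD₀
  obtain ⟨t, ht, hq⟩ := quad_dimer num ho D₀ K.1 hp
  obtain ⟨t₀, ht₀, hq₀⟩ := quad_dimer num ho D₀ K.1 hp₀
  have h1 : ∑ e ∈ D₀.1, (if e ∈ D₀.1 then 1 + ω e else 0) = n + ∑ e ∈ D₀.1, ω e := by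
    rw [sum_congr rfl fun e he => if_pos he, sum_add_distrib, hp₀.sum_eq (fun _ => (1 : ZMod 2))]
    simp
  have h2 : two (∑ e ∈ D₀.1, ω e) = 2 * (X.omegaDimer ω D₀ : ZMod 4) := by
    unfold omegaDimer
    rw [map_sum, Nat.cast_sum, mul_sum]
    rfl
  -- The mixed term of `quad_add` cancels the contributions of n and of the common edges, leaving
  -- only the two signs and the numbers of 1-edges.
  have h3 : -X.enhancement ω o K.1 D₀
      (X.homologyClass ⟨D₀.chain + D.chain, dimer_add_mem ho D₀ D⟩) =
      two t + two t₀ + (X.omegaDimer ω D : ZMod 4) - (X.omegaDimer ω D₀ : ZMod 4) := by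
    rw [enhancement_eq_quad num D₀ ho]
    simp only
    rw [add_comm, quad_add num D₀ ho, hq, hq₀, h1, sum_dualChain_dimers num ho]
    simp only [map_add, h2]
    have hA : ∀ x : ZMod 2, two x + two x = 0 := by decide
    have e1 := hA t₀
    have e2 := hA (n : ZMod 2)
    have e3 := hA (∑ e ∈ D.1, if e ∈ D₀.1 then 1 + ω e else 0)
    have e4 := hA t
    linear_combination -e4 - e1 - 2 * e2 - e3
  have h5 : iz (-(X.omegaDimer ω D₀ : ZMod 4)) = (-Complex.I) ^ X.omegaDimer ω D₀ := by
    rw [← conj_iz, iz_natCast, map_pow, Complex.conj_I]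
  rw [h3, sub_eq_add_neg, iz_add, iz_add, iz_add, iz_two, iz_two, iz_natCast, h5,
    dimerSign_eq num ho K.1 hp, dimerSign_eq num ho K.1 hp₀, ht, ht₀]
  ring

end

end SurfaceGraph

/-! ### Counting listings -/

lemma cycleType_of_fixedPointFree {n : ℕ} {s : Equiv.Perm (Fin (2 * n))} (h : ∀ i, s (s i) = i)
    (h' : ∀ i, s i ≠ i) : s.cycleType = Multiset.replicate n 2 := by
  have h2 : s ^ 2 = 1 := by
    ext i; rw [pow_two, Equiv.Perm.mul_apply, h, Equiv.Perm.one_apply]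
  have h3 := Equiv.Perm.cycleType_of_pow_prime_eq_one (p := 2) h2
  have h4 := s.sum_cycleType
  have h5 : s.support = univ := by ext i; simp [h']
  rw [h3, h5, card_univ, Fintype.card_fin, Multiset.sum_replicate, smul_eq_mul] at h4
  rw [h3, show s.cycleType.card = n by omega]

/-- Two fixed-point-free involutions are conjugate, so the intertwiners form a coset of the
centralizer of one of them. -/
lemma card_intertwiners {n : ℕ} {s m : Equiv.Perm (Fin (2 * n))} (hs : ∀ i, s (s i) = i)
    (hs' : ∀ i, s i ≠ i) (hm : ∀ i, m (m i) = i) (hm' : ∀ i, m i ≠ i) :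
    Fintype.card {σ : Equiv.Perm (Fin (2 * n)) // ∀ i, σ (s i) = m (σ i)} =
      2 ^ n * n.factorial := by
  have hct := cycleType_of_fixedPointFree hs hs'
  obtain ⟨τ, hτ⟩ := isConj_iff.1 (Equiv.Perm.isConj_iff_cycleType_eq.2
    (hct.trans (cycleType_of_fixedPointFree hm hm').symm))
  have e : {σ : Equiv.Perm (Fin (2 * n)) // ∀ i, σ (s i) = m (σ i)} ≃
      Subgroup.centralizer {s} := by
    refine (Equiv.mulLeft τ⁻¹).subtypeEquiv fun σ => ?_
    rw [Subgroup.mem_centralizer_singleton_iff, Equiv.coe_mulLeft, ← hτ]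
    constructor
    · intro h
      have h' : σ * s = τ * s * τ⁻¹ * σ := Equiv.ext h
      rw [mul_assoc τ⁻¹, h']
      group
    · intro h i
      have h' : σ * s = τ * s * τ⁻¹ * σ := by
        rw [mul_assoc τ⁻¹, inv_mul_eq_iff_eq_mul] at h
        rw [h]; group
      exact congrArg (fun f => f i) h'
  rw [← Nat.card_eq_fintype_card, Nat.card_congr e, Equiv.Perm.nat_card_centralizer, hct]
  rcases n.eq_zero_or_pos with rfl | hn
  · simp
  · rw [Multiset.toFinset_replicate, if_neg hn.ne', Multiset.sum_replicate,
      Multiset.prod_replicate, prod_singleton, Multiset.count_replicate_self, Fintype.card_fin]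
    simp [mul_comm]

namespace SurfaceGraph

noncomputable section

open Classical

variable {F : Type*} {X : SurfaceGraph F} [Fintype F]
  {ω : X.Edge → ZMod 2} {o : F → ZMod 2} {n : ℕ}

/-- The permutation exchanging the two elements of each pair in `Fin (2 * n)`. -/
def pairSwap (n : ℕ) : Equiv.Perm (Fin (2 * n)) :=
  Function.Involutive.toPerm
    (fun i => if h : i.1 % 2 = 0 then ⟨i.1 + 1, by omega⟩ else ⟨i.1 - 1, by omega⟩) (by
      intro i
      apply Fin.ext
      by_cases h : i.1 % 2 = 0
      · simp only [h, dif_pos]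
        rw [dif_neg (by omega)]
        simp
      · simp only [h, dif_neg, not_false_iff]
        rw [dif_pos (by omega)]
        simp only
        omega)

lemma pairSwap_fst (l : Fin n) : pairSwap n (fstIdx l) = sndIdx l := by
  have h : (fstIdx l).1 % 2 = 0 := by unfold fstIdx; simp
  exact dif_pos h

lemma pairSwap_pairSwap (i : Fin (2 * n)) : pairSwap n (pairSwap n i) = i :=
  Function.Involutive.toPerm_involutive _ i

lemma pairSwap_snd (l : Fin n) : pairSwap n (sndIdx l) = fstIdx l := by
  rw [← pairSwap_fst, pairSwap_pairSwap]

lemma pairSwap_ne (i : Fin (2 * n)) : pairSwap n i ≠ i := by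
  have h : ∀ l : Fin n, fstIdx l ≠ sndIdx l := fun l h => by
    have := congrArg Fin.val h
    unfold fstIdx sndIdx at this
    simp only at this
    omega
  obtain ⟨l, rfl | rfl⟩ := exists_idx_of_fin i
  · rw [pairSwap_fst]; exact (h l).symm
  · rw [pairSwap_snd]; exact h l

/-- The vertex matched with `v`. -/
def partner (o : F → ZMod 2) (D : X.Dimer) (v : X.Vertex) : X.Vertex := X.vert (X.t0 (root o D v))

lemma joins_partner (ho : X.IsLabelling ω o) (D : X.Dimer) (v : X.Vertex) :
    X.Joins (X.edge (root o D v)) v (partner o D v) :=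
  ⟨_, rfl, (root_spec ho D v).1, rfl⟩

lemma Dimer.joins_iff (ho : X.IsLabelling ω o) (D : X.Dimer) {e : X.Edge} {u v : X.Vertex} :
    (e ∈ D.1 ∧ X.Joins e u v) ↔ v = partner o D u ∧ e = X.edge (root o D u) := by
  obtain ⟨h1, h2, -⟩ := root_spec ho D u
  constructor
  · rintro ⟨he, φ, rfl, rfl, rfl⟩
    rcases D.eq_or_eq_t2 h1.symm he h2 with h | h
    · exact ⟨congrArg (fun φ => X.vert (X.t0 φ)) h, congrArg X.edge h⟩
    · constructor
      · conv_lhs => rw [h, X.t0_t2, X.vert_t2]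
        rfl
      · conv_lhs => rw [h, X.edge_t2]
  · rintro ⟨rfl, rfl⟩
    exact ⟨h2, joins_partner ho D u⟩

lemma Joins.symm {e : X.Edge} {u v : X.Vertex} (h : X.Joins e u v) : X.Joins e v u := by
  obtain ⟨φ, rfl, rfl, rfl⟩ := h
  exact ⟨X.t0 φ, X.edge_t0 φ, rfl, by rw [X.t0_t0]⟩

lemma partner_partner (ho : X.IsLabelling ω o) (D : X.Dimer) (v : X.Vertex) :
    partner o D (partner o D v) = v :=
  ((D.joins_iff ho).1 ⟨(root_spec ho D v).2.1, (joins_partner ho D v).symm⟩).1.symm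

lemma partner_ne (ho : X.IsLabelling ω o) (D : X.Dimer) (v : X.Vertex) : partner o D v ≠ v :=
  (D.2.2 _ (root_spec ho D v).2.1 _ _ (joins_partner ho D v)).symm

/-- The permutation determines the edges, and it has to carry the standard pairing to the matching
of D. Listings are thereby counted as intertwiners. -/
lemma lists_iff (num : X.Vertex ≃ Fin (2 * n)) (ho : X.IsLabelling ω o) (D : X.Dimer)
    (p : Equiv.Perm (Fin (2 * n)) × (Fin n → X.Edge)) :
    X.Lists num D p ↔ (∀ i, p.1 (pairSwap n i) = num (partner o D (num.symm (p.1 i)))) ∧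
      p.2 = fun l => X.edge (root o D (num.symm (p.1 (fstIdx l)))) := by
  unfold Lists
  simp only [D.joins_iff ho, Equiv.symm_apply_eq, forall_and, funext_iff]
  refine and_congr_left fun _ => ⟨fun h i => ?_, fun h l => ?_⟩
  · obtain ⟨l, rfl | rfl⟩ := exists_idx_of_fin i
    · rw [pairSwap_fst, h]
    · rw [pairSwap_snd, h, Equiv.symm_apply_apply, partner_partner ho, Equiv.apply_symm_apply]
  · rw [← h, pairSwap_fst]

lemma card_lists (num : X.Vertex ≃ Fin (2 * n)) (ho : X.IsLabelling ω o) (D : X.Dimer) :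
    #{p | X.Lists num D p} = 2 ^ n * n.factorial := by
  let m : Equiv.Perm (Fin (2 * n)) :=
    Function.Involutive.toPerm (fun i => num (partner o D (num.symm i))) (fun i => by
      simp only [Equiv.symm_apply_apply, partner_partner ho, Equiv.apply_symm_apply])
  rw [← card_intertwiners (s := pairSwap n) (m := m) pairSwap_pairSwap pairSwap_ne
    (Function.Involutive.toPerm_involutive _)
    (fun i h => partner_ne ho D (num.symm i) ((Equiv.eq_symm_apply num).2 h)),
    Fintype.card_subtype]
  refine card_nbij' Prod.fst
    (fun σ => (σ, fun l => X.edge (root o D (num.symm (σ (fstIdx l)))))) ?_ ?_ ?_ ?_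
  · intro p hp
    simp only [coe_filter, mem_univ, true_and, Set.mem_ofPred_eq, lists_iff num ho] at hp ⊢
    exact hp.1
  · intro σ hσ
    simp only [coe_filter, mem_univ, true_and, Set.mem_ofPred_eq, lists_iff num ho] at hσ ⊢
    exact ⟨hσ, trivial⟩
  · intro p hp
    simp only [coe_filter, mem_univ, true_and, Set.mem_ofPred_eq, lists_iff num ho] at hp
    exact Prod.ext rfl hp.2.symm
  · intro σ _
    rfl

lemma exists_lists (num : X.Vertex ≃ Fin (2 * n)) (ho : X.IsLabelling ω o) (D : X.Dimer) :
    ∃ p, X.Lists num D p := by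
  have h : 0 < #{p | X.Lists num D p} := by
    rw [card_lists num ho]; positivity
  obtain ⟨p, hp⟩ := card_pos.1 h
  exact ⟨p, by simpa using hp⟩

/-! ### The expansion of the Pfaffian -/

lemma joins_of_edgeSign_ne {K : X.EdgeOrientation} {e : X.Edge} {u v : X.Vertex}
    (h : X.edgeSign K e u v ≠ 0) : X.Joins e u v := by
  by_cases h1 : X.OrientedFromTo K e u v
  · obtain ⟨φ, h1, h2, h3, -⟩ := h1; exact ⟨φ, h1, h2, h3⟩
  · by_cases h2 : X.OrientedFromTo K e v u
    · obtain ⟨φ, h1, h2, h3, -⟩ := h2; exact Joins.symm ⟨φ, h1, h2, h3⟩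
    · exact absurd (by simp [edgeSign, h1, h2]) h

lemma exists_dimer_of_joins {num : X.Vertex ≃ Fin (2 * n)}
    {p : Equiv.Perm (Fin (2 * n)) × (Fin n → X.Edge)}
    (hp : ∀ l, X.Joins (p.2 l) (num.symm (p.1 (fstIdx l))) (num.symm (p.1 (sndIdx l)))) :
    ∃ D, X.Lists num D p := by
  have hends : ∀ l u, (∃ v, X.Joins (p.2 l) u v) ↔
      p.1.symm (num u) = fstIdx l ∨ p.1.symm (num u) = sndIdx l := by
    intro l u
    rw [Equiv.symm_apply_eq, Equiv.symm_apply_eq, ← Equiv.eq_symm_apply, ← Equiv.eq_symm_apply]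
    constructor
    · rintro ⟨v, h⟩
      exact joins_ends (hp l) h
    · rintro (rfl | rfl)
      · exact ⟨_, hp l⟩
      · exact ⟨_, (hp l).symm⟩
  have hidx : ∀ (i : Fin (2 * n)) (l l' : Fin n), (i = fstIdx l ∨ i = sndIdx l) →
      (i = fstIdx l' ∨ i = sndIdx l') → l = l' := by
    intro i l l' h h'
    unfold fstIdx sndIdx at h h'
    rw [Fin.ext_iff, Fin.ext_iff] at h h'
    apply Fin.ext
    simp only at h h'
    omega
  refine ⟨⟨univ.image p.2, fun u => ?_, ?_⟩, fun l => ⟨mem_image_of_mem _ (mem_univ l), hp l⟩⟩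
  · obtain ⟨l, hl⟩ := exists_idx_of_fin (p.1.symm (num u))
    refine ⟨p.2 l, ⟨mem_image_of_mem _ (mem_univ l), (hends l u).2 hl⟩, ?_⟩
    rintro e ⟨he, hv⟩
    obtain ⟨l', -, rfl⟩ := mem_image.1 he
    rw [hidx _ _ _ hl ((hends l' u).1 hv)]
  · intro e he u v huv
    obtain ⟨l, -, rfl⟩ := mem_image.1 he
    rintro rfl
    have hne : num.symm (p.1 (fstIdx l)) ≠ num.symm (p.1 (sndIdx l)) := fun h => by
      have := p.1.injective (num.symm.injective h)
      rw [← pairSwap_fst] at this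
      exact pairSwap_ne _ this.symm
    have h1 : ∀ v', X.Joins (p.2 l) v' (num.symm (p.1 (sndIdx l))) → v' = u := fun v' h => by
      rcases joins_ends huv h with h | h <;> exact h
    have h2 : ∀ v', X.Joins (p.2 l) v' (num.symm (p.1 (fstIdx l))) → v' = u := fun v' h => by
      rcases joins_ends huv h with h | h <;> exact h
    exact hne ((h1 _ (hp l)).trans (h2 _ (hp l).symm).symm)

/-- Expanding the entries of the matrix over edges gives a sum over pairs of a permutation and a
family of edges. A nonzero term lists exactly one dimer configuration, and each configuration has
2^n n! listings, all of the same sign. -/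
lemma pfaffian_kasteleynMatrix (num : X.Vertex ≃ Fin (2 * n)) (ho : X.IsLabelling ω o)
    (w : X.Edge → ℝ) (K : X.EdgeOrientation) :
    pfaffian (X.kasteleynMatrix num w ω K) = ∑ D : X.Dimer,
      (X.dimerSign num K D : ℂ) * Complex.I ^ X.omegaDimer ω D * ∏ e ∈ D.1, (w e : ℂ) := by
  let T : Equiv.Perm (Fin (2 * n)) × (Fin n → X.Edge) → ℂ := fun p =>
    (listSign num K p : ℂ) * ∏ l, (Complex.I ^ (ω (p.2 l)).val * (w (p.2 l) : ℂ))
  have hT : ∀ p, T p = ∑ D, if X.Lists num D p then T p else 0 := by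
    intro p
    by_cases h : ∀ l, X.Joins (p.2 l) (num.symm (p.1 (fstIdx l))) (num.symm (p.1 (sndIdx l)))
    · obtain ⟨D, hD⟩ := exists_dimer_of_joins h
      rw [sum_eq_single D, if_pos hD]
      · intro D' _ hne
        exact if_neg fun hD' => hne (Subtype.ext (hD'.image_eq.trans hD.image_eq.symm))
      · simp
    · push Not at h
      obtain ⟨l, hl⟩ := h
      have h0 : X.edgeSign K (p.2 l) (num.symm (p.1 (fstIdx l)))
          (num.symm (p.1 (sndIdx l))) = 0 := by
        by_contra h; exact hl (joins_of_edgeSign_ne h)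
      have h1 : T p = 0 := by
        simp only [T, listSign]
        rw [prod_eq_zero (mem_univ l) h0]
        simp
      rw [h1]; simp
  have hD : ∀ D : X.Dimer, ∑ p, (if X.Lists num D p then T p else 0) =
      ((2 : ℂ) ^ n * (n.factorial : ℂ)) * ((X.dimerSign num K D : ℂ) *
        Complex.I ^ X.omegaDimer ω D * ∏ e ∈ D.1, (w e : ℂ)) := by
    intro D
    rw [← sum_filter, sum_congr rfl (g := fun _ => (X.dimerSign num K D : ℂ) *
        Complex.I ^ X.omegaDimer ω D * ∏ e ∈ D.1, (w e : ℂ)), sum_const, card_lists num ho,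
      nsmul_eq_mul]
    · push_cast; rfl
    · intro p hp
      have hp' : X.Lists num D p := by simpa using hp
      simp only [T]
      rw [dimerSign_eq num ho K hp', prod_mul_distrib, hp'.prod_eq, omegaDimer, hp'.sum_eq,
        prod_pow_eq_pow_sum, mul_assoc]
  have hsum : ∑ σ : Equiv.Perm (Fin (2 * n)), ((Equiv.Perm.sign σ : ℤ) : ℂ) *
      ∏ l : Fin n, X.kasteleynMatrix num w ω K (σ (fstIdx l)) (σ (sndIdx l)) = ∑ p, T p := by
    rw [Fintype.sum_prod_type]
    refine sum_congr rfl fun σ _ => ?_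
    unfold kasteleynMatrix
    rw [prod_univ_sum, Fintype.piFinset_univ, mul_sum]
    refine sum_congr rfl fun e _ => ?_
    simp only [T, listSign]
    push_cast
    rw [mul_assoc, ← prod_mul_distrib]
    simp only [mul_assoc]
  rw [pfaffian, hsum, sum_congr rfl fun p _ => hT p, sum_comm, sum_congr rfl fun D _ => hD D,
    ← mul_sum, ← mul_assoc, one_div, inv_mul_cancel₀, one_mul]
  exact mul_ne_zero (pow_ne_zero _ two_ne_zero) (Nat.cast_ne_zero.2 n.factorial_ne_zero)

end

end SurfaceGraph

namespace SurfaceGraph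

noncomputable section

open Classical

variable {F : Type*} {X : SurfaceGraph F} [Fintype F]
  {ω : X.Edge → ZMod 2} {o : F → ZMod 2} {n : ℕ}

/-! ### The Pfaffian formula -/

/-- The homology class of the superposition of two dimer configurations. -/
def superposition (ho : X.IsLabelling ω o) (D D' : X.Dimer) : X.H1 :=
  X.homologyClass ⟨D.chain + D'.chain, dimer_add_mem ho D D'⟩

lemma superposition_add (ho : X.IsLabelling ω o) (D D₀ D₁ : X.Dimer) :
    superposition ho D₁ D + superposition ho D₀ D₁ = superposition ho D₀ D := by
  unfold superposition
  rw [← homologyClass_add]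
  congr 1
  apply Subtype.ext
  funext e
  simp only [Submodule.coe_add, Pi.add_apply]
  have h := ZMod.two_add_self (D₁.chain e)
  linear_combination h

/-- All signs and powers of i are absorbed into one value of the enhancement for each D, the form
needed for summing over K. -/
lemma pfaffianTerm_eq (num : X.Vertex ≃ Fin (2 * n)) (ho : X.IsLabelling ω o) (w : X.Edge → ℝ)
    (D₀ : X.Dimer) (K : X.Kasteleyn ω o) :
    (-Complex.I) ^ X.omegaDimer ω D₀ * X.pfaffianTerm num w ω o D₀ K.1 =
      (1 / (Real.sqrt (Fintype.card X.H1) : ℂ)) * ∑ D : X.Dimer,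
        (∑ x, iz (X.enhancement ω o K.1 D₀ x)) *
          iz (-X.enhancement ω o K.1 D₀ (superposition ho D₀ D)) * ∏ e ∈ D.1, (w e : ℂ) := by
  unfold pfaffianTerm superposition
  rw [brown_enhancement num ho, pfaffian_kasteleynMatrix num ho]
  generalize ∑ x, iz (X.enhancement ω o K.1 D₀ x) = G
  rw [mul_sum, mul_sum, mul_sum]
  refine sum_congr rfl fun D _ => ?_
  rw [enhancement_dimers num ho K D D₀ (exists_lists num ho D) (exists_lists num ho D₀)]
  ring

lemma partitionFunction_eq (num : X.Vertex ≃ Fin (2 * n)) (ho : X.IsLabelling ω o)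
    (w : X.Edge → ℝ) (D₀ : X.Dimer) : (X.partitionFunction w : ℂ) =
      (-Complex.I) ^ X.omegaDimer ω D₀ / (((2 : ℝ) ^ ((X.b1 : ℝ) / 2) : ℝ) : ℂ) *
        ∑ κ : X.KasteleynClass ω o, X.pfaffianTerm num w ω o D₀ (Quotient.out κ).1 := by
  have hcard : (2 : ℝ) ^ ((X.b1 : ℝ) / 2) = Real.sqrt (Fintype.card X.H1) := by
    rw [card_H1, Real.sqrt_eq_rpow]
    push_cast
    rw [← Real.rpow_natCast, ← Real.rpow_mul two_pos.le, mul_one_div]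
  have hpos : (0 : ℝ) < Fintype.card X.H1 := Nat.cast_pos.2 Fintype.card_pos
  have hne : (Real.sqrt (Fintype.card X.H1) : ℂ) ≠ 0 :=
    Complex.ofReal_ne_zero.2 (Real.sqrt_pos.2 hpos).ne'
  have hsq : (Real.sqrt (Fintype.card X.H1) : ℂ) * Real.sqrt (Fintype.card X.H1) =
      Fintype.card X.H1 := by
    rw [← Complex.ofReal_mul, Real.mul_self_sqrt hpos.le, Complex.ofReal_natCast]
  have hsum : (-Complex.I) ^ X.omegaDimer ω D₀ *
      ∑ κ : X.KasteleynClass ω o, X.pfaffianTerm num w ω o D₀ (Quotient.out κ).1 =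
      (1 / (Real.sqrt (Fintype.card X.H1) : ℂ)) * ∑ D : X.Dimer,
        (Fintype.card X.H1 : ℂ) * ∏ e ∈ D.1, (w e : ℂ) := by
    refine (mul_sum _ _ _).trans ((sum_congr rfl fun (κ : X.KasteleynClass ω o) _ =>
      pfaffianTerm_eq num ho w D₀ (Quotient.out κ)).trans ((mul_sum _ _ _).symm.trans ?_))
    congr 1
    refine sum_comm.trans ?_
    refine sum_congr rfl fun D _ => ?_
    rw [← sum_mul, ← sum_kasteleyn num ho D₀ (superposition ho D₀ D)]
  rw [hcard, div_mul_eq_mul_div, hsum, ← mul_sum, ← hsq, partitionFunction]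
  push_cast
  field_simp

lemma pfaffianTerm_of_equivalent (num : X.Vertex ≃ Fin (2 * n)) (ho : X.IsLabelling ω o)
    (w : X.Edge → ℝ) {K K' : X.Kasteleyn ω o} (h : X.Equivalent K.1 K'.1) (D₀ : X.Dimer) :
    X.pfaffianTerm num w ω o D₀ K.1 = X.pfaffianTerm num w ω o D₀ K'.1 := by
  refine mul_left_cancel₀
    (pow_ne_zero (X.omegaDimer ω D₀) (neg_ne_zero.2 Complex.I_ne_zero)) ?_
  rw [pfaffianTerm_eq num ho, pfaffianTerm_eq num ho, enhancement_of_equivalent num ho h]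

/-- The linear term added by the change of dimers is the polarization at the superposition, so the
new enhancement is a translate of the old one. -/
lemma enhancement_eq_sub (num : X.Vertex ≃ Fin (2 * n)) (ho : X.IsLabelling ω o)
    (K : X.Kasteleyn ω o) (D₀ D₁ : X.Dimer) (a : X.H1) : X.enhancement ω o K.1 D₁ a =
      X.enhancement ω o K.1 D₀ (a + superposition ho D₀ D₁) -
        X.enhancement ω o K.1 D₀ (superposition ho D₀ D₁) := by
  rw [enhancement_change_dimer num ho K D₀ D₁ a, (enhancement_spec num ho K D₀).1 a, two_eq]
  unfold superposition
  ring

lemma pfaffianTerm_change_dimer (num : X.Vertex ≃ Fin (2 * n)) (ho : X.IsLabelling ω o)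
    (w : X.Edge → ℝ) (K : X.Kasteleyn ω o) (D₀ D₁ : X.Dimer) :
    (-Complex.I) ^ X.omegaDimer ω D₀ * X.pfaffianTerm num w ω o D₀ K.1 =
      (-Complex.I) ^ X.omegaDimer ω D₁ * X.pfaffianTerm num w ω o D₁ K.1 := by
  rw [pfaffianTerm_eq num ho w D₀, pfaffianTerm_eq num ho w D₁]
  refine congrArg _ (sum_congr rfl fun D _ => ?_)
  have hq := enhancement_eq_sub num ho K D₀ D₁
  -- Translation multiplies the Gauss sum by i^(-q(s)), with s the superposition class; the factor
  -- attached to each D is multiplied by the inverse.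
  have hG : ∑ x, iz (X.enhancement ω o K.1 D₁ x) = (∑ x, iz (X.enhancement ω o K.1 D₀ x)) *
      iz (-X.enhancement ω o K.1 D₀ (superposition ho D₀ D₁)) := by
    simp only [hq, sub_eq_add_neg, iz_add]
    rw [← sum_mul]
    exact congrArg (· * _) (Equiv.sum_comp (Equiv.addRight (superposition ho D₀ D₁))
      (fun x => iz (X.enhancement ω o K.1 D₀ x)))
  rw [hG, hq, superposition_add, neg_sub, sub_eq_add_neg, iz_add]
  have h := iz_mul_neg (X.enhancement ω o K.1 D₀ (superposition ho D₀ D₁))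
  generalize iz (X.enhancement ω o K.1 D₀ (superposition ho D₀ D₁)) = a at h ⊢
  generalize iz (-X.enhancement ω o K.1 D₀ (superposition ho D₀ D₁)) = b at h ⊢
  generalize iz (-X.enhancement ω o K.1 D₀ (superposition ho D₀ D)) = c
  generalize ∑ x, iz (X.enhancement ω o K.1 D₀ x) = G
  linear_combination (-G * c * ∏ e ∈ D.1, (w e : ℂ)) * h

end

end SurfaceGraph

/-! ### The main theorem -/

theorem mainTheorem2 {F : Type*} [Fintype F] (X : SurfaceGraph F)
    (w : X.Edge → ℝ) (hw : ∀ e, 0 < w e)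
    (n : ℕ) (num : X.Vertex ≃ Fin (2 * n))
    (ω : X.Edge → ZMod 2) (hω : X.RepresentsW1 ω) :
    (∃ o : F → ZMod 2, X.IsLabelling ω o) ∧
    ∀ o : F → ZMod 2, X.IsLabelling ω o →
      -- the quadratic enhancement of each Kasteleyn orientation and dimer configuration exists
      -- and is determined by its values on simple closed curves
      (∀ (K : X.Kasteleyn ω o) (D : X.Dimer), ∃! q, X.IsEnhancementOf ω o K.1 D q) ∧
      -- the Pfaffian formula
      (∀ D₀ : X.Dimer, (X.partitionFunction w : ℂ) =
        (-Complex.I) ^ X.omegaDimer ω D₀ / (((2 : ℝ) ^ ((X.b1 : ℝ) / 2) : ℝ) : ℂ) *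
          ∑ κ : X.KasteleynClass ω o, X.pfaffianTerm num w ω o D₀ (Quotient.out κ).1) ∧
      -- the summands depend neither on the representatives nor on the dimer configuration
      (∀ K K' : X.Kasteleyn ω o, X.Equivalent K.1 K'.1 → ∀ D₀ : X.Dimer,
        X.pfaffianTerm num w ω o D₀ K.1 = X.pfaffianTerm num w ω o D₀ K'.1) ∧
      (∀ (K : X.Kasteleyn ω o) (D₀ D₁ : X.Dimer),
        (-Complex.I) ^ X.omegaDimer ω D₀ * X.pfaffianTerm num w ω o D₀ K.1 =
          (-Complex.I) ^ X.omegaDimer ω D₁ * X.pfaffianTerm num w ω o D₁ K.1) := by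
  refine ⟨X.exists_isLabelling hω, fun o ho => ⟨fun K D => ?_, fun D₀ => ?_, fun K K' h D₀ => ?_,
    fun K D₀ D₁ => ?_⟩⟩
  · exact SurfaceGraph.existsUnique_isEnhancementOf num D ho K
  · exact SurfaceGraph.partitionFunction_eq num ho w D₀
  · exact SurfaceGraph.pfaffianTerm_of_equivalent num ho w h D₀
  · exact SurfaceGraph.pfaffianTerm_change_dimer num ho w K D₀ D₁
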